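/- **Model.** For each sample size $n$ there is a population $\mathcal D_N$ of $N=N_n\ge n$ agents located in $\mathbb R^d$ ($d\ge1$), with a non-random $0$-$1$ adjacency matrix $(A_{i,j})$ with zero diagonal, reference groups $\mathcal P_i=\{j:A_{i,j}=1\}\neq\emptyset$, $\overline{\mathcal P}_i=\{i\}\cup\mathcal P_i$, and weights $a_{i,j}\ge 0$ with $a_{i,j}>0$ iff $j\in\mathcal P_i$ and $\sum_j a_{i,j}=1$. The first $n$ agents form the estimation sample. With covariates $X_i\in\mathbb R^{dx}$, instruments $Z_i\in\mathbb R^{dz}$ and unobservables $U_i\in(0,1)$, $\epsilon_i\in\mathbb R$, let $$T_i=\pi(X_i,Z_i)+\eta(U_i),\qquad S_i=m_i\Big(\sum_{j\in\mathcal P_i}a_{i,j}T_j\Big),\qquad Y_i=X_i^\top\beta(T_i,S_i)+g(T_i,S_i)\,\epsilon_i ,$$ where $\pi$ is measurable, $\eta$ is continuous and strictly increasing on $(0,1)$ and the $m_i$ are continuous and strictly increasing. $V_i$ is the unique $v\in(0,1)$ with $\eta(v)=\sum_{j\in\mathcal P_i}a_{i,j}\eta(U_j)$. $T_i$ takes values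 in a closed interval $\mathcal T$ and, for $i\le n$, $S_i$ takes values in a closed set $\mathcal S$; $\mathcal{TS}=\mathcal T\times\mathcal S$. Let $\mathcal F_N=\sigma(X_i,Z_i,U_i:i\in\mathcal D_N)$. For $i\le n$: $(Z_j,X_j)_{j\in\overline{\mathcal P}_i}$ is independent of $((U_j)_{j\in\overline{\mathcal P}_i},\epsilon_i)$, the pairs $(U_i,V_i)$ have a common law (that of $(U,V)$, which may depend on $n$), $\mathbb E[\epsilon_i\mid U_i,V_i]=\lambda(U_i,V_i)$, and $\mathbb E[\epsilon_i]=0$. **Estimator.** Let $P_T,P_S,P_U,P_V$ be vectors of $K_T,K_S,K_U,K_V\ge1$ univariate basis functions (depending on $n$), $P_{TS}=P_T\otimes P_S$, $P_{UV}=P_U\otimes P_V$, $K_{TS}=K_TK_S$, $K_{UV}=K_UK_V$, $\overline P_{UV}=P_{UV}-\mathbb E[P_{UV}(U,V)]$. Let $\hat U_i,\hat V_i$ be $[0,1]$-valued, $\mathcal F_N$-measurable estimators of $U_i,V_i$ (for instance, any estimators computed from the data $(X_j,Z_j,T_j)$ of the treatment equation), $\hat P_{UV}=P_{UV}-\frac1n\sum_{i=1}^nP_{UV}(\hat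 U_i,\hat V_i)$, and let $\hat{\mathbf\Pi}_n$ and $\mathbf\Pi_n$ be the matrices with rows $\big((X_i\otimes P_{TS}(T_i,S_i))^\top,(P_{TS}(T_i,S_i)\otimes\hat P_{UV}(\hat U_i,\hat V_i))^\top\big)$ and $\big((X_i\otimes P_{TS}(T_i,S_i))^\top,(P_{TS}(T_i,S_i)\otimes\overline P_{UV}(U_i,V_i))^\top\big)$, $i=1,\dots,n$. With non-random symmetric positive semidefinite $\mathbf D$ (depending on $n$) such that $\rho_{\max}(\mathbf D)=O(1)$, and $\tau_n\ge0$, $\tau_n\to0$, put $$\hat\theta_n=(\hat\theta_{n,\beta}^\top,\hat\theta_{n,g\lambda}^\top)^\top=\big[\hat{\mathbf\Pi}_n^\top\hat{\mathbf\Pi}_n+\tau_n\mathbf D n\big]^{-1}\hat{\mathbf\Pi}_n^\top\mathbf Y_n,\qquad \mathbf Y_n=(Y_1,\dots,Y_n)^\top .$$ **Theorem.** Suppose that: 1. distinct agents are at Euclidean distance at least $1$, and $A_{i,j}=0$ whenever the distance of $i$ and $j$ exceeds a fixed integer $\overline\Delta\ge0$; 2. $\{(X_i,Z_i,\epsilon_i,U_i)\}$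 is an $\alpha$-mixing random field with $\alpha(k,l,r)\le(k+l)^\vartheta\hat\alpha(r)$, $0\le\vartheta<\infty$, $\sum_{r\ge1}(r+2\overline\Delta)^{d-1}\hat\alpha(r)<\infty$, where $\alpha(k,l,r)$ is the supremum of $|\Pr(A\cap B)-\Pr(A)\Pr(B)|$ over all $n$, all sets of at most $k$ and at most $l$ agents of the $n$-th population at mutual distance at least $r$, and all events $A$, $B$ generated by the field on the first and on the second set; and the $\|X_i\|$ are bounded by a constant; 3. $\mathbb E[\epsilon_i^4\mid\mathcal F_N]$ is bounded by a constant, $\mathbb E[\epsilon_i\mid\mathcal F_N]=\mathbb E[\epsilon_i\mid U_i,V_i]$, and $\epsilon_i,\epsilon_j$ are independent conditionally on $\mathcal F_N$ for $i\ne j$, for all $i,j\in\mathcal D_N$; 4. the basis functions are uniformly bounded on $\mathcal T,\mathcal S,[0,1],[0,1]$, and $P_U,P_V$ are differentiable on $[0,1]$ with $\sup_u\|\partial P_U(u)\|\le\zeta_U$, $\sup_v\|\partial P_V(v)\|\le\zeta_V$ ($\zeta_U,\zeta_V$ may depend on $n$); 5. for some constants $0<c_1<c_2$ and all large $n$, all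 eigenvalues of $\mathbb E[\mathbf\Pi_n^\top\mathbf\Pi_n/n]$ lie in $(c_1,c_2)$; 6. each $\beta_l$ is twice continuously differentiable and $g$ is continuously differentiable on $\mathcal{TS}$, $\lambda$ is continuously differentiable on $[0,1]^2$, and there are vectors $\theta^*_{\beta_l},\theta^*_g,\theta^*_\lambda$ (depending on $n$) and constants $\mu_\beta,\mu_g,\mu_\lambda>0$ with $\sup_{\mathcal{TS}}|\beta_l-P_{TS}^\top\theta^*_{\beta_l}|=O(K_{TS}^{-\mu_\beta})$, $\sup_{\mathcal{TS}}|g-P_{TS}^\top\theta^*_g|=O(K_{TS}^{-\mu_g})$, $\sup_{[0,1]^2}|\lambda-\overline P_{UV}^\top\theta^*_\lambda|=O(K_{UV}^{-\mu_\lambda})$; 7. for a constant $\nu\in(0,1/2]$, $\sup_{i\in\mathcal D_N}|\hat U_i-U_i|=O_P(n^{-\nu})$ and $\sup_{i\in\mathcal D_N}|\hat V_i-V_i|=O_P(n^{-\nu})$; 8. for positive numbers $\kappa_n$, $K_{TS}\asymp\kappa_n$, $K_{UV}\asymp\kappa_n$, $\kappa_n^4/n\to0$ and $\zeta_\dagger\sqrt{\kappa_n}\,n^{-\nu}\to0$,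 where $\zeta_\dagger=\zeta_U\sqrt{K_V}+\zeta_V\sqrt{K_U}$. Let $\theta^*_\beta=(\theta_{\beta_1}^{*\top},\dots,\theta_{\beta_{dx}}^{*\top})^\top$, $\theta^*_{g\lambda}=\theta^*_g\otimes\theta^*_\lambda$, $\theta^*=(\theta_\beta^{*\top},\theta_{g\lambda}^{*\top})^\top$, $b_\mu=K_{TS}^{-\mu_\beta}+K_{TS}^{-\mu_g}+K_{UV}^{-\mu_\lambda}$ and $\tau_n^*=\tau_n\sqrt{\theta^{*\top}\mathbf D\theta^*}$. Then, as $n\to\infty$, in Euclidean norm, (i) $\|\hat\theta_{n,\beta}-\theta^*_\beta\|=O_P\big(\sqrt{\kappa_n/n}+b_\mu+\tau_n^*+n^{-\nu}\big)$; (ii) $\|\hat\theta_{n,g\lambda}-\theta^*_{g\lambda}\|=O_P\big(\kappa_n/\sqrt n+b_\mu+\tau_n^*+n^{-\nu}\big)$. -/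

import Mathlib

open MeasureTheory ProbabilityTheory Filter Topology

noncomputable section

/-! ### Stochastic orders, mixing and conditional independence -/

/-- `Z_n = O_P(r_n)` as `n → ∞`: for every `ε > 0` there is a finite `M` such that
`P(|Z_n| > M r_n) ≤ ε` for all sufficiently large `n`. -/
def IsBigOP {Ω : Type*} [MeasurableSpace Ω] (μ : Measure Ω) (Z : ℕ → Ω → ℝ) (r : ℕ → ℝ) : Prop :=
  ∀ ε : ℝ, 0 < ε → ∃ M : ℝ, 0 < M ∧
    ∀ᶠ n in atTop, μ {ω | M * r n < |Z n ω|} ≤ ENNReal.ofReal ε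

/-- `a_n ≍ b_n` for positive sequences. -/
def Comparable (a b : ℕ → ℝ) : Prop :=
  ∃ c₁ c₂ : ℝ, 0 < c₁ ∧ ∀ᶠ n in atTop, c₁ ≤ a n / b n ∧ a n / b n ≤ c₂

/-- The `α`-mixing coefficient between two sub-`σ`-algebras. -/
def alphaCoeff {Ω : Type*} [MeasurableSpace Ω] (μ : Measure Ω) (𝒜 ℬ : MeasurableSpace Ω) : ℝ :=
  sSup {x : ℝ | ∃ A B : Set Ω, MeasurableSet[𝒜] A ∧ MeasurableSet[ℬ] B ∧
    x = |μ.real (A ∩ B) - μ.real A * μ.real B|}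

/-- The `σ`-algebra generated by the variables `W i`, `i ∈ K`. -/
@[reducible] def sigmaOn {Ω ι E : Type*} [MeasurableSpace E] (W : ι → Ω → E) (K : Finset ι) :
    MeasurableSpace Ω :=
  ⨆ i ∈ K, MeasurableSpace.comap (W i) inferInstance

/-- The `α`-mixing coefficient `α(k, l, r)` of a triangular array of random fields: in the `n`-th
row the variable `W n i` sits at the point `loc n i`. -/
def mixingCoeff {Ω : Type*} [MeasurableSpace Ω] (μ : Measure Ω) {N : ℕ → ℕ} {F E : Type*}
    [PseudoMetricSpace F] [MeasurableSpace E] (loc : ∀ n, Fin (N n) → F)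
    (W : ∀ n, Fin (N n) → Ω → E) (k l r : ℕ) : ℝ :=
  sSup {x : ℝ | ∃ (n : ℕ) (K L : Finset (Fin (N n))), K.card ≤ k ∧ L.card ≤ l ∧
    (∀ i ∈ K, ∀ j ∈ L, (r : ℝ) ≤ dist (loc n i) (loc n j)) ∧
    x = alphaCoeff μ (sigmaOn (W n) K) (sigmaOn (W n) L)}

/-- Conditional independence of two real random variables given a sub-`σ`-algebra. -/
def CondIndepGiven {Ω : Type*} [MeasurableSpace Ω] (μ : Measure Ω) (𝒢 : MeasurableSpace Ω)
    (f g : Ω → ℝ) : Prop :=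
  ∀ A B : Set ℝ, MeasurableSet A → MeasurableSet B →
    μ⟦f ⁻¹' A ∩ g ⁻¹' B | 𝒢⟧ =ᵐ[μ] μ⟦f ⁻¹' A | 𝒢⟧ * μ⟦g ⁻¹' B | 𝒢⟧

/-! ### The model -/

/-- The treatment-spillover model along a sequence of networks. For each sample size `n` there is a
population of `N n ≥ n` agents, the first `n` of which form the estimation sample. -/
structure SpilloverModel (Ω : Type*) [MeasurableSpace Ω] (d dx dz : ℕ) where
  /-- population size -/
  N : ℕ → ℕ
  le_N : ∀ n, n ≤ N n
  d_pos : 0 < d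
  /-- locations of the agents -/
  loc : ∀ n, Fin (N n) → EuclideanSpace ℝ (Fin d)
  /-- `adj n i j`: agent `j` affects agent `i`, i.e. the `(i, j)` entry of the adjacency matrix is
  one -/
  adj : ∀ n, Fin (N n) → Fin (N n) → Prop
  adj_irrefl : ∀ n i, ¬ adj n i i
  /-- weights -/
  a : ∀ n, Fin (N n) → Fin (N n) → ℝ
  a_nonneg : ∀ n i j, 0 ≤ a n i j
  a_pos_iff : ∀ n i j, 0 < a n i j ↔ adj n i j
  a_sum : ∀ n i, ∑ j, a n i j = 1
  /-- exposure functions -/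
  m : ∀ n, Fin (N n) → ℝ → ℝ
  m_strictMono : ∀ n i, StrictMono (m n i)
  m_continuous : ∀ n i, Continuous (m n i)
  /-- covariates -/
  X : ∀ n, Fin (N n) → Ω → EuclideanSpace ℝ (Fin dx)
  /-- instruments -/
  Z : ∀ n, Fin (N n) → Ω → EuclideanSpace ℝ (Fin dz)
  /-- unobservables of the treatment equation -/
  U : ∀ n, Fin (N n) → Ω → ℝ
  /-- unobservables of the outcome equation -/
  eps : ∀ n, Fin (N n) → Ω → ℝ
  measurable_X : ∀ n i, Measurable (X n i)
  measurable_Z : ∀ n i, Measurable (Z n i)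
  measurable_U : ∀ n i, Measurable (U n i)
  measurable_eps : ∀ n i, Measurable (eps n i)
  U_mem : ∀ n i ω, U n i ω ∈ Set.Ioo (0 : ℝ) 1
  /-- the two parts of the treatment equation -/
  pi : EuclideanSpace ℝ (Fin dx) → EuclideanSpace ℝ (Fin dz) → ℝ
  measurable_pi : Measurable (Function.uncurry pi)
  eta : ℝ → ℝ
  eta_strictMono : StrictMonoOn eta (Set.Ioo 0 1)
  eta_continuous : ContinuousOn eta (Set.Ioo 0 1)
  /-- the coefficient functions of the outcome equation -/
  beta : Fin dx → ℝ → ℝ → ℝ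
  g : ℝ → ℝ → ℝ
  /-- the control function `E[ε_i | U_i, V_i]` -/
  lam : ℝ → ℝ → ℝ
  /-- the ranges of the own treatment and of the exposure -/
  suppT : Set ℝ
  suppS : Set ℝ
  suppT_closed : IsClosed suppT
  suppT_interval : suppT.OrdConnected
  suppS_closed : IsClosed suppS

namespace SpilloverModel

variable {Ω : Type*} [MeasurableSpace Ω] {d dx dz : ℕ} (M : SpilloverModel Ω d dx dz)

/-- The `i`-th member of the estimation sample, as a member of the population. -/
def smp (n : ℕ) (i : Fin n) : Fin (M.N n) := Fin.castLE (M.le_N n) i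

/-- Own treatment `T_i = π(X_i, Z_i) + η(U_i)`. -/
def T (n : ℕ) (i : Fin (M.N n)) (ω : Ω) : ℝ := M.pi (M.X n i ω) (M.Z n i ω) + M.eta (M.U n i ω)

/-- Exposure `S_i = m_i (∑_j a_{ij} T_j)`; the weights vanish outside the reference group. -/
def S (n : ℕ) (i : Fin (M.N n)) (ω : Ω) : ℝ := M.m n i (∑ j, M.a n i j * M.T n j ω)

/-- The control variable `V_i`: the `v ∈ (0, 1)` with `η(v) = ∑_j a_{ij} η(U_j)`, which exists and
is unique because `η` is continuous and strictly increasing and the weights form an average. -/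
def V (n : ℕ) (i : Fin (M.N n)) (ω : Ω) : ℝ :=
  Function.invFunOn M.eta (Set.Ioo 0 1) (∑ j, M.a n i j * M.eta (M.U n j ω))

/-- Outcome `Y_i = X_iᵀ β(T_i, S_i) + g(T_i, S_i) ε_i`. -/
def Y (n : ℕ) (i : Fin (M.N n)) (ω : Ω) : ℝ :=
  ∑ l, M.X n i ω l * M.beta l (M.T n i ω) (M.S n i ω) + M.g (M.T n i ω) (M.S n i ω) * M.eps n i ω

/-- The joint range of `(T_i, S_i)`. -/
def suppTS : Set (ℝ × ℝ) := M.suppT ×ˢ M.suppS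

/-- The `σ`-algebra generated by all `(X_i, Z_i, U_i)`. -/
@[reducible] def sigmaF (n : ℕ) : MeasurableSpace Ω :=
  sigmaOn (fun i ω => (M.X n i ω, M.Z n i ω, M.U n i ω)) (Finset.univ : Finset (Fin (M.N n)))

/-- The `σ`-algebra generated by `(U_i, V_i)`. -/
@[reducible] def sigmaUV (n : ℕ) (i : Fin (M.N n)) : MeasurableSpace Ω :=
  MeasurableSpace.comap (fun ω => (M.U n i ω, M.V n i ω)) inferInstance

/-- Exogeneity, homogeneity of the control variables, control function, location normalization,
and the ranges of the treatment and of the exposure. -/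
structure Standing (μ : Measure Ω) : Prop where
  indep : ∀ n (i : Fin n), IndepFun
    (fun ω (j : {j // j = M.smp n i ∨ M.adj n (M.smp n i) j}) => (M.Z n j ω, M.X n j ω))
    (fun ω => ((fun j : {j // j = M.smp n i ∨ M.adj n (M.smp n i) j} => M.U n j ω),
      M.eps n (M.smp n i) ω)) μ
  identDistrib : ∀ n (i j : Fin n), IdentDistrib
    (fun ω => (M.U n (M.smp n i) ω, M.V n (M.smp n i) ω))
    (fun ω => (M.U n (M.smp n j) ω, M.V n (M.smp n j) ω)) μ μ
  control : ∀ n (i : Fin n), μ[M.eps n (M.smp n i) | M.sigmaUV n (M.smp n i)] =ᵐ[μ]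
    fun ω => M.lam (M.U n (M.smp n i) ω) (M.V n (M.smp n i) ω)
  centered : ∀ n (i : Fin n), ∫ ω, M.eps n (M.smp n i) ω ∂μ = 0
  T_mem : ∀ n i, ∀ᵐ ω ∂μ, M.T n i ω ∈ M.suppT
  S_mem : ∀ n (i : Fin n), ∀ᵐ ω ∂μ, M.S n (M.smp n i) ω ∈ M.suppS

/-- Increasing-domain asymptotics and locality of the links. -/
structure SpatialDomain (Δ : ℕ) : Prop where
  separated : ∀ n i j, i ≠ j → 1 ≤ dist (M.loc n i) (M.loc n j)
  local_links : ∀ n i j, i ≠ j → (Δ : ℝ) < dist (M.loc n i) (M.loc n j) → ¬ M.adj n i j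

/-- The random field `(X_i, Z_i, ε_i, U_i)`. -/
def field (n : ℕ) (i : Fin (M.N n)) (ω : Ω) :
    EuclideanSpace ℝ (Fin dx) × EuclideanSpace ℝ (Fin dz) × ℝ × ℝ :=
  (M.X n i ω, M.Z n i ω, M.eps n i ω, M.U n i ω)

/-- Weak dependence and bounded covariates. -/
structure WeakDependence (μ : Measure Ω) (Δ : ℕ) : Prop where
  mixing : ∀ k l : ℕ, Tendsto (fun r => mixingCoeff μ M.loc M.field k l r) atTop (𝓝 0)
  rate : ∃ (ϑ : ℝ) (αhat : ℕ → ℝ), 0 ≤ ϑ ∧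
    (∀ k l r : ℕ, mixingCoeff μ M.loc M.field k l r ≤ ((k : ℝ) + l) ^ ϑ * αhat r) ∧
    Summable (fun r : ℕ => (((r + 1 : ℕ) : ℝ) + 2 * Δ) ^ (d - 1) * αhat (r + 1))
  X_bounded : ∃ C : ℝ, ∀ n i, ∀ᵐ ω ∂μ, ‖M.X n i ω‖ ≤ C

/-- Conditional moments and conditional independence of the outcome unobservables. -/
structure ErrorCondition (μ : Measure Ω) : Prop where
  memLp : ∀ n i, MemLp (M.eps n i) 4 μ
  moment : ∃ C : ℝ, ∀ n i, ∀ᵐ ω ∂μ, (μ[fun ω' => M.eps n i ω' ^ 4 | M.sigmaF n]) ω ≤ C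
  condMean : ∀ n i, μ[M.eps n i | M.sigmaF n] =ᵐ[μ] μ[M.eps n i | M.sigmaUV n i]
  condIndep : ∀ n i j, i ≠ j → CondIndepGiven μ (M.sigmaF n) (M.eps n i) (M.eps n j)

end SpilloverModel

/-- Estimators of the control variables: `[0, 1]`-valued and determined by the data of the
treatment equation, i.e. measurable with respect to the `σ`-algebra of all `(X_j, Z_j, U_j)`
(which contains that of all observables `(X_j, Z_j, T_j)`). -/
structure ControlEstimator {Ω : Type*} [MeasurableSpace Ω] {d dx dz : ℕ}
    (M : SpilloverModel Ω d dx dz) where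
  Uhat : ∀ n, Fin (M.N n) → Ω → ℝ
  Vhat : ∀ n, Fin (M.N n) → Ω → ℝ
  Uhat_mem : ∀ n i ω, Uhat n i ω ∈ Set.Icc (0 : ℝ) 1
  Vhat_mem : ∀ n i ω, Vhat n i ω ∈ Set.Icc (0 : ℝ) 1
  measurable_Uhat : ∀ n i, Measurable[M.sigmaF n] (Uhat n i)
  measurable_Vhat : ∀ n i, Measurable[M.sigmaF n] (Vhat n i)

/-- Uniform convergence of the estimated control variables at the rate `n ^ (-ν)`. -/
structure ControlEstimator.Rate {Ω : Type*} [MeasurableSpace Ω] {d dx dz : ℕ}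
    {M : SpilloverModel Ω d dx dz} (H : ControlEstimator M) (μ : Measure Ω) (ν : ℝ) : Prop where
  pos : 0 < ν
  le_half : ν ≤ 1 / 2
  rateU : IsBigOP μ (fun n ω => ⨆ i, |H.Uhat n i ω - M.U n i ω|) (fun n => (n : ℝ) ^ (-ν))
  rateV : IsBigOP μ (fun n ω => ⨆ i, |H.Vhat n i ω - M.V n i ω|) (fun n => (n : ℝ) ^ (-ν))

/-! ### Series approximation -/

/-- Univariate basis functions; both their number and the functions may change with `n`. -/
structure SeriesBasis where
  KT : ℕ → ℕ
  KS : ℕ → ℕ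
  KU : ℕ → ℕ
  KV : ℕ → ℕ
  KT_pos : ∀ n, 0 < KT n
  KS_pos : ∀ n, 0 < KS n
  KU_pos : ∀ n, 0 < KU n
  KV_pos : ∀ n, 0 < KV n
  pT : ∀ n, Fin (KT n) → ℝ → ℝ
  pS : ∀ n, Fin (KS n) → ℝ → ℝ
  pU : ∀ n, Fin (KU n) → ℝ → ℝ
  pV : ∀ n, Fin (KV n) → ℝ → ℝ
  measurable_pT : ∀ n j, Measurable (pT n j)
  measurable_pS : ∀ n j, Measurable (pS n j)

namespace SeriesBasis

variable (B : SeriesBasis)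

/-- Index set of `P_TS`. -/
abbrev IdxTS (n : ℕ) : Type := Fin (B.KT n) × Fin (B.KS n)

/-- Index set of `P_UV`. -/
abbrev IdxUV (n : ℕ) : Type := Fin (B.KU n) × Fin (B.KV n)

/-- Index set of `θ_β`. -/
abbrev IdxB (dx n : ℕ) : Type := Fin dx × B.IdxTS n

/-- Index set of `θ_{gλ}`. -/
abbrev IdxG (n : ℕ) : Type := B.IdxTS n × B.IdxUV n

/-- Index set of `θ = (θ_β, θ_{gλ})`. -/
abbrev Idx (dx n : ℕ) : Type := B.IdxB dx n ⊕ B.IdxG n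

/-- `K_TS = K_T K_S`. -/
def KTS (n : ℕ) : ℝ := (B.KT n : ℝ) * B.KS n

/-- `K_UV = K_U K_V`. -/
def KUV (n : ℕ) : ℝ := (B.KU n : ℝ) * B.KV n

/-- `P_TS(t, s) = P_T(t) ⊗ P_S(s)`. -/
def PTS (n : ℕ) (t s : ℝ) : B.IdxTS n → ℝ := fun k => B.pT n k.1 t * B.pS n k.2 s

/-- `P_UV(u, v) = P_U(u) ⊗ P_V(v)`. -/
def PUV (n : ℕ) (u v : ℝ) : B.IdxUV n → ℝ := fun k => B.pU n k.1 u * B.pV n k.2 v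

/-- Uniform boundedness of the basis functions. -/
structure Bounded (TT SS : Set ℝ) : Prop where
  bT : ∃ C : ℝ, ∀ n j, ∀ t ∈ TT, |B.pT n j t| ≤ C
  bS : ∃ C : ℝ, ∀ n j, ∀ s ∈ SS, |B.pS n j s| ≤ C
  bU : ∃ C : ℝ, ∀ n j, ∀ u ∈ Set.Icc (0 : ℝ) 1, |B.pU n j u| ≤ C
  bV : ∃ C : ℝ, ∀ n j, ∀ v ∈ Set.Icc (0 : ℝ) 1, |B.pV n j v| ≤ C

/-- Differentiability of `P_U` and `P_V` on `[0, 1]`, with bounds `ζ_U` and `ζ_V` on the Euclidean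
norms of the derivatives. -/
structure Smooth (ζU ζV : ℕ → ℝ) : Prop where
  diffU : ∀ n j, DifferentiableOn ℝ (B.pU n j) (Set.Icc 0 1)
  diffV : ∀ n j, DifferentiableOn ℝ (B.pV n j) (Set.Icc 0 1)
  boundU : ∀ n, ∀ u ∈ Set.Icc (0 : ℝ) 1,
    √(∑ j, derivWithin (B.pU n j) (Set.Icc 0 1) u ^ 2) ≤ ζU n
  boundV : ∀ n, ∀ v ∈ Set.Icc (0 : ℝ) 1,
    √(∑ j, derivWithin (B.pV n j) (Set.Icc 0 1) v ^ 2) ≤ ζV n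

/-- `ζ_† = ζ_U √K_V + ζ_V √K_U`. -/
def zetaDagger (ζU ζV : ℕ → ℝ) (n : ℕ) : ℝ := ζU n * √(B.KV n) + ζV n * √(B.KU n)

variable {Ω : Type*} [MeasurableSpace Ω] {d dx dz : ℕ} (M : SpilloverModel Ω d dx dz)

/-- `E[P_UV(U, V)]`, where `(U, V)` has the common law of the `(U_i, V_i)`, `i = 1, …, n` (so that
the average over `i` only picks this common value). -/
def meanPUV (μ : Measure Ω) (n : ℕ) : B.IdxUV n → ℝ := fun k =>
  (n : ℝ)⁻¹ * ∑ i : Fin n, ∫ ω, B.PUV n (M.U n (M.smp n i) ω) (M.V n (M.smp n i) ω) k ∂μ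

/-- The centered basis `P_UV(u, v) - E[P_UV(U, V)]`. -/
def PUVbar (μ : Measure Ω) (n : ℕ) (u v : ℝ) : B.IdxUV n → ℝ := fun k =>
  B.PUV n u v k - B.meanPUV M μ n k

/-- The empirically centered basis `P_UV(u, v) - n⁻¹ ∑_i P_UV(Û_i, V̂_i)`. -/
def PUVhat {M : SpilloverModel Ω d dx dz} (H : ControlEstimator M) (n : ℕ) (ω : Ω) (u v : ℝ) :
    B.IdxUV n → ℝ := fun k =>
  B.PUV n u v k -
    (n : ℝ)⁻¹ * ∑ i : Fin n, B.PUV n (H.Uhat n (M.smp n i) ω) (H.Vhat n (M.smp n i) ω) k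

/-- The infeasible regressor matrix `Π_n`, with rows `(X_i ⊗ P_TS, P_TS ⊗ P̄_UV)` at the true
control variables. -/
def Pi (μ : Measure Ω) (n : ℕ) (ω : Ω) : Matrix (Fin n) (B.Idx dx n) ℝ :=
  Matrix.of fun i => Sum.elim
    (fun k : B.IdxB dx n => M.X n (M.smp n i) ω k.1 *
      B.PTS n (M.T n (M.smp n i) ω) (M.S n (M.smp n i) ω) k.2)
    (fun k : B.IdxG n => B.PTS n (M.T n (M.smp n i) ω) (M.S n (M.smp n i) ω) k.1 *
      B.PUVbar M μ n (M.U n (M.smp n i) ω) (M.V n (M.smp n i) ω) k.2)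

/-- The feasible regressor matrix `Π̂_n`, with rows `(X_i ⊗ P_TS, P_TS ⊗ P̂_UV)` at the estimated
control variables. -/
def PiHat {M : SpilloverModel Ω d dx dz} (H : ControlEstimator M) (n : ℕ) (ω : Ω) :
    Matrix (Fin n) (B.Idx dx n) ℝ :=
  Matrix.of fun i => Sum.elim
    (fun k : B.IdxB dx n => M.X n (M.smp n i) ω k.1 *
      B.PTS n (M.T n (M.smp n i) ω) (M.S n (M.smp n i) ω) k.2)
    (fun k : B.IdxG n => B.PTS n (M.T n (M.smp n i) ω) (M.S n (M.smp n i) ω) k.1 *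
      B.PUVhat H n ω (H.Uhat n (M.smp n i) ω) (H.Vhat n (M.smp n i) ω) k.2)

/-- The matrix `E[Π_nᵀ Π_n / n]`. -/
def gram (μ : Measure Ω) (n : ℕ) : Matrix (B.Idx dx n) (B.Idx dx n) ℝ :=
  Matrix.of fun k l => ∫ ω, ((B.Pi M μ n ω).transpose * B.Pi M μ n ω) k l / (n : ℝ) ∂μ

/-- The eigenvalues of `E[Π_nᵀ Π_n / n]` are bounded and bounded away from zero. -/
def EigenCondition (μ : Measure Ω) : Prop :=
  ∃ c₁ c₂ : ℝ, 0 < c₁ ∧ ∀ᶠ n in atTop, ∀ ρ ∈ spectrum ℝ (B.gram M μ n), c₁ < ρ ∧ ρ < c₂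

/-- Smoothness of `β`, `g`, `λ` and sup-norm approximation by the series with coefficients
`θβ`, `θg`, `θlam`. -/
structure SeriesApproximation (μ : Measure Ω) (θβ : ∀ n, B.IdxB dx n → ℝ) (θg : ∀ n, B.IdxTS n → ℝ)
    (θlam : ∀ n, B.IdxUV n → ℝ) (μβ μg μlam : ℝ) : Prop where
  μβ_pos : 0 < μβ
  μg_pos : 0 < μg
  μlam_pos : 0 < μlam
  beta_smooth : ∀ l, ContDiffOn ℝ 2 (Function.uncurry (M.beta l)) M.suppTS
  g_smooth : ContDiffOn ℝ 1 (Function.uncurry M.g) M.suppTS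
  lam_smooth : ContDiffOn ℝ 1 (Function.uncurry M.lam) (Set.Icc (0 : ℝ) 1 ×ˢ Set.Icc (0 : ℝ) 1)
  beta_approx : ∀ l, ∃ C : ℝ, ∀ᶠ n in atTop, ∀ x ∈ M.suppTS,
    |M.beta l x.1 x.2 - ∑ k, B.PTS n x.1 x.2 k * θβ n (l, k)| ≤ C * B.KTS n ^ (-μβ)
  g_approx : ∃ C : ℝ, ∀ᶠ n in atTop, ∀ x ∈ M.suppTS,
    |M.g x.1 x.2 - ∑ k, B.PTS n x.1 x.2 k * θg n k| ≤ C * B.KTS n ^ (-μg)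
  lam_approx : ∃ C : ℝ, ∀ᶠ n in atTop, ∀ u ∈ Set.Icc (0 : ℝ) 1, ∀ v ∈ Set.Icc (0 : ℝ) 1,
    |M.lam u v - ∑ k, B.PUVbar M μ n u v k * θlam n k| ≤ C * B.KUV n ^ (-μlam)

/-- `K_TS ≍ κ_n`, `K_UV ≍ κ_n`, `κ_n ^ 4 / n → 0` and `ζ_† √κ_n n ^ (-ν) → 0`. -/
structure Growth (κ ζU ζV : ℕ → ℝ) (ν : ℝ) : Prop where
  κ_pos : ∀ n, 0 < κ n
  compTS : Comparable B.KTS κ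
  compUV : Comparable B.KUV κ
  lim₁ : Tendsto (fun n : ℕ => κ n ^ 4 / (n : ℝ)) atTop (𝓝 0)
  lim₂ : Tendsto (fun n : ℕ => B.zetaDagger ζU ζV n * √(κ n) * (n : ℝ) ^ (-ν)) atTop (𝓝 0)

/-- The penalty: tuning parameters `τ_n ≥ 0` tending to zero and symmetric positive semidefinite
penalization matrices `D` with bounded largest eigenvalue. -/
structure PenaltyCondition (dx : ℕ) (τ : ℕ → ℝ)
    (D : ∀ n, Matrix (B.Idx dx n) (B.Idx dx n) ℝ) : Prop where
  τ_nonneg : ∀ n, 0 ≤ τ n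
  τ_lim : Tendsto τ atTop (𝓝 0)
  D_psd : ∀ n, (D n).PosSemidef
  D_bounded : ∃ C : ℝ, ∀ᶠ n in atTop, ∀ ρ ∈ spectrum ℝ (D n), ρ ≤ C

/-- The penalized least squares estimator `[Π̂ᵀ Π̂ + τ_n D n]⁻¹ Π̂ᵀ Y`. -/
def thetaHat {M : SpilloverModel Ω d dx dz} (H : ControlEstimator M) (τ : ℕ → ℝ)
    (D : ∀ n, Matrix (B.Idx dx n) (B.Idx dx n) ℝ) (n : ℕ) (ω : Ω) : B.Idx dx n → ℝ :=
  ((B.PiHat H n ω).transpose * B.PiHat H n ω + (τ n * (n : ℝ)) • D n)⁻¹.mulVec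
    ((B.PiHat H n ω).transpose.mulVec fun i => M.Y n (M.smp n i) ω)

/-- `θ*_{gλ} = θ*_g ⊗ θ*_λ`. -/
def kron (θg : ∀ n, B.IdxTS n → ℝ) (θlam : ∀ n, B.IdxUV n → ℝ) (n : ℕ) : B.IdxG n → ℝ :=
  fun k => θg n k.1 * θlam n k.2

/-- `b_μ = K_TS ^ (-μ_β) + K_TS ^ (-μ_g) + K_UV ^ (-μ_λ)`. -/
def bias (μβ μg μlam : ℝ) (n : ℕ) : ℝ :=
  B.KTS n ^ (-μβ) + B.KTS n ^ (-μg) + B.KUV n ^ (-μlam)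

/-- `τ*_n = τ_n √(θ*ᵀ D θ*)` with `θ* = (θ*_β, θ*_{gλ})`. -/
def tauStar (τ : ℕ → ℝ) (D : ∀ n, Matrix (B.Idx dx n) (B.Idx dx n) ℝ)
    (θβ : ∀ n, B.IdxB dx n → ℝ) (θgl : ∀ n, B.IdxG n → ℝ) (n : ℕ) : ℝ :=
  τ n * √(Sum.elim (θβ n) (θgl n) ⬝ᵥ (D n).mulVec (Sum.elim (θβ n) (θgl n)))

end SeriesBasis

end

/-! Write A = Π̂ᵀΠ̂ + τ_n n D and Y = Π̂θ* + r + u, where u_i = g(T_i, S_i)(ε_i − λ(U_i, V_i)) and r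
collects everything else. Then θ̂ − θ* = A⁻¹Π̂ᵀr + A⁻¹Π̂ᵀu − A⁻¹(τ_n n Dθ*) (`Matrix.ridge_sub_eq`),
and the three terms are bounded separately on an event of probability tending to one where Π̂ᵀΠ̂ ≥
nc.

That event comes from `exists_withHighProb_gramBelow`. Averages of bounded functions that are local
to a reference group have variance O(1/n), because the agents are separated, shells contain
polynomially many of them, and the mixing rate is summable against this count
(`exists_integral_sq_sum_le`). The infeasible Gram matrix has O(κ⁴) entries, so its Frobenius error
is O_P(κ²/√n) = o_P(1). Passing to the feasible matrix moves each row by O_P(√κ (ζ_† n^(-ν) +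
√(κ/n))) = o_P(1).

On the event, A⁻¹Π̂ᵀr is at most a constant times the largest |r_i|, and the penalty term at most a
constant times τ*_n. The r_i are O_P(b_μ + n^(-ν)) (`exists_remainder_bound`): the series at the
estimated controls is uniformly close to λ there, and it is λ, not the basis, whose Lipschitz
constant absorbs the estimation error, so ζ_† does not enter the rate. The empirical recentring
costs the sample mean of λ, which is O_P(n^(-1/2)) since λ(U, V) has mean zero, and ν ≤ 1/2 absorbs
it.

Given F_N, the weights A⁻¹Π̂ᵀ are fixed while the errors ε_i − λ(U_i, V_i) are centred and
uncorrelated with bounded variances. Every row of A⁻¹Π̂ᵀ has squared norm at most 1/(nc), so, after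
truncation to the event, each coordinate of A⁻¹Π̂ᵀu has second moment O(1/n), and a block of q
coordinates contributes √(q/n). This is the only term that sees the block size: q is of order κ for
θ_β and κ² for θ_{gλ}, which is the difference between the two rates. -/

noncomputable section

/-! ### Covariance inequality under α-mixing. -/

section AlphaMixing

variable {Ω : Type*} {𝒜 ℬ : MeasurableSpace Ω} [mΩ : MeasurableSpace Ω] {μ : Measure Ω}

lemma alphaCoeff_bddAbove [IsProbabilityMeasure μ] :
    1 ∈ upperBounds {x : ℝ | ∃ A B : Set Ω, MeasurableSet[𝒜] A ∧ MeasurableSet[ℬ] B ∧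
    x = |μ.real (A ∩ B) - μ.real A * μ.real B|} := by
  rintro x ⟨A, B, -, -, rfl⟩
  have h1 : μ.real (A ∩ B) ≤ 1 := measureReal_le_one
  have h2 : μ.real A ≤ 1 := measureReal_le_one
  have h3 : μ.real B ≤ 1 := measureReal_le_one
  have h4 : 0 ≤ μ.real (A ∩ B) := measureReal_nonneg
  have h5 : 0 ≤ μ.real A := measureReal_nonneg
  have h6 : 0 ≤ μ.real B := measureReal_nonneg
  rw [abs_le]
  constructor <;> nlinarith [mul_nonneg h5 h6]

lemma alphaCoeff_le_one [IsProbabilityMeasure μ] :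
    alphaCoeff μ 𝒜 ℬ ≤ 1 :=
  csSup_le ⟨_, ∅, ∅, @MeasurableSet.empty _ 𝒜, @MeasurableSet.empty _ ℬ, rfl⟩
    (alphaCoeff_bddAbove)

lemma alphaCoeff_nonneg : 0 ≤ alphaCoeff μ 𝒜 ℬ := by
  refine Real.sSup_nonneg ?_
  rintro x ⟨A, B, -, -, rfl⟩
  exact abs_nonneg _

lemma le_alphaCoeff [IsProbabilityMeasure μ] {A B : Set Ω}
    (hA : MeasurableSet[𝒜] A) (hB : MeasurableSet[ℬ] B) :
    |μ.real (A ∩ B) - μ.real A * μ.real B| ≤ alphaCoeff μ 𝒜 ℬ :=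
  le_csSup ⟨1, alphaCoeff_bddAbove⟩ ⟨A, B, hA, hB, rfl⟩

/-- Conditioning on 𝒜 turns the covariance into E[f h] with h = E[g | 𝒜] − E[g], which is at most a
E|h|. As h has mean zero, E|h| is twice the integral of h over {h ≥ 0}, an event of 𝒜. This trades a
bounded variable for an indicator; using it once for each variable reduces covariances to events. -/
lemma exists_measurableSet_abs_covariance_le [IsProbabilityMeasure μ]
    (hm : 𝒜 ≤ mΩ) {f g : Ω → ℝ} {a : ℝ} (hf : StronglyMeasurable[𝒜] f)
    (hfa : ∀ᵐ ω ∂μ, |f ω| ≤ a) (hg : Integrable g μ) :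
    ∃ A, MeasurableSet[𝒜] A ∧ |∫ ω, f ω * g ω ∂μ - (∫ ω, f ω ∂μ) * ∫ ω, g ω ∂μ| ≤
      2 * a * |∫ ω in A, g ω ∂μ - μ.real A * ∫ ω, g ω ∂μ| := by
  set c := ∫ ω, g ω ∂μ
  set h : Ω → ℝ := fun ω => (μ[g | 𝒜]) ω - c with hh
  have hhm : StronglyMeasurable[𝒜] h :=
    stronglyMeasurable_condExp.sub (@stronglyMeasurable_const _ _ 𝒜 _ c)
  have hhi : Integrable h μ := integrable_condExp.sub (integrable_const c)
  have hA : MeasurableSet[𝒜] {ω | 0 ≤ h ω} :=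
    measurableSet_le (@measurable_const _ _ _ 𝒜 0) hhm.measurable
  have hfi : Integrable f μ := by
    refine Integrable.mono' (integrable_const a) (hf.mono hm).aestronglyMeasurable ?_
    simpa [Real.norm_eq_abs] using hfa
  have hfg : Integrable (fun ω => f ω * g ω) μ :=
    hg.bdd_mul (hf.mono hm).aestronglyMeasurable (by simpa [Real.norm_eq_abs] using hfa)
  have hfh : Integrable (fun ω => f ω * h ω) μ :=
    hhi.bdd_mul (hf.mono hm).aestronglyMeasurable (by simpa [Real.norm_eq_abs] using hfa)
  have hfc : Integrable (fun ω => f ω * (μ[g | 𝒜]) ω) μ :=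
    integrable_condExp.bdd_mul (hf.mono hm).aestronglyMeasurable
      (by simpa [Real.norm_eq_abs] using hfa)
  have h0 : ∫ ω, h ω ∂μ = 0 := by
    rw [hh, integral_sub integrable_condExp (integrable_const c), integral_condExp hm]
    simp [c]
  have h1 : ∫ ω, f ω * g ω ∂μ - (∫ ω, f ω ∂μ) * c = ∫ ω, f ω * h ω ∂μ := by
    have e1 : ∫ ω, f ω * g ω ∂μ = ∫ ω, f ω * (μ[g | 𝒜]) ω ∂μ := by
      rw [← integral_condExp hm]
      exact integral_congr_ae (condExp_mul_of_stronglyMeasurable_left hf hfg hg)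
    rw [e1, ← integral_mul_const, ← integral_sub hfc (hfi.mul_const c)]
    congr 1 with ω
    simp [hh]; ring
  have h2 : ∀ s, MeasurableSet[𝒜] s → ∫ ω in s, h ω ∂μ = ∫ ω in s, g ω ∂μ - μ.real s * c := by
    intro s hA
    rw [hh, integral_sub integrable_condExp.integrableOn (integrable_const c).integrableOn,
      setIntegral_condExp hm hg hA]
    simp
  have h3 : ∫ ω, |h ω| ∂μ = 2 * ∫ ω in {ω | 0 ≤ h ω}, h ω ∂μ := by
    have : ∀ ω, |h ω| = 2 * ({ω | 0 ≤ h ω}.indicator h ω) - h ω := by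
      intro ω
      by_cases hω : 0 ≤ h ω
      · rw [Set.indicator_of_mem (by exact hω), abs_of_nonneg hω]; ring
      · rw [Set.indicator_of_notMem (by exact hω), abs_of_neg (not_le.1 hω)]; ring
    simp_rw [this]
    rw [integral_sub ((hhi.indicator (hm _ hA)).const_mul 2) hhi, h0, sub_zero,
      integral_const_mul, integral_indicator (hm _ hA)]
  refine ⟨_, hA, ?_⟩
  rw [h1, ← h2 _ hA]
  have ha : 0 ≤ a := by
    obtain ⟨ω, hω⟩ := hfa.exists
    exact (abs_nonneg _).trans hω
  calc |∫ ω, f ω * h ω ∂μ| ≤ ∫ ω, |f ω * h ω| ∂μ := abs_integral_le_integral_abs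
    _ ≤ ∫ ω, a * |h ω| ∂μ := by
        refine integral_mono_ae hfh.abs (hhi.abs.const_mul a) ?_
        filter_upwards [hfa] with ω hω
        rw [abs_mul]
        exact mul_le_mul_of_nonneg_right hω (abs_nonneg _)
    _ = 2 * a * ∫ ω in {ω | 0 ≤ h ω}, h ω ∂μ := by rw [integral_const_mul, h3]; ring
    _ ≤ _ := mul_le_mul_of_nonneg_left (le_abs_self _) (by positivity)

/-- The covariance inequality for bounded random variables under `α`-mixing. -/
theorem abs_covariance_le_alphaCoeff [IsProbabilityMeasure μ]
    (hA : 𝒜 ≤ mΩ) (hB : ℬ ≤ mΩ) {f g : Ω → ℝ} {a b : ℝ} (hf : StronglyMeasurable[𝒜] f)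
    (hg : StronglyMeasurable[ℬ] g) (hfa : ∀ᵐ ω ∂μ, |f ω| ≤ a) (hgb : ∀ᵐ ω ∂μ, |g ω| ≤ b) :
    |∫ ω, f ω * g ω ∂μ - (∫ ω, f ω ∂μ) * ∫ ω, g ω ∂μ| ≤ 4 * a * b * alphaCoeff μ 𝒜 ℬ := by
  have hgi : Integrable g μ := by
    refine Integrable.mono' (integrable_const b) (hg.mono hB).aestronglyMeasurable ?_
    simpa [Real.norm_eq_abs] using hgb
  obtain ⟨A, hAm, h1⟩ := exists_measurableSet_abs_covariance_le hA hf hfa hgi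
  have hind : Integrable (A.indicator (fun _ => (1 : ℝ))) μ :=
    (integrable_const 1).indicator (hA _ hAm)
  -- The same trade with the roles exchanged: now g is the bounded variable and the indicator of A
  -- the other one. The two factors 2 make the constant 4.
  obtain ⟨B, hBm, h2⟩ := exists_measurableSet_abs_covariance_le hB hg hgb hind
  have ha : 0 ≤ a := by
    obtain ⟨ω, hω⟩ := hfa.exists
    exact (abs_nonneg _).trans hω
  have hb : 0 ≤ b := by
    obtain ⟨ω, hω⟩ := hgb.exists
    exact (abs_nonneg _).trans hω
  have e1 : ∫ ω, g ω * A.indicator (fun _ => (1 : ℝ)) ω ∂μ = ∫ ω in A, g ω ∂μ := by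
    rw [← integral_indicator (hA _ hAm)]
    congr 1 with ω
    by_cases hω : ω ∈ A <;> simp [hω]
  have e2 : ∫ ω, A.indicator (fun _ => (1 : ℝ)) ω ∂μ = μ.real A := by
    rw [integral_indicator (hA _ hAm)]; simp
  have e3 : ∫ ω in B, A.indicator (fun _ => (1 : ℝ)) ω ∂μ = μ.real (A ∩ B) := by
    rw [integral_indicator (hA _ hAm)]
    simp [Measure.real, Measure.restrict_apply (hA _ hAm)]
  rw [e1, e2, e3] at h2
  calc _ ≤ _ := h1
    _ ≤ 2 * a * (2 * b * alphaCoeff μ 𝒜 ℬ) := by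
      refine mul_le_mul_of_nonneg_left ?_ (by positivity)
      rw [mul_comm (μ.real A)]
      refine h2.trans (mul_le_mul_of_nonneg_left ?_ (by positivity))
      rw [mul_comm (μ.real B)]
      exact le_alphaCoeff hAm hBm
    _ = _ := by ring

end AlphaMixing

/-! ### From conditional independence of events to conditional uncorrelatedness. -/

section ConditionalIndependence

variable {Ω : Type*} {𝒢 : MeasurableSpace Ω} [mΩ : MeasurableSpace Ω] {μ : Measure Ω}

/-- The hypothesis says E[w | σ(f)] = 0, and f can be pulled out of that conditional expectation.
This upgrades identities over events of f to identities for f itself, without approximation by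
simple functions. -/
lemma integral_mul_eq_zero_of_setIntegral_preimage_eq_zero [IsFiniteMeasure μ] {w f : Ω → ℝ}
    (hw : Integrable w μ) (hf : Measurable f) (hwf : Integrable (fun ω => w ω * f ω) μ)
    (h : ∀ B : Set ℝ, MeasurableSet B → ∫ ω in f ⁻¹' B, w ω ∂μ = 0) :
    ∫ ω, w ω * f ω ∂μ = 0 := by
  have hm : MeasurableSpace.comap f inferInstance ≤ mΩ := hf.comap_le
  have hz : μ[w | MeasurableSpace.comap f inferInstance] =ᵐ[μ] 0 := by
    symm
    refine ae_eq_condExp_of_forall_setIntegral_eq hm hw (fun _ _ _ => integrableOn_zero) ?_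
      stronglyMeasurable_zero.aestronglyMeasurable
    rintro s ⟨B, hB, rfl⟩ -
    simp [h B hB]
  have hfm : StronglyMeasurable[MeasurableSpace.comap f inferInstance] f :=
    (comap_measurable f).stronglyMeasurable
  rw [← integral_condExp hm]
  refine integral_eq_zero_of_ae ?_
  filter_upwards [condExp_mul_of_stronglyMeasurable_right hfm hwf hw, hz] with ω h1 h2
  rw [show (μ[fun ω => w ω * f ω | MeasurableSpace.comap f inferInstance]) ω = _ from h1]
  simp [h2]

lemma integral_mul_eq_integral_mul_condExp [IsFiniteMeasure μ]
    (hm : 𝒢 ≤ mΩ) {h f f' : Ω → ℝ} (hh : StronglyMeasurable[𝒢] h) (hf : Integrable f μ)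
    (hhf : Integrable (fun ω => h ω * f ω) μ) (hf' : μ[f | 𝒢] =ᵐ[μ] f') :
    ∫ ω, h ω * f ω ∂μ = ∫ ω, h ω * f' ω ∂μ := by
  rw [← integral_condExp hm]
  refine integral_congr_ae ?_
  filter_upwards [condExp_mul_of_stronglyMeasurable_left hh hhf hf, hf'] with ω h1 h2
  rw [show (μ[fun ω => h ω * f ω | 𝒢]) ω = _ from h1, Pi.mul_apply, h2]

/-- Conditionally independent square integrable variables are conditionally uncorrelated. -/
theorem CondIndepGiven.integral_mul_centered_eq_zero [IsProbabilityMeasure μ]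
    (hm : 𝒢 ≤ mΩ) {f g a b h : Ω → ℝ} (hfg : CondIndepGiven μ 𝒢 f g)
    (hf : MemLp f 2 μ) (hg : MemLp g 2 μ) (hfm : Measurable f) (hgm : Measurable g)
    (ha : StronglyMeasurable[𝒢] a) (hb : StronglyMeasurable[𝒢] b) {Ca Cb Ch : ℝ}
    (haC : ∀ ω, |a ω| ≤ Ca) (hbC : ∀ ω, |b ω| ≤ Cb)
    (hfa : μ[f | 𝒢] =ᵐ[μ] a)
    (hh : StronglyMeasurable[𝒢] h) (hhC : ∀ ω, |h ω| ≤ Ch) :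
    ∫ ω, h ω * ((f ω - a ω) * (g ω - b ω)) ∂μ = 0 := by
  have hfi : Integrable f μ := hf.integrable (by norm_num)
  have hgi : Integrable g μ := hg.integrable (by norm_num)
  have bdd : ∀ {u v : Ω → ℝ} {C : ℝ}, StronglyMeasurable[𝒢] u → (∀ ω, |u ω| ≤ C) →
      Integrable v μ → Integrable (fun ω => u ω * v ω) μ := fun hu hC hv =>
    hv.bdd_mul (hu.mono hm).aestronglyMeasurable
      (Eventually.of_forall fun ω => by simpa [Real.norm_eq_abs] using hC ω)
  have hai : Integrable a μ := by simpa using bdd ha haC (integrable_const 1)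
  have hbi : Integrable b μ := by simpa using bdd hb hbC (integrable_const 1)
  have indm : ∀ {F : Set Ω}, MeasurableSet[𝒢] F →
      StronglyMeasurable[𝒢] (F.indicator (fun _ => (1 : ℝ))) :=
    fun hF => (@stronglyMeasurable_const _ _ 𝒢 _ (1 : ℝ)).indicator hF
  have indC : ∀ (F : Set Ω) ω, |F.indicator (fun _ => (1 : ℝ)) ω| ≤ 1 := by
    intro F ω
    by_cases hω : ω ∈ F <;> simp [hω]
  -- conditional probabilities of the events of `g`
  have step1 : ∀ F, MeasurableSet[𝒢] F → ∀ B : Set ℝ, MeasurableSet B →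
      ∫ ω, F.indicator (fun _ => (1 : ℝ)) ω * (f ω * (g ⁻¹' B).indicator (fun _ => (1 : ℝ)) ω) ∂μ =
      ∫ ω, (F.indicator (fun _ => (1 : ℝ)) ω * a ω) *
        (g ⁻¹' B).indicator (fun _ => (1 : ℝ)) ω ∂μ := by
    intro F hF B hB
    set p : Ω → ℝ := μ⟦g ⁻¹' B | 𝒢⟧ with hp
    have hgB : MeasurableSet (g ⁻¹' B) := hgm hB
    have hBi : Integrable ((g ⁻¹' B).indicator (fun _ => (1 : ℝ))) μ :=
      (integrable_const 1).indicator hgB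
    have hpm : StronglyMeasurable[𝒢] p := stronglyMeasurable_condExp
    have hp1 : ∀ᵐ ω ∂μ, |p ω| ≤ 1 := by
      have h1 : p ≤ᵐ[μ] μ[fun _ => (1 : ℝ) | 𝒢] := condExp_mono hBi (integrable_const 1)
        (Eventually.of_forall fun ω => (le_abs_self _).trans (indC _ ω))
      have h0 : 0 ≤ᵐ[μ] p := condExp_nonneg (Eventually.of_forall fun ω =>
        Set.indicator_nonneg (fun _ _ => zero_le_one) ω)
      rw [condExp_const hm] at h1
      filter_upwards [h1, h0] with ω h1 h0
      rw [abs_le]; exact ⟨by linarith [show (0 : ℝ) ≤ p ω from h0], h1⟩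
    have hpf : ∀ {u : Ω → ℝ}, Integrable u μ → Integrable (fun ω => p ω * u ω) μ := fun hu =>
      hu.bdd_mul (hpm.mono hm).aestronglyMeasurable (by simpa [Real.norm_eq_abs] using hp1)
    set w : Ω → ℝ := fun ω => F.indicator (fun _ => (1 : ℝ)) ω *
      ((g ⁻¹' B).indicator (fun _ => (1 : ℝ)) ω - p ω) with hw
    have hwi : Integrable w μ := bdd (indm hF) (indC F) (hBi.sub integrable_condExp)
    have hwb : ∀ᵐ ω ∂μ, ‖w ω‖ ≤ 2 := by
      filter_upwards [hp1] with ω h1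
      rw [hw, Real.norm_eq_abs, abs_mul]
      have := indC F ω
      have h2 := indC (g ⁻¹' B) ω
      have h3 := abs_sub ((g ⁻¹' B).indicator (fun _ => (1 : ℝ)) ω) (p ω)
      nlinarith [abs_nonneg (F.indicator (fun _ => (1 : ℝ)) ω),
        abs_nonneg ((g ⁻¹' B).indicator (fun _ => (1 : ℝ)) ω - p ω)]
    -- Conditional independence says exactly that 1_F (1_{g ∈ B} − p) integrates to zero over every
    -- event {f ∈ A}; hence it is orthogonal to f. So 1_{g ∈ B} may be exchanged for p, and
    -- conditioning then exchanges f for a.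
    have key : ∫ ω, w ω * f ω ∂μ = 0 := by
      refine integral_mul_eq_zero_of_setIntegral_preimage_eq_zero hwi hfm
        (hfi.bdd_mul hwi.aestronglyMeasurable hwb) fun A hA => ?_
      have hfA : MeasurableSet (f ⁻¹' A) := hfm hA
      have hAi : Integrable ((f ⁻¹' A).indicator (fun _ => (1 : ℝ))) μ :=
        (integrable_const 1).indicator hfA
      have i1 : Integrable ((f ⁻¹' A ∩ g ⁻¹' B).indicator (fun _ => (1 : ℝ))) μ :=
        (integrable_const 1).indicator (hfA.inter hgB)
      rw [← integral_indicator hfA]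
      have e : ∀ ω, (f ⁻¹' A).indicator w ω = F.indicator (fun _ => (1 : ℝ)) ω *
          (f ⁻¹' A ∩ g ⁻¹' B).indicator (fun _ => (1 : ℝ)) ω -
          F.indicator (fun _ => (1 : ℝ)) ω * (p ω *
            (f ⁻¹' A).indicator (fun _ => (1 : ℝ)) ω) := by
        intro ω
        rw [hw]
        by_cases h1 : ω ∈ f ⁻¹' A <;> by_cases h2 : ω ∈ g ⁻¹' B <;>
          simp only [Set.indicator, Set.mem_inter_iff, h1, h2, and_true, and_false, and_self,
            if_true, if_false] <;> ring
      simp_rw [e]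
      rw [integral_sub (bdd (indm hF) (indC F) i1) (bdd (indm hF) (indC F) (hpf hAi)),
        integral_mul_eq_integral_mul_condExp hm (indm hF) i1 (bdd (indm hF) (indC F) i1)
          (hfg A B hA hB),
        integral_mul_eq_integral_mul_condExp hm (indm hF) (hpf hAi)
          (bdd (indm hF) (indC F) (hpf hAi))
          (condExp_mul_of_stronglyMeasurable_left hpm (hpf hAi) hAi)]
      rw [sub_eq_zero]
      congr 1 with ω
      simp only [Pi.mul_apply]
      ring
    have e2 : ∀ ω, w ω * f ω = F.indicator (fun _ => (1 : ℝ)) ω *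
        (f ω * (g ⁻¹' B).indicator (fun _ => (1 : ℝ)) ω) -
        F.indicator (fun _ => (1 : ℝ)) ω * (p ω * f ω) := fun ω => by rw [hw]; ring
    have i2 : Integrable (fun ω => f ω * (g ⁻¹' B).indicator (fun _ => (1 : ℝ)) ω) μ := by
      refine hfi.mul_bdd (c := 1) hBi.aestronglyMeasurable (Eventually.of_forall fun ω => ?_)
      rw [Real.norm_eq_abs]; exact indC _ ω
    simp_rw [e2] at key
    rw [integral_sub (bdd (indm hF) (indC F) i2) (bdd (indm hF) (indC F) (hpf hfi)),
      sub_eq_zero] at key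
    rw [key]
    have i3 : StronglyMeasurable[𝒢] (fun ω => F.indicator (fun _ => (1 : ℝ)) ω * a ω) :=
      (indm hF).mul ha
    have i3C : ∀ ω, |F.indicator (fun _ => (1 : ℝ)) ω * a ω| ≤ Ca := fun ω => by
      rw [abs_mul]
      nlinarith [indC F ω, haC ω, abs_nonneg (a ω)]
    rw [integral_mul_eq_integral_mul_condExp hm i3 hBi (bdd i3 i3C hBi) (EventuallyEq.refl _ _)]
    have i4 := integral_mul_eq_integral_mul_condExp hm (indm hF) (hpf hfi)
      (bdd (indm hF) (indC F) (hpf hfi))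
      ((condExp_mul_of_stronglyMeasurable_left hpm (hpf hfi) hfi).trans
        ((EventuallyEq.refl _ p).mul hfa))
    rw [i4]
    congr 1 with ω
    simp only [Pi.mul_apply, ← hp]
    ring
  have hfaL : MemLp (fun ω => f ω - a ω) 2 μ :=
    hf.sub (MemLp.of_bound (ha.mono hm).aestronglyMeasurable Ca (Eventually.of_forall fun ω => by
      simpa [Real.norm_eq_abs] using haC ω))
  have hgbL : MemLp (fun ω => g ω - b ω) 2 μ :=
    hg.sub (MemLp.of_bound (hb.mono hm).aestronglyMeasurable Cb (Eventually.of_forall fun ω => by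
      simpa [Real.norm_eq_abs] using hbC ω))
  have hprod : Integrable (fun ω => (f ω - a ω) * (g ω - b ω)) μ := hfaL.integrable_mul hgbL
  have hprod1 : Integrable (fun ω => (f ω - a ω) * g ω) μ := hfaL.integrable_mul hg
  have hprod2 : Integrable (fun ω => b ω * (f ω - a ω)) μ := bdd hb hbC (hfi.sub hai)
  have hcz : μ[fun ω => f ω - a ω | 𝒢] =ᵐ[μ] 0 := by
    have := condExp_sub hfi hai 𝒢
    rw [condExp_of_stronglyMeasurable hm ha hai] at this
    filter_upwards [this, hfa] with ω h1 h2
    rw [show (μ[fun ω => f ω - a ω | 𝒢]) ω = _ from h1, Pi.sub_apply, h2]; simp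
  have step2 : ∀ F, MeasurableSet[𝒢] F →
      ∫ ω, F.indicator (fun _ => (1 : ℝ)) ω * ((f ω - a ω) * (g ω - b ω)) ∂μ = 0 := by
    intro F hF
    -- `step1` states that 1_F (f − a) integrates to zero over every event {g ∈ B}; the same
    -- upgrade, now in g, makes it orthogonal to g.
    have k1 : ∫ ω, (F.indicator (fun _ => (1 : ℝ)) ω * (f ω - a ω)) * g ω ∂μ = 0 := by
      refine integral_mul_eq_zero_of_setIntegral_preimage_eq_zero
        (bdd (indm hF) (indC F) (hfi.sub hai)) hgm ?_ fun B hB => ?_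
      · simpa only [mul_assoc] using bdd (indm hF) (indC F) hprod1
      have hgB : MeasurableSet (g ⁻¹' B) := hgm hB
      rw [← integral_indicator hgB]
      have bi : ∀ {u : Ω → ℝ}, Integrable u μ → Integrable
          (fun ω => u ω * (g ⁻¹' B).indicator (fun _ => (1 : ℝ)) ω) μ := fun hu =>
        hu.mul_bdd (c := 1) ((integrable_const (1 : ℝ)).indicator hgB).aestronglyMeasurable
          (Eventually.of_forall fun ω => by rw [Real.norm_eq_abs]; exact indC _ ω)
      have e : ∀ ω, (g ⁻¹' B).indicator (fun ω => F.indicator (fun _ => (1 : ℝ)) ω *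
          (f ω - a ω)) ω = F.indicator (fun _ => (1 : ℝ)) ω * (f ω *
            (g ⁻¹' B).indicator (fun _ => (1 : ℝ)) ω) - (F.indicator (fun _ => (1 : ℝ)) ω * a ω) *
            (g ⁻¹' B).indicator (fun _ => (1 : ℝ)) ω := by
        intro ω
        by_cases h1 : ω ∈ g ⁻¹' B <;> simp only [Set.indicator, h1, if_true, if_false] <;> ring
      simp_rw [e]
      rw [integral_sub (bdd (indm hF) (indC F) (bi hfi)) (bi (bdd (indm hF) (indC F) hai)),
        step1 F hF B hB, sub_self]
    -- Here b only has to be bounded and 𝒢-measurable: centring one of the two factors at its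
    -- conditional mean is enough.
    have k2 : ∫ ω, F.indicator (fun _ => (1 : ℝ)) ω * (b ω * (f ω - a ω)) ∂μ = 0 := by
      rw [integral_mul_eq_integral_mul_condExp hm (indm hF) hprod2
        (bdd (indm hF) (indC F) hprod2)
        ((condExp_mul_of_stronglyMeasurable_left hb hprod2 (hfi.sub hai)).trans
          ((EventuallyEq.refl _ b).mul hcz))]
      simp
    have e : ∀ ω, F.indicator (fun _ => (1 : ℝ)) ω * ((f ω - a ω) * (g ω - b ω)) =
        (F.indicator (fun _ => (1 : ℝ)) ω * (f ω - a ω)) * g ω -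
        F.indicator (fun _ => (1 : ℝ)) ω * (b ω * (f ω - a ω)) := fun ω => by ring
    simp_rw [e]
    rw [integral_sub (by simpa only [mul_assoc] using bdd (indm hF) (indC F) hprod1)
      (bdd (indm hF) (indC F) hprod2), k1, k2, sub_self]
  have hz : μ[fun ω => (f ω - a ω) * (g ω - b ω) | 𝒢] =ᵐ[μ] 0 := by
    symm
    refine ae_eq_condExp_of_forall_setIntegral_eq hm hprod (fun _ _ _ => integrableOn_zero) ?_
      stronglyMeasurable_zero.aestronglyMeasurable
    rintro F hF -
    rw [← integral_indicator (hm _ hF), ← integral_indicator (hm _ hF)]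
    rw [show ∫ ω, F.indicator (fun ω => (f ω - a ω) * (g ω - b ω)) ω ∂μ = 0 from ?_]
    · simp
    rw [← step2 F hF]
    congr 1 with ω
    by_cases h1 : ω ∈ F <;> simp [h1]
  rw [integral_mul_eq_integral_mul_condExp hm hh hprod (bdd hh hhC hprod) hz]
  simp

end ConditionalIndependence

/-! ### Counting separated points by volume. -/

section Packing

variable {d : ℕ} {ι : Type*} {s : Finset ι} {p : ι → EuclideanSpace ℝ (Fin d)}
  {x : EuclideanSpace ℝ (Fin d)} {R : ℝ}

lemma volumeReal_ball (x : EuclideanSpace ℝ (Fin d)) {r : ℝ} (hr : 0 < r) :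
    (volume : Measure (EuclideanSpace ℝ (Fin d))).real (Metric.ball x r) =
      r ^ d * (volume : Measure (EuclideanSpace ℝ (Fin d))).real (Metric.ball 0 1) := by
  rw [Measure.real, Measure.addHaar_ball_of_pos _ _ hr, ENNReal.toReal_mul,
    ENNReal.toReal_ofReal (by positivity), finrank_euclideanSpace_fin, Measure.real]

lemma volumeReal_ball_pos :
    0 < (volume : Measure (EuclideanSpace ℝ (Fin d))).real (Metric.ball 0 1) :=
  ENNReal.toReal_pos (Metric.measure_ball_pos _ _ one_pos).ne' measure_ball_lt_top.ne

lemma volumeReal_biUnion_half_balls (hs : ∀ i ∈ s, ∀ j ∈ s, i ≠ j → 1 ≤ dist (p i) (p j)) :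
    (volume : Measure (EuclideanSpace ℝ (Fin d))).real (⋃ i ∈ s, Metric.ball (p i) (1 / 2)) =
      s.card * ((1 / 2) ^ d *
        (volume : Measure (EuclideanSpace ℝ (Fin d))).real (Metric.ball 0 1)) := by
  rw [measureReal_biUnion_finset ?_ (fun i _ => measurableSet_ball)
    (fun i _ => measure_ball_lt_top.ne)]
  · simp_rw [volumeReal_ball _ (show (0 : ℝ) < 1 / 2 by norm_num)]
    simp
  · intro i hi j hj hij
    refine Metric.ball_disjoint_ball ?_
    linarith [hs i hi j hj hij]

/-- The number of `1`-separated points in a ball. -/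
lemma card_le_of_separated_of_dist_le (hs : ∀ i ∈ s, ∀ j ∈ s, i ≠ j → 1 ≤ dist (p i) (p j))
    (hR : 0 ≤ R) (h : ∀ i ∈ s, dist (p i) x ≤ R) : (s.card : ℝ) ≤ (2 * R + 1) ^ d := by
  -- Balls of radius 1/2 around 1-separated points are disjoint, so their number is bounded by a
  -- ratio of volumes.
  have hsub : (⋃ i ∈ s, Metric.ball (p i) (1 / 2)) ⊆ Metric.ball x (R + 1 / 2) := by
    refine Set.iUnion₂_subset fun i hi => Metric.ball_subset_ball' ?_
    linarith [h i hi]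
  have h1 := measureReal_mono (μ := volume) hsub measure_ball_lt_top.ne
  rw [volumeReal_biUnion_half_balls hs, volumeReal_ball x (by linarith), ← mul_assoc] at h1
  have h2 := le_of_mul_le_mul_right h1 volumeReal_ball_pos
  have h3 : (2 * R + 1) ^ d = (R + 1 / 2) ^ d * 2 ^ d := by rw [← mul_pow]; ring_nf
  rw [h3]
  have h4 : (s.card : ℝ) = s.card * (1 / 2) ^ d * 2 ^ d := by
    rw [mul_assoc, ← mul_pow]; norm_num
  rw [h4]
  exact mul_le_mul_of_nonneg_right h2 (by positivity)

/-- The number of `1`-separated points in a shell of width `1`. -/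
lemma card_le_of_separated_of_mem_shell (hd : 0 < d)
    (hs : ∀ i ∈ s, ∀ j ∈ s, i ≠ j → 1 ≤ dist (p i) (p j))
    (hR : 1 ≤ R) (h : ∀ i ∈ s, R ≤ dist (p i) x ∧ dist (p i) x ≤ R + 1) :
    (s.card : ℝ) ≤ 2 ^ d * (2 * d * 3 ^ (d - 1)) * R ^ (d - 1) := by
  -- The half balls also avoid the inner ball of radius R − 1/2, so the count is controlled by a
  -- difference of d-th powers. This gains one power of R over the bound for a full ball.
  have hsub : (⋃ i ∈ s, Metric.ball (p i) (1 / 2)) ∪ Metric.ball x (R - 1 / 2) ⊆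
      Metric.ball x (R + 3 / 2) := by
    refine Set.union_subset (Set.iUnion₂_subset fun i hi => Metric.ball_subset_ball' ?_)
      (Metric.ball_subset_ball (by linarith))
    linarith [(h i hi).2]
  have hdisj : Disjoint (⋃ i ∈ s, Metric.ball (p i) (1 / 2)) (Metric.ball x (R - 1 / 2)) := by
    refine Set.disjoint_iUnion₂_left.2 fun i hi => Metric.ball_disjoint_ball ?_
    linarith [(h i hi).1]
  have hfin : volume (⋃ i ∈ s, Metric.ball (p i) (1 / 2)) ≠ ⊤ :=
    ((measure_mono (Set.subset_union_left.trans hsub)).trans_lt measure_ball_lt_top).ne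
  have h1 := measureReal_mono (μ := volume) hsub measure_ball_lt_top.ne
  rw [measureReal_union hdisj measurableSet_ball hfin measure_ball_lt_top.ne,
    volumeReal_biUnion_half_balls hs, volumeReal_ball x (by linarith),
    volumeReal_ball x (by linarith), ← mul_assoc, ← add_mul] at h1
  have h2 := le_of_mul_le_mul_right h1 volumeReal_ball_pos
  have h3 : (R + 3 / 2) ^ d - (R - 1 / 2) ^ d ≤ 2 * d * 3 ^ (d - 1) * R ^ (d - 1) := by
    have h5 := abs_pow_sub_pow_le (R + 3 / 2) (R - 1 / 2) d
    have h6 : |R + 3 / 2 - (R - 1 / 2)| = 2 := by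
      rw [show R + 3 / 2 - (R - 1 / 2) = 2 by ring]; norm_num
    have h7 : max |R + 3 / 2| |R - 1 / 2| ≤ 3 * R := by
      rw [abs_of_nonneg (by linarith), abs_of_nonneg (by linarith)]
      exact max_le (by linarith) (by linarith)
    rw [h6] at h5
    calc _ ≤ _ := (le_abs_self _).trans h5
      _ ≤ 2 * d * (3 * R) ^ (d - 1) := by gcongr
      _ = _ := by rw [mul_pow]; ring
  have h4 : (s.card : ℝ) = 2 ^ d * (s.card * (1 / 2) ^ d) := by
    rw [mul_comm, mul_assoc, ← mul_pow]; norm_num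
  rw [h4, mul_assoc]
  exact mul_le_mul_of_nonneg_left (by linarith) (by positivity)

end Packing

/-! ### Variance of sums of local functions of a mixing field. -/

section Mixing

lemma alphaCoeff_le_mixingCoeff {Ω : Type*} [MeasurableSpace Ω] {μ : Measure Ω}
    [IsProbabilityMeasure μ] {N : ℕ → ℕ} {F E : Type*} [PseudoMetricSpace F] [MeasurableSpace E]
    (loc : ∀ n, Fin (N n) → F) (W : ∀ n, Fin (N n) → Ω → E) {k l r n : ℕ}
    {K L : Finset (Fin (N n))} (hK : K.card ≤ k) (hL : L.card ≤ l)
    (hKL : ∀ i ∈ K, ∀ j ∈ L, (r : ℝ) ≤ dist (loc n i) (loc n j)) :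
    alphaCoeff μ (sigmaOn (W n) K) (sigmaOn (W n) L) ≤ mixingCoeff μ loc W k l r := by
  refine le_csSup ⟨1, ?_⟩ ⟨n, K, L, hK, hL, hKL, rfl⟩
  rintro x ⟨n, K, L, -, -, -, rfl⟩
  exact alphaCoeff_le_one

lemma mixingCoeff_nonneg {Ω : Type*} [MeasurableSpace Ω] {μ : Measure Ω}
    {N : ℕ → ℕ} {F E : Type*} [PseudoMetricSpace F] [MeasurableSpace E]
    (loc : ∀ n, Fin (N n) → F) (W : ∀ n, Fin (N n) → Ω → E) (k l r : ℕ) :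
    0 ≤ mixingCoeff μ loc W k l r := by
  refine Real.sSup_nonneg ?_
  rintro x ⟨n, K, L, -, -, -, rfl⟩
  exact alphaCoeff_nonneg

lemma sigmaOn_le {Ω ι E : Type*} [mΩ : MeasurableSpace Ω] [MeasurableSpace E] {W : ι → Ω → E}
    (hW : ∀ i, Measurable (W i)) (K : Finset ι) : sigmaOn W K ≤ mΩ :=
  iSup₂_le fun i _ => (hW i).comap_le

lemma measurable_sigmaOn {Ω ι E : Type*} [MeasurableSpace E] (W : ι → Ω → E) {K : Finset ι}
    {i : ι} (hi : i ∈ K) : Measurable[sigmaOn W K] (W i) :=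
  (comap_measurable (W i)).mono (le_iSup₂_of_le i hi le_rfl) le_rfl

namespace SpilloverModel

variable {Ω : Type*} [MeasurableSpace Ω] {d dx dz : ℕ} (M : SpilloverModel Ω d dx dz)

open Classical in
/-- The closed reference group: the agent and those affecting it. -/
def nbhd (n : ℕ) (i : Fin (M.N n)) : Finset (Fin (M.N n)) :=
  Finset.univ.filter fun j => j = i ∨ M.adj n i j

lemma mem_nbhd {n : ℕ} {i j : Fin (M.N n)} : j ∈ M.nbhd n i ↔ j = i ∨ M.adj n i j := by
  simp [nbhd]

lemma smp_injective (n : ℕ) : Function.Injective (M.smp n) := Fin.castLE_injective (M.le_N n)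

lemma measurable_field (n : ℕ) (i : Fin (M.N n)) : Measurable (M.field n i) :=
  (M.measurable_X n i).prodMk ((M.measurable_Z n i).prodMk
    ((M.measurable_eps n i).prodMk (M.measurable_U n i)))

variable {M}

lemma SpatialDomain.dist_le_of_mem_nbhd {Δ : ℕ} (h : M.SpatialDomain Δ) {n : ℕ}
    {i j : Fin (M.N n)} (hj : j ∈ M.nbhd n i) : dist (M.loc n i) (M.loc n j) ≤ Δ := by
  rcases M.mem_nbhd.1 hj with rfl | hj
  · simp
  · by_contra! hlt
    refine h.local_links n i j ?_ hlt hj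
    rintro rfl
    exact M.adj_irrefl n _ hj

lemma SpatialDomain.card_nbhd_le {Δ : ℕ} (h : M.SpatialDomain Δ) (n : ℕ) (i : Fin (M.N n)) :
    (M.nbhd n i).card ≤ (2 * Δ + 1) ^ d := by
  have := card_le_of_separated_of_dist_le (s := M.nbhd n i) (p := M.loc n) (x := M.loc n i)
    (R := Δ) (fun i _ j _ hij => h.separated n i j hij) (by positivity)
    (fun j hj => by rw [dist_comm]; exact h.dist_le_of_mem_nbhd hj)
  exact_mod_cast this

/-- Under weak dependence, sums of bounded local functions of the field have variance of the order
of the sample size. -/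
theorem exists_integral_sq_sum_le {μ : Measure Ω} [IsProbabilityMeasure μ] {Δ : ℕ}
    (hD : M.SpatialDomain Δ) (hW : M.WeakDependence μ Δ) :
    ∃ C : ℝ, 0 ≤ C ∧ ∀ (n : ℕ) (f : Fin n → Ω → ℝ) (b : ℝ),
      (∀ i, StronglyMeasurable[sigmaOn (M.field n) (M.nbhd n (M.smp n i))] (f i)) →
      (∀ i, ∀ᵐ ω ∂μ, |f i ω| ≤ b) →
      ∫ ω, (∑ i, (f i ω - ∫ ω', f i ω' ∂μ)) ^ 2 ∂μ ≤ C * b ^ 2 * n := by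
  obtain ⟨ϑ, αhat, hϑ, hα, hsum⟩ := hW.rate
  set k₀ : ℕ := (2 * Δ + 1) ^ d with hk₀
  -- Nonnegativity of the rate is not assumed; it follows from nonnegativity of the mixing
  -- coefficient at k = l = 1.
  have hαhat : ∀ r, 0 ≤ αhat r := by
    intro r
    have h1 := (mixingCoeff_nonneg (μ := μ) M.loc M.field 1 1 r).trans (hα 1 1 r)
    exact nonneg_of_mul_nonneg_right h1 (by positivity)
  set A : ℝ := ((k₀ : ℝ) + k₀) ^ ϑ with hA
  have hA0 : 0 ≤ A := by positivity
  set Cd : ℝ := 2 ^ d * (2 * d * 3 ^ (d - 1)) with hCd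
  set tot := ∑' r : ℕ, (((r + 1 : ℕ) : ℝ) + 2 * Δ) ^ (d - 1) * αhat (r + 1)
  have hterm : ∀ r : ℕ, 0 ≤ (((r + 1 : ℕ) : ℝ) + 2 * Δ) ^ (d - 1) * αhat (r + 1) :=
    fun r => mul_nonneg (by positivity) (hαhat _)
  have htot0 : 0 ≤ tot := tsum_nonneg hterm
  -- The 4 is that of the covariance inequality. The first summand counts the agents within 1 + 2Δ
  -- of a given one, where the coefficient is only bounded by 1; the second sums the mixing rate
  -- over all farther shells.
  refine ⟨4 * ((2 * (1 + 2 * (Δ : ℝ)) + 1) ^ d + A * (Cd * tot)), by positivity, ?_⟩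
  intro n f b hf hb
  have hle : ∀ K, sigmaOn (M.field n) K ≤ ‹MeasurableSpace Ω› := sigmaOn_le (M.measurable_field n)
  have hfi : ∀ i, MemLp (f i) 2 μ := fun i => MemLp.of_bound
    ((hf i).mono (hle _)).aestronglyMeasurable b (by simpa [Real.norm_eq_abs] using hb i)
  have hfi1 : ∀ i, Integrable (f i) μ := fun i => (hfi i).integrable (by norm_num)
  have hff : ∀ i j, Integrable (fun ω => f i ω * f j ω) μ := fun i j => (hfi i).integrable_mul (hfi j)
  have hcc : ∀ i j, Integrable
      (fun ω => (f i ω - ∫ ω', f i ω' ∂μ) * (f j ω - ∫ ω', f j ω' ∂μ)) μ := fun i j =>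
    ((hfi i).sub (memLp_const _)).integrable_mul ((hfi j).sub (memLp_const _))
  set dst : Fin n → Fin n → ℝ := fun i j => dist (M.loc n (M.smp n j)) (M.loc n (M.smp n i))
  have hexp : ∫ ω, (∑ i, (f i ω - ∫ ω', f i ω' ∂μ)) ^ 2 ∂μ =
      ∑ i, ∑ j, (∫ ω, f i ω * f j ω ∂μ - (∫ ω, f i ω ∂μ) * ∫ ω, f j ω ∂μ) := by
    simp_rw [sq, Finset.sum_mul_sum]
    rw [integral_finsetSum _ fun i _ => integrable_finsetSum _ fun j _ => hcc i j]
    refine Finset.sum_congr rfl fun i _ => ?_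
    rw [integral_finsetSum _ fun j _ => hcc i j]
    refine Finset.sum_congr rfl fun j _ => ?_
    have e : ∀ ω, (f i ω - ∫ ω', f i ω' ∂μ) * (f j ω - ∫ ω', f j ω' ∂μ) =
        f i ω * f j ω - (∫ ω', f j ω' ∂μ) * f i ω - (∫ ω', f i ω' ∂μ) * f j ω +
          (∫ ω', f i ω' ∂μ) * ∫ ω', f j ω' ∂μ := fun ω => by ring
    simp_rw [e]
    have i1 : Integrable (fun ω => (∫ ω', f j ω' ∂μ) * f i ω) μ := (hfi1 i).const_mul _
    have i2 : Integrable (fun ω => (∫ ω', f i ω' ∂μ) * f j ω) μ := (hfi1 j).const_mul _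
    have i3 : Integrable (fun ω => f i ω * f j ω - (∫ ω', f j ω' ∂μ) * f i ω) μ := (hff i j).sub i1
    have i4 : Integrable (fun ω => f i ω * f j ω - (∫ ω', f j ω' ∂μ) * f i ω -
      (∫ ω', f i ω' ∂μ) * f j ω) μ := i3.sub i2
    rw [integral_add i4 (integrable_const _), integral_sub i3 i2, integral_sub (hff i j) i1,
      integral_const_mul, integral_const_mul]
    simp
    ring
  -- Reference groups have radius Δ, so those of two agents at distance D are at least ⌊D⌋ − 2Δ
  -- apart. The index is written as a successor to match the summable sequence; the truncated
  -- subtraction is exact because D > 1 + 2Δ in that branch.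
  have hcov : ∀ i j, ∫ ω, f i ω * f j ω ∂μ - (∫ ω, f i ω ∂μ) * ∫ ω, f j ω ∂μ ≤
      4 * b ^ 2 * (if dst i j ≤ 1 + 2 * (Δ : ℝ) then 1 else
        A * αhat ((⌊dst i j⌋₊ - 2 * Δ - 1) + 1)) := by
    intro i j
    have h1 := (le_abs_self _).trans
      (abs_covariance_le_alphaCoeff (hle _) (hle _) (hf i) (hf j) (hb i) (hb j))
    rw [show 4 * b * b = 4 * b ^ 2 by ring] at h1
    refine h1.trans (mul_le_mul_of_nonneg_left ?_ (by positivity))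
    split_ifs with hij
    · exact alphaCoeff_le_one
    · push Not at hij
      have hfl : 1 + 2 * Δ ≤ ⌊dst i j⌋₊ := Nat.le_floor (by push_cast; exact hij.le)
      have hr : ⌊dst i j⌋₊ - 2 * Δ - 1 + 1 + 2 * Δ = ⌊dst i j⌋₊ := by omega
      set r := ⌊dst i j⌋₊ - 2 * Δ - 1 + 1
      refine (alphaCoeff_le_mixingCoeff M.loc M.field (r := r) (hD.card_nbhd_le n _)
        (hD.card_nbhd_le n _) ?_).trans (hα _ _ _)
      intro k hk l hl
      have e1 := hD.dist_le_of_mem_nbhd hk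
      have e2 := hD.dist_le_of_mem_nbhd hl
      have e3 : (⌊dst i j⌋₊ : ℝ) ≤ dst i j := Nat.floor_le dist_nonneg
      rw [← hr] at e3
      push_cast at e3
      have e4 := dist_triangle4 (M.loc n (M.smp n i)) (M.loc n k) (M.loc n l) (M.loc n (M.smp n j))
      rw [dist_comm (M.loc n l)] at e4
      have e5 : dst i j = dist (M.loc n (M.smp n i)) (M.loc n (M.smp n j)) := dist_comm _ _
      linarith
  have hsep : ∀ i j : Fin n, i ≠ j → 1 ≤ dist (M.loc n (M.smp n i)) (M.loc n (M.smp n j)) :=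
    fun i j hij => hD.separated n _ _ fun h => hij (M.smp_injective n h)
  have hrow : ∀ i, ∑ j, (if dst i j ≤ 1 + 2 * (Δ : ℝ) then 1 else
      A * αhat ((⌊dst i j⌋₊ - 2 * Δ - 1) + 1)) ≤
      (2 * (1 + 2 * (Δ : ℝ)) + 1) ^ d + A * (Cd * tot) := by
    intro i
    rw [Finset.sum_ite]
    refine add_le_add ?_ ?_
    · rw [Finset.sum_const, nsmul_eq_mul, mul_one]
      refine card_le_of_separated_of_dist_le (p := fun j => M.loc n (M.smp n j))
        (x := M.loc n (M.smp n i)) (fun j _ k _ hjk => hsep j k hjk) (by positivity) ?_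
      intro j hj
      exact (Finset.mem_filter.1 hj).2
    · rw [← Finset.mul_sum]
      refine mul_le_mul_of_nonneg_left ?_ hA0
      -- Group the far agents by the integer part of their distance. Index q means a distance
      -- between q + 1 + 2Δ and q + 2 + 2Δ, a unit shell, and its packing count is the weight in the
      -- summability hypothesis up to the factor `Cd`.
      rw [Finset.sum_comp (fun q => αhat (q + 1)) (fun j => ⌊dst i j⌋₊ - 2 * Δ - 1)]
      calc _ ≤ ∑ q ∈ (Finset.univ.filter fun j => ¬ dst i j ≤ 1 + 2 * (Δ : ℝ)).image
            (fun j => ⌊dst i j⌋₊ - 2 * Δ - 1),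
              Cd * ((((q + 1 : ℕ) : ℝ) + 2 * Δ) ^ (d - 1) * αhat (q + 1)) := by
            refine Finset.sum_le_sum fun q _ => ?_
            rw [nsmul_eq_mul, ← mul_assoc]
            refine mul_le_mul_of_nonneg_right ?_ (hαhat _)
            refine card_le_of_separated_of_mem_shell (p := fun j => M.loc n (M.smp n j))
              (x := M.loc n (M.smp n i)) M.d_pos (fun j _ k _ hjk => hsep j k hjk) ?_ ?_
            · push_cast; linarith [(Nat.cast_nonneg q : (0 : ℝ) ≤ q), (Nat.cast_nonneg Δ : (0 : ℝ) ≤ Δ)]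
            · intro j hj
              obtain ⟨hj1, hj2⟩ := Finset.mem_filter.1 hj
              have hj3 := (Finset.mem_filter.1 hj1).2
              push Not at hj3
              have hfl : 1 + 2 * Δ ≤ ⌊dst i j⌋₊ := Nat.le_floor (by push_cast; exact hj3.le)
              have hq : ⌊dst i j⌋₊ = q + 1 + 2 * Δ := by omega
              have e1 : (⌊dst i j⌋₊ : ℝ) ≤ dst i j := Nat.floor_le dist_nonneg
              have e2 : dst i j < ⌊dst i j⌋₊ + 1 := Nat.lt_floor_add_one _
              rw [hq] at e1 e2
              push_cast at e1 e2 ⊢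
              exact ⟨e1, e2.le⟩
        _ = Cd * ∑ q ∈ (Finset.univ.filter fun j => ¬ dst i j ≤ 1 + 2 * (Δ : ℝ)).image
            (fun j => ⌊dst i j⌋₊ - 2 * Δ - 1),
              ((((q + 1 : ℕ) : ℝ) + 2 * Δ) ^ (d - 1) * αhat (q + 1)) := by rw [Finset.mul_sum]
        _ ≤ Cd * tot := mul_le_mul_of_nonneg_left
            (hsum.sum_le_tsum _ fun q _ => hterm q) (by positivity)
  rw [hexp]
  calc _ ≤ ∑ i : Fin n, ∑ j : Fin n, 4 * b ^ 2 * (if dst i j ≤ 1 + 2 * (Δ : ℝ) then 1 else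
        A * αhat ((⌊dst i j⌋₊ - 2 * Δ - 1) + 1)) :=
        Finset.sum_le_sum fun i _ => Finset.sum_le_sum fun j _ => hcov i j
    _ ≤ ∑ i : Fin n, 4 * b ^ 2 * ((2 * (1 + 2 * (Δ : ℝ)) + 1) ^ d + A * (Cd * tot)) := by
        refine Finset.sum_le_sum fun i _ => ?_
        rw [← Finset.mul_sum]
        exact mul_le_mul_of_nonneg_left (hrow i) (by positivity)
    _ = _ := by
        rw [Finset.sum_const, Finset.card_univ, Fintype.card_fin, nsmul_eq_mul]; ring

end SpilloverModel

end Mixing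

/-! ### Measurability of the model variables, locally and with respect to F_N. -/

lemma ContinuousOn.measurable_comp {α β γ : Type*} {_ : MeasurableSpace α} [TopologicalSpace β]
    [MeasurableSpace β] [OpensMeasurableSpace β] [TopologicalSpace γ] [MeasurableSpace γ]
    [BorelSpace γ] {f : β → γ} {s : Set β} {u : α → β} (hf : ContinuousOn f s) (hu : Measurable u)
    (h : ∀ x, u x ∈ s) : Measurable fun x => f (u x) :=
  (continuousOn_iff_continuous_domRestrict.1 hf).measurable.comp (hu.subtype_mk (h := h))

namespace SpilloverModel

variable {Ω : Type*} {𝒢 : MeasurableSpace Ω} [MeasurableSpace Ω] {d dx dz : ℕ}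
  (M : SpilloverModel Ω d dx dz)

/-- The image of (0, 1) under the continuous η is an interval, hence convex, and so contains
weighted averages of its points. -/
lemma exists_eta_eq_sum (n : ℕ) (i : Fin (M.N n)) (ω : Ω) :
    ∃ v ∈ Set.Ioo (0 : ℝ) 1, M.eta v = ∑ j, M.a n i j * M.eta (M.U n j ω) := by
  have hconv : Convex ℝ (M.eta '' Set.Ioo 0 1) :=
    (isPreconnected_Ioo.image _ M.eta_continuous).ordConnected.convex
  have := hconv.sum_mem (t := Finset.univ) (w := M.a n i) (z := fun j => M.eta (M.U n j ω))
    (fun j _ => M.a_nonneg n i j) (M.a_sum n i) (fun j _ => ⟨_, M.U_mem n j ω, rfl⟩)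
  simpa using this

lemma V_mem (n : ℕ) (i : Fin (M.N n)) (ω : Ω) : M.V n i ω ∈ Set.Ioo (0 : ℝ) 1 :=
  Function.invFunOn_mem (M.exists_eta_eq_sum n i ω)

lemma eta_V (n : ℕ) (i : Fin (M.N n)) (ω : Ω) :
    M.eta (M.V n i ω) = ∑ j, M.a n i j * M.eta (M.U n j ω) :=
  Function.invFunOn_eq (M.exists_eta_eq_sum n i ω)

lemma a_eq_zero {n : ℕ} {i j : Fin (M.N n)} (h : ¬ M.adj n i j) : M.a n i j = 0 :=
  le_antisymm (not_lt.1 fun h' => h ((M.a_pos_iff n i j).1 h')) (M.a_nonneg n i j)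

variable {M} {n : ℕ} {i : Fin (M.N n)}

lemma measurable_sum_weights {u : Fin (M.N n) → Ω → ℝ}
    (h : ∀ j, M.adj n i j → Measurable[𝒢] (u j)) :
    Measurable[𝒢] fun ω => ∑ j, M.a n i j * u j ω := by
  refine Finset.measurable_sum _ fun j _ => ?_
  by_cases hj : M.adj n i j
  · exact (h j hj).const_mul _
  · simp only [M.a_eq_zero hj, zero_mul]
    exact measurable_const

lemma measurable_eta_U (hU : Measurable[𝒢] (M.U n i)) :
    Measurable[𝒢] fun ω => M.eta (M.U n i ω) :=
  M.eta_continuous.measurable_comp hU (M.U_mem n i)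

lemma measurable_T (hX : Measurable[𝒢] (M.X n i)) (hZ : Measurable[𝒢] (M.Z n i))
    (hU : Measurable[𝒢] (M.U n i)) : Measurable[𝒢] (M.T n i) :=
  (M.measurable_pi.comp (hX.prodMk hZ)).add (measurable_eta_U hU)

lemma measurable_S (h : ∀ j, M.adj n i j → Measurable[𝒢] (M.T n j)) : Measurable[𝒢] (M.S n i) :=
  (M.m_continuous n i).measurable.comp (measurable_sum_weights h)

/-- `V` is defined through a choice of inverse, so measurability is read off the sublevel sets: for
c in (0, 1), V ≤ c means that the average of the η(U_j) is at most η(c). Only neighbours carry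
weight, so V is local. -/
lemma measurable_V (h : ∀ j, M.adj n i j → Measurable[𝒢] (M.U n j)) : Measurable[𝒢] (M.V n i) := by
  have hs : Measurable[𝒢] fun ω => ∑ j, M.a n i j * M.eta (M.U n j ω) :=
    measurable_sum_weights fun j hj => measurable_eta_U (h j hj)
  refine measurable_of_Iic fun c => ?_
  by_cases h0 : c ≤ 0
  · rw [show M.V n i ⁻¹' Set.Iic c = ∅ from ?_]
    · exact @MeasurableSet.empty _ 𝒢
    · ext ω
      simpa using h0.trans_lt (M.V_mem n i ω).1
  by_cases h1 : 1 ≤ c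
  · rw [show M.V n i ⁻¹' Set.Iic c = Set.univ from ?_]
    · exact @MeasurableSet.univ _ 𝒢
    · ext ω
      simpa using (M.V_mem n i ω).2.le.trans h1
  push Not at h0 h1
  rw [show M.V n i ⁻¹' Set.Iic c = {ω | ∑ j, M.a n i j * M.eta (M.U n j ω) ≤ M.eta c} from ?_]
  · exact measurableSet_le hs measurable_const
  · ext ω
    rw [Set.mem_ofPred_eq, ← M.eta_V, M.eta_strictMono.le_iff_le (M.V_mem n i ω) ⟨h0, h1⟩]
    rfl

variable (M)

lemma sigmaF_le (n : ℕ) : M.sigmaF n ≤ ‹MeasurableSpace Ω› :=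
  sigmaOn_le (fun i => (M.measurable_X n i).prodMk ((M.measurable_Z n i).prodMk
    (M.measurable_U n i))) _

lemma measurable_XZU_sigmaF (n : ℕ) (i : Fin (M.N n)) :
    Measurable[M.sigmaF n] fun ω => (M.X n i ω, M.Z n i ω, M.U n i ω) :=
  measurable_sigmaOn (fun i ω => (M.X n i ω, M.Z n i ω, M.U n i ω)) (Finset.mem_univ i)

lemma measurable_X_sigmaF (n : ℕ) (i : Fin (M.N n)) : Measurable[M.sigmaF n] (M.X n i) :=
  measurable_fst.comp (M.measurable_XZU_sigmaF n i)

lemma measurable_Z_sigmaF (n : ℕ) (i : Fin (M.N n)) : Measurable[M.sigmaF n] (M.Z n i) :=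
  (measurable_fst.comp measurable_snd).comp (M.measurable_XZU_sigmaF n i)

lemma measurable_U_sigmaF (n : ℕ) (i : Fin (M.N n)) : Measurable[M.sigmaF n] (M.U n i) :=
  (measurable_snd.comp measurable_snd).comp (M.measurable_XZU_sigmaF n i)

lemma measurable_T_sigmaF (n : ℕ) (i : Fin (M.N n)) : Measurable[M.sigmaF n] (M.T n i) :=
  measurable_T (M.measurable_X_sigmaF n i) (M.measurable_Z_sigmaF n i) (M.measurable_U_sigmaF n i)

lemma measurable_S_sigmaF (n : ℕ) (i : Fin (M.N n)) : Measurable[M.sigmaF n] (M.S n i) :=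
  measurable_S fun j _ => M.measurable_T_sigmaF n j

lemma measurable_V_sigmaF (n : ℕ) (i : Fin (M.N n)) : Measurable[M.sigmaF n] (M.V n i) :=
  measurable_V fun j _ => M.measurable_U_sigmaF n j

/-- The `σ`-algebra of the field on the closed reference group of an agent. -/
@[reducible] def sigmaNbhd (n : ℕ) (i : Fin (M.N n)) : MeasurableSpace Ω :=
  sigmaOn (M.field n) (M.nbhd n i)

lemma sigmaNbhd_le (n : ℕ) (i : Fin (M.N n)) : M.sigmaNbhd n i ≤ ‹MeasurableSpace Ω› :=
  sigmaOn_le (M.measurable_field n) _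

variable {j : Fin (M.N n)}

lemma measurable_X_sigmaNbhd (h : j ∈ M.nbhd n i) : Measurable[M.sigmaNbhd n i] (M.X n j) :=
  measurable_fst.comp (measurable_sigmaOn (M.field n) h)

lemma measurable_Z_sigmaNbhd (h : j ∈ M.nbhd n i) : Measurable[M.sigmaNbhd n i] (M.Z n j) :=
  (measurable_fst.comp measurable_snd).comp (measurable_sigmaOn (M.field n) h)

lemma measurable_U_sigmaNbhd (h : j ∈ M.nbhd n i) : Measurable[M.sigmaNbhd n i] (M.U n j) :=
  (measurable_snd.comp (measurable_snd.comp measurable_snd)).comp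
    (measurable_sigmaOn (M.field n) h)

lemma measurable_T_sigmaNbhd (h : j ∈ M.nbhd n i) : Measurable[M.sigmaNbhd n i] (M.T n j) :=
  measurable_T (M.measurable_X_sigmaNbhd h) (M.measurable_Z_sigmaNbhd h)
    (M.measurable_U_sigmaNbhd h)

lemma measurable_S_sigmaNbhd (n : ℕ) (i : Fin (M.N n)) : Measurable[M.sigmaNbhd n i] (M.S n i) :=
  measurable_S fun _ hj => M.measurable_T_sigmaNbhd (M.mem_nbhd.2 (Or.inr hj))

lemma measurable_V_sigmaNbhd (n : ℕ) (i : Fin (M.N n)) : Measurable[M.sigmaNbhd n i] (M.V n i) :=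
  measurable_V fun _ hj => M.measurable_U_sigmaNbhd (M.mem_nbhd.2 (Or.inr hj))

lemma self_mem_nbhd (n : ℕ) (i : Fin (M.N n)) : i ∈ M.nbhd n i := M.mem_nbhd.2 (Or.inl rfl)

end SpilloverModel

/-! ### Deterministic bounds for ridge regression. -/

namespace Matrix

variable {κ ι : Type*} [Fintype κ] [Fintype ι]

lemma dotProduct_self_nonneg_real (v : ι → ℝ) : 0 ≤ v ⬝ᵥ v :=
  Finset.sum_nonneg fun _ _ => mul_self_nonneg _

lemma dotProduct_sq_le (v w : ι → ℝ) : (v ⬝ᵥ w) ^ 2 ≤ (v ⬝ᵥ v) * (w ⬝ᵥ w) := by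
  simpa only [dotProduct, ← sq] using Finset.sum_mul_sq_le_sq_mul_sq Finset.univ v w

lemma sq_apply_le_dotProduct_self (v : ι → ℝ) (k : ι) : v k ^ 2 ≤ v ⬝ᵥ v := by
  rw [sq]
  exact Finset.single_le_sum (f := fun k => v k * v k) (fun _ _ => mul_self_nonneg _)
    (Finset.mem_univ k)

lemma IsHermitian.mul_dotProduct_le_of_le_spectrum [DecidableEq ι] {A : Matrix ι ι ℝ}
    (hA : A.IsHermitian) {c : ℝ} (h : ∀ ρ ∈ spectrum ℝ A, c ≤ ρ) (v : ι → ℝ) :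
    c * (v ⬝ᵥ v) ≤ v ⬝ᵥ A *ᵥ v := by
  have hherm : (A - algebraMap ℝ (Matrix ι ι ℝ) c).IsHermitian := by
    refine hA.sub ?_
    rw [Algebra.algebraMap_eq_smul_one]
    simp [IsHermitian]
  have hps : (A - algebraMap ℝ (Matrix ι ι ℝ) c).PosSemidef := by
    rw [posSemidef_iff_isHermitian_and_spectrum_nonneg]
    refine ⟨hherm, ?_⟩
    rw [← spectrum.sub_singleton_eq]
    rintro x ⟨ρ, hρ, y, rfl, rfl⟩
    exact sub_nonneg.2 (h ρ hρ)
  have := hps.dotProduct_mulVec_nonneg v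
  rw [sub_mulVec, Algebra.algebraMap_eq_smul_one, smul_mulVec, one_mulVec, dotProduct_sub,
    dotProduct_smul, smul_eq_mul, star_trivial] at this
  linarith

lemma IsHermitian.dotProduct_le_of_spectrum_le [DecidableEq ι] {A : Matrix ι ι ℝ}
    (hA : A.IsHermitian) {c : ℝ} (h : ∀ ρ ∈ spectrum ℝ A, ρ ≤ c) (v : ι → ℝ) :
    v ⬝ᵥ A *ᵥ v ≤ c * (v ⬝ᵥ v) := by
  have := hA.neg.mul_dotProduct_le_of_le_spectrum (c := -c) (fun ρ hρ => by
    rw [← spectrum.neg_eq, Set.mem_neg] at hρ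
    linarith [h _ hρ]) v
  rw [neg_mulVec, dotProduct_neg] at this
  linarith

/-- The Cauchy–Schwarz inequality for a positive semidefinite form. -/
lemma PosSemidef.dotProduct_mulVec_sq_le {D : Matrix ι ι ℝ} (hD : D.PosSemidef) (x y : ι → ℝ) :
    (x ⬝ᵥ D *ᵥ y) ^ 2 ≤ (x ⬝ᵥ D *ᵥ x) * (y ⬝ᵥ D *ᵥ y) := by
  have hsymm : y ⬝ᵥ D *ᵥ x = x ⬝ᵥ D *ᵥ y := by
    have h : Dᵀ = D := by simpa [IsHermitian, conjTranspose_eq_transpose_of_trivial] using hD.1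
    rw [dotProduct_mulVec, ← mulVec_transpose, h, dotProduct_comm]
  have h : ∀ t : ℝ, 0 ≤ (x ⬝ᵥ D *ᵥ x) * (t * t) + (2 * (x ⬝ᵥ D *ᵥ y)) * t + y ⬝ᵥ D *ᵥ y := by
    intro t
    have h1 := hD.dotProduct_mulVec_nonneg (t • x + y)
    simp only [star_trivial, mulVec_add, mulVec_smul, add_dotProduct, dotProduct_add,
      smul_dotProduct, dotProduct_smul, smul_eq_mul, hsymm] at h1
    linarith
  have := discrim_le_zero h
  rw [discrim] at this
  linarith

section Ridge

variable {P : Matrix κ ι ℝ} {D : Matrix ι ι ℝ} {c t : ℝ}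

lemma dotProduct_gram_add_smul_mulVec (P : Matrix κ ι ℝ) (D : Matrix ι ι ℝ) (t : ℝ) (v : ι → ℝ) :
    v ⬝ᵥ (Pᵀ * P + t • D) *ᵥ v = (P *ᵥ v) ⬝ᵥ (P *ᵥ v) + t * (v ⬝ᵥ D *ᵥ v) := by
  rw [add_mulVec, dotProduct_add, smul_mulVec, dotProduct_smul, smul_eq_mul, ← mulVec_mulVec,
    dotProduct_mulVec v, vecMul_transpose]

lemma gram_le_ridge (hD : D.PosSemidef) (ht : 0 ≤ t) (v : ι → ℝ) :
    (P *ᵥ v) ⬝ᵥ (P *ᵥ v) ≤ v ⬝ᵥ (Pᵀ * P + t • D) *ᵥ v := by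
  rw [dotProduct_gram_add_smul_mulVec]
  have := hD.dotProduct_mulVec_nonneg v
  rw [star_trivial] at this
  nlinarith [mul_nonneg ht this]

variable [DecidableEq ι]

lemma isUnit_det_ridge (hD : D.PosSemidef) (ht : 0 ≤ t) (hc : 0 < c)
    (hP : ∀ v, c * (v ⬝ᵥ v) ≤ (P *ᵥ v) ⬝ᵥ (P *ᵥ v)) : IsUnit (Pᵀ * P + t • D).det := by
  rw [← isUnit_iff_isUnit_det]
  refine PosDef.isUnit (PosDef.of_dotProduct_mulVec_pos ?_ ?_)
  · refine IsHermitian.add ?_ ?_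
    · rw [IsHermitian, conjTranspose_eq_transpose_of_trivial, transpose_mul, transpose_transpose]
    · rw [IsHermitian, conjTranspose_smul, hD.1.eq, star_trivial]
  · intro v hv
    rw [star_trivial]
    have h0 : 0 < v ⬝ᵥ v := lt_of_le_of_ne (dotProduct_self_nonneg_real v)
      fun h => hv (dotProduct_self_eq_zero.1 h.symm)
    exact (mul_pos hc h0).trans_le ((hP v).trans (gram_le_ridge hD ht v))

lemma ridge_mulVec_inv (hD : D.PosSemidef) (ht : 0 ≤ t) (hc : 0 < c)
    (hP : ∀ v, c * (v ⬝ᵥ v) ≤ (P *ᵥ v) ⬝ᵥ (P *ᵥ v)) (y : ι → ℝ) :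
    (Pᵀ * P + t • D) *ᵥ ((Pᵀ * P + t • D)⁻¹ *ᵥ y) = y := by
  rw [mulVec_mulVec, mul_nonsing_inv _ (isUnit_det_ridge hD ht hc hP), one_mulVec]

/-- For w = A⁻¹Pᵀr, ‖Pw‖² ≤ wᵀAw = (Pw)·r ≤ ‖Pw‖‖r‖, so ‖Pw‖ ≤ ‖r‖, and the lower bound on P turns
this into a bound on w. No upper bound on P is needed. -/
lemma ridge_inv_transpose_mulVec_le (hD : D.PosSemidef) (ht : 0 ≤ t) (hc : 0 < c)
    (hP : ∀ v, c * (v ⬝ᵥ v) ≤ (P *ᵥ v) ⬝ᵥ (P *ᵥ v)) (r : κ → ℝ) :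
    c * (((Pᵀ * P + t • D)⁻¹ *ᵥ (Pᵀ *ᵥ r)) ⬝ᵥ ((Pᵀ * P + t • D)⁻¹ *ᵥ (Pᵀ *ᵥ r))) ≤ r ⬝ᵥ r := by
  have hw := ridge_mulVec_inv hD ht hc hP (Pᵀ *ᵥ r)
  set w := (Pᵀ * P + t • D)⁻¹ *ᵥ (Pᵀ *ᵥ r)
  have h1 := gram_le_ridge (P := P) hD ht w
  rw [hw, dotProduct_mulVec w, vecMul_transpose] at h1
  have h2 := dotProduct_sq_le (P *ᵥ w) r
  have h3 := hP w
  have h4 := dotProduct_self_nonneg_real (P *ᵥ w)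
  have h5 := dotProduct_self_nonneg_real r
  refine h3.trans ?_
  by_contra! hlt
  nlinarith

/-- For w = A⁻¹(tDθ), c‖w‖² ≤ wᵀAw = t wᵀDθ. Cauchy–Schwarz in the form D bounds wᵀDθ by √(wᵀDw)
√(θᵀDθ) with wᵀDw ≤ CD‖w‖², so one factor ‖w‖ cancels and θ enters only through θᵀDθ. -/
lemma ridge_inv_penalty_le {CD : ℝ} (hD : D.PosSemidef) (ht : 0 ≤ t) (hc : 0 < c)
    (hP : ∀ v, c * (v ⬝ᵥ v) ≤ (P *ᵥ v) ⬝ᵥ (P *ᵥ v))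
    (hCD : ∀ v, v ⬝ᵥ D *ᵥ v ≤ CD * (v ⬝ᵥ v)) (θ : ι → ℝ) :
    c ^ 2 * (((Pᵀ * P + t • D)⁻¹ *ᵥ (t • D *ᵥ θ)) ⬝ᵥ ((Pᵀ * P + t • D)⁻¹ *ᵥ (t • D *ᵥ θ))) ≤
      CD * (t ^ 2 * (θ ⬝ᵥ D *ᵥ θ)) := by
  have hw := ridge_mulVec_inv hD ht hc hP (t • D *ᵥ θ)
  set w := (Pᵀ * P + t • D)⁻¹ *ᵥ (t • D *ᵥ θ)
  have h1 := (hP w).trans (gram_le_ridge (P := P) hD ht w)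
  rw [hw, dotProduct_smul, smul_eq_mul] at h1
  have h2 := hD.dotProduct_mulVec_sq_le w θ
  have h3 := hCD w
  have h4 := hCD θ
  have h5 := dotProduct_self_nonneg_real w
  have h6 := hD.dotProduct_mulVec_nonneg θ
  rw [star_trivial] at h6
  -- If w = 0 there is nothing to divide by, and the right side must be shown nonnegative; the sign
  -- of CD is recovered from the bound at θ.
  rcases h5.eq_or_lt with h0 | h0
  · rw [← h0, mul_zero]
    have h7 := dotProduct_self_nonneg_real θ
    rcases h7.eq_or_lt with h8 | h8
    · rw [← h8, mul_zero] at h4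
      rw [le_antisymm h4 h6]; simp
    · have : 0 ≤ CD := nonneg_of_mul_nonneg_left (h6.trans h4) h8
      positivity
  · have h8 : (c * (w ⬝ᵥ w)) ^ 2 ≤ (t * (w ⬝ᵥ D *ᵥ θ)) ^ 2 :=
      pow_le_pow_left₀ (by positivity) h1 2
    have h9 : (w ⬝ᵥ D *ᵥ θ) ^ 2 ≤ CD * (w ⬝ᵥ w) * (θ ⬝ᵥ D *ᵥ θ) :=
      h2.trans (mul_le_mul_of_nonneg_right h3 h6)
    have h10 : (t * (w ⬝ᵥ D *ᵥ θ)) ^ 2 ≤ t ^ 2 * (CD * (w ⬝ᵥ w) * (θ ⬝ᵥ D *ᵥ θ)) := by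
      rw [mul_pow]; exact mul_le_mul_of_nonneg_left h9 (by positivity)
    refine le_of_mul_le_mul_right ?_ h0
    calc _ = (c * (w ⬝ᵥ w)) ^ 2 := by ring
      _ ≤ _ := h8.trans h10
      _ = _ := by ring

/-- Let a be the k-th row of A⁻¹. Then ‖Pa‖² ≤ aᵀAa = a_k, while c a_k² ≤ c‖a‖² ≤ ‖Pa‖². Hence c
a_k² ≤ a_k, so a_k ≤ 1/c, and ‖Pa‖² is the required sum of squares. -/
lemma sum_sq_ridge_inv_mul_transpose_le (hD : D.PosSemidef) (ht : 0 ≤ t) (hc : 0 < c)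
    (hP : ∀ v, c * (v ⬝ᵥ v) ≤ (P *ᵥ v) ⬝ᵥ (P *ᵥ v)) (k : ι) :
    ∑ i, ((Pᵀ * P + t • D)⁻¹ * Pᵀ) k i ^ 2 ≤ 1 / c := by
  set A := Pᵀ * P + t • D with hA
  set a : ι → ℝ := A⁻¹ k with ha
  have h1 : a ⬝ᵥ A *ᵥ a = a k := by
    have : a ᵥ* A = (1 : Matrix ι ι ℝ) k := by
      rw [← nonsing_inv_mul _ (isUnit_det_ridge hD ht hc hP), ← hA]
      rfl
    rw [dotProduct_mulVec, this]
    simp [dotProduct, one_apply]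
  have h2 := gram_le_ridge (P := P) hD ht a
  rw [← hA, h1] at h2
  have h3 := hP a
  have h4 := sq_apply_le_dotProduct_self a k
  have h5 : ∑ i, (A⁻¹ * Pᵀ) k i ^ 2 = (P *ᵥ a) ⬝ᵥ (P *ᵥ a) := by
    refine Finset.sum_congr rfl fun i _ => ?_
    rw [← sq]
    congr 1
    rw [mul_apply, mulVec, dotProduct]
    refine Finset.sum_congr rfl fun l _ => ?_
    rw [transpose_apply, mul_comm]
  rw [h5]
  refine h2.trans ?_
  rw [le_div_iff₀ hc]
  by_contra! hlt
  have h6 : c * a k ^ 2 ≤ a k := (mul_le_mul_of_nonneg_left h4 hc.le).trans (h3.trans h2)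
  have h7 : 0 < a k := by nlinarith
  nlinarith

lemma ridge_sub_eq (hD : D.PosSemidef) (ht : 0 ≤ t) (hc : 0 < c)
    (hP : ∀ v, c * (v ⬝ᵥ v) ≤ (P *ᵥ v) ⬝ᵥ (P *ᵥ v)) (θ : ι → ℝ) (y r u : κ → ℝ)
    (hy : y = P *ᵥ θ + r + u) :
    (Pᵀ * P + t • D)⁻¹ *ᵥ (Pᵀ *ᵥ y) - θ =
      (Pᵀ * P + t • D)⁻¹ *ᵥ (Pᵀ *ᵥ r) + ((Pᵀ * P + t • D)⁻¹ * Pᵀ) *ᵥ u -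
        (Pᵀ * P + t • D)⁻¹ *ᵥ (t • D *ᵥ θ) := by
  have h1 : (Pᵀ * P + t • D)⁻¹ *ᵥ ((Pᵀ * P + t • D) *ᵥ θ) = θ := by
    rw [mulVec_mulVec, nonsing_inv_mul _ (isUnit_det_ridge hD ht hc hP), one_mulVec]
  have h2 : Pᵀ *ᵥ y = (Pᵀ * P + t • D) *ᵥ θ + Pᵀ *ᵥ r + Pᵀ *ᵥ u - t • D *ᵥ θ := by
    rw [hy, mulVec_add, mulVec_add, mulVec_mulVec, add_mulVec, smul_mulVec]
    abel
  rw [h2, mulVec_sub, mulVec_add, mulVec_add, h1, mulVec_mulVec u]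
  abel

end Ridge

lemma mulVec_dotProduct_self_le (P : Matrix κ ι ℝ) {δ : ℝ} (h : ∀ i, ∑ k, P i k ^ 2 ≤ δ)
    (v : ι → ℝ) : (P *ᵥ v) ⬝ᵥ (P *ᵥ v) ≤ Fintype.card κ * δ * (v ⬝ᵥ v) := by
  calc (P *ᵥ v) ⬝ᵥ (P *ᵥ v) ≤ ∑ _i : κ, δ * (v ⬝ᵥ v) := by
        refine Finset.sum_le_sum fun i _ => ?_
        rw [← sq]
        refine (dotProduct_sq_le (P i) v).trans ?_
        refine mul_le_mul_of_nonneg_right ?_ (dotProduct_self_nonneg_real v)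
        simpa only [dotProduct, ← sq] using h i
    _ = _ := by simp [Finset.sum_const, mul_assoc]

/-- Lower bounds on a Gram matrix are stable under small perturbations of the rows. -/
lemma gram_lower_bound_of_rows_close {P P' : Matrix κ ι ℝ} {c : ℝ}
    (hP : ∀ v, Fintype.card κ * c * (v ⬝ᵥ v) ≤ (P *ᵥ v) ⬝ᵥ (P *ᵥ v))
    (h : ∀ i, ∑ k, (P' i k - P i k) ^ 2 ≤ c / 4) (v : ι → ℝ) :
    Fintype.card κ * (c / 4) * (v ⬝ᵥ v) ≤ (P' *ᵥ v) ⬝ᵥ (P' *ᵥ v) := by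
  have h1 := mulVec_dotProduct_self_le (P' - P) (by simpa using h) v
  -- Convexity of the square. With perturbation at most c/4 per row, half of c is lost and the
  -- factor 2 halves the rest, which leaves c/4.
  have h2 : (P *ᵥ v) ⬝ᵥ (P *ᵥ v) ≤
      2 * ((P' *ᵥ v) ⬝ᵥ (P' *ᵥ v)) + 2 * (((P' - P) *ᵥ v) ⬝ᵥ ((P' - P) *ᵥ v)) := by
    rw [sub_mulVec]
    simp only [dotProduct, Finset.mul_sum, ← Finset.sum_add_distrib, Pi.sub_apply]
    refine Finset.sum_le_sum fun i _ => ?_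
    nlinarith [sq_nonneg ((P' *ᵥ v) i + ((P' *ᵥ v) i - (P *ᵥ v) i))]
  have h3 := hP v
  linarith

/-- Lower bounds on a quadratic form are stable under small perturbations in Frobenius norm. -/
lemma quadratic_lower_bound_of_frobenius_close {A G : Matrix ι ι ℝ} {c : ℝ} (hc : 0 ≤ c)
    (hG : ∀ v, c * (v ⬝ᵥ v) ≤ v ⬝ᵥ G *ᵥ v)
    (h : ∑ k, ∑ l, (A k l - G k l) ^ 2 ≤ (c / 2) ^ 2) (v : ι → ℝ) :
    c / 2 * (v ⬝ᵥ v) ≤ v ⬝ᵥ A *ᵥ v := by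
  have h0 := dotProduct_self_nonneg_real v
  have h1 : (v ⬝ᵥ (A - G) *ᵥ v) ^ 2 ≤ (c / 2 * (v ⬝ᵥ v)) ^ 2 := by
    refine (dotProduct_sq_le v _).trans ?_
    -- The Frobenius norm dominates the operator norm, by Cauchy–Schwarz in each row.
    have h2 : ((A - G) *ᵥ v) ⬝ᵥ ((A - G) *ᵥ v) ≤ (c / 2) ^ 2 * (v ⬝ᵥ v) := by
      refine le_trans ?_ (mul_le_mul_of_nonneg_right h h0)
      rw [Finset.sum_mul]
      refine Finset.sum_le_sum fun k _ => ?_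
      rw [← sq]
      refine (dotProduct_sq_le ((A - G) k) v).trans (le_of_eq ?_)
      simp only [dotProduct, ← sq, sub_apply]
    nlinarith
  have h3 := abs_le_of_sq_le_sq' h1 (by positivity)
  rw [sub_mulVec, dotProduct_sub] at h3
  linarith [hG v, h3.1]

end Matrix

/-! ### Calculus of stochastic orders and high-probability events. -/

section StochasticOrder

variable {Ω : Type*} [MeasurableSpace Ω] {μ : Measure Ω}

/-- The events `A_n` have probability tending to one. -/
def WithHighProb (μ : Measure Ω) (A : ℕ → Set Ω) : Prop :=
  ∀ ε : ℝ, 0 < ε → ∀ᶠ n in atTop, μ (A n)ᶜ ≤ ENNReal.ofReal ε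

lemma WithHighProb.inter {A B : ℕ → Set Ω} (hA : WithHighProb μ A) (hB : WithHighProb μ B) :
    WithHighProb μ fun n => A n ∩ B n := by
  intro ε hε
  filter_upwards [hA (ε / 2) (by positivity), hB (ε / 2) (by positivity)] with n h1 h2
  rw [Set.compl_inter]
  refine (measure_union_le _ _).trans ((add_le_add h1 h2).trans (le_of_eq ?_))
  rw [← ENNReal.ofReal_add (by positivity) (by positivity), add_halves]

lemma WithHighProb.mono {A B : ℕ → Set Ω} (hA : WithHighProb μ A)
    (h : ∀ᶠ n in atTop, A n ⊆ B n) : WithHighProb μ B := by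
  intro ε hε
  filter_upwards [hA ε hε, h] with n h1 h2
  exact (measure_mono (Set.compl_subset_compl.2 h2)).trans h1

lemma WithHighProb.of_ae {p : ℕ → Ω → Prop} (h : ∀ n, ∀ᵐ ω ∂μ, p n ω) :
    WithHighProb μ fun n => {ω | p n ω} := by
  intro ε _
  refine Eventually.of_forall fun n => ?_
  have : μ {ω | p n ω}ᶜ = 0 := h n
  rw [this]
  exact zero_le

lemma IsBigOP.add {Y Z : ℕ → Ω → ℝ} {r : ℕ → ℝ} (hY : IsBigOP μ Y r) (hZ : IsBigOP μ Z r) :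
    IsBigOP μ (fun n ω => Y n ω + Z n ω) r := by
  intro ε hε
  obtain ⟨M₁, hM₁, h1⟩ := hY (ε / 2) (by positivity)
  obtain ⟨M₂, hM₂, h2⟩ := hZ (ε / 2) (by positivity)
  refine ⟨M₁ + M₂, by positivity, ?_⟩
  filter_upwards [h1, h2] with n h1 h2
  have hsub : {ω | (M₁ + M₂) * r n < |Y n ω + Z n ω|} ⊆
      {ω | M₁ * r n < |Y n ω|} ∪ {ω | M₂ * r n < |Z n ω|} := by
    intro ω hω
    by_contra hcon
    simp only [Set.mem_union, Set.mem_ofPred_eq, not_or, not_lt] at hcon hω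
    have := abs_add_le (Y n ω) (Z n ω)
    linarith [hcon.1, hcon.2, add_mul M₁ M₂ (r n)]
  refine (measure_mono hsub).trans ((measure_union_le _ _).trans
    ((add_le_add h1 h2).trans (le_of_eq ?_)))
  rw [← ENNReal.ofReal_add (by positivity) (by positivity), add_halves]

lemma IsBigOP.mono_rate {Z : ℕ → Ω → ℝ} {r r' : ℕ → ℝ} {C : ℝ} (hZ : IsBigOP μ Z r) (hC : 0 < C)
    (h : ∀ᶠ n in atTop, r n ≤ C * r' n) : IsBigOP μ Z r' := by
  intro ε hε
  obtain ⟨M, hM, h1⟩ := hZ ε hε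
  refine ⟨M * C, by positivity, ?_⟩
  filter_upwards [h1, h] with n h1 h2
  refine (measure_mono fun ω hω => ?_).trans h1
  simp only [Set.mem_ofPred_eq] at hω ⊢
  refine lt_of_le_of_lt ?_ hω
  rw [mul_assoc]
  exact mul_le_mul_of_nonneg_left h2 hM.le

lemma IsBigOP.of_le {Z Z' : ℕ → Ω → ℝ} {r : ℕ → ℝ} {C : ℝ} {A : ℕ → Set Ω}
    (hZ : IsBigOP μ Z r) (hA : WithHighProb μ A) (hC : 0 < C)
    (h : ∀ᶠ n in atTop, ∀ ω ∈ A n, |Z' n ω| ≤ C * |Z n ω|) : IsBigOP μ Z' r := by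
  intro ε hε
  obtain ⟨M, hM, h1⟩ := hZ (ε / 2) (by positivity)
  refine ⟨M * C, by positivity, ?_⟩
  filter_upwards [h1, hA (ε / 2) (by positivity), h] with n h1 h2 h3
  have hsub : {ω | M * C * r n < |Z' n ω|} ⊆ {ω | M * r n < |Z n ω|} ∪ (A n)ᶜ := by
    intro ω hω
    by_cases hωA : ω ∈ A n
    · left
      simp only [Set.mem_ofPred_eq] at hω ⊢
      have := hω.trans_le (h3 ω hωA)
      rw [mul_comm M C, mul_assoc] at this
      exact lt_of_mul_lt_mul_left this hC.le
    · right; exact hωA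
  refine (measure_mono hsub).trans ((measure_union_le _ _).trans
    ((add_le_add h1 h2).trans (le_of_eq ?_)))
  rw [← ENNReal.ofReal_add (by positivity) (by positivity), add_halves]

lemma IsBigOP.of_deterministic {r r' : ℕ → ℝ} (h : ∀ᶠ n in atTop, |r n| ≤ r' n) :
    IsBigOP μ (fun n _ => r n) r' := by
  intro ε _
  refine ⟨1, one_pos, ?_⟩
  filter_upwards [h] with n hn
  simp only [one_mul, not_lt.2 hn]
  simp

/-- Chebyshev's inequality as a stochastic order. -/
lemma IsBigOP.of_integral_sq_le [IsProbabilityMeasure μ] {Z : ℕ → Ω → ℝ} {r : ℕ → ℝ} {C : ℝ}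
    (hi : ∀ n, Integrable (fun ω => Z n ω ^ 2) μ) (hr : ∀ᶠ n in atTop, 0 < r n)
    (h : ∀ᶠ n in atTop, ∫ ω, Z n ω ^ 2 ∂μ ≤ C * r n ^ 2) : IsBigOP μ Z r := by
  intro ε hε
  -- Chosen so that the Markov bound C r² / (m r)² is at most ε; the added 1 keeps the constant
  -- positive.
  refine ⟨√((|C| + 1) / ε), by positivity, ?_⟩
  filter_upwards [hr, h] with n hr h
  set m := √((|C| + 1) / ε) with hm
  have hm2 : m ^ 2 = (|C| + 1) / ε := Real.sq_sqrt (by positivity)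
  have hsub : {ω | m * r n < |Z n ω|} ⊆ {ω | (m * r n) ^ 2 ≤ Z n ω ^ 2} := by
    intro ω hω
    simp only [Set.mem_ofPred_eq] at hω ⊢
    rw [← sq_abs (Z n ω)]
    exact pow_le_pow_left₀ (by positivity) hω.le 2
  have h1 := mul_meas_ge_le_integral_of_nonneg (Eventually.of_forall fun ω => sq_nonneg (Z n ω))
    (hi n) ((m * r n) ^ 2)
  have h2 : (m * r n) ^ 2 * μ.real {ω | (m * r n) ^ 2 ≤ Z n ω ^ 2} ≤ (m * r n) ^ 2 * ε := by
    refine h1.trans (h.trans ?_)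
    rw [mul_pow, hm2, mul_right_comm, div_mul_cancel₀ _ hε.ne']
    refine mul_le_mul_of_nonneg_right ?_ (by positivity)
    linarith [le_abs_self C]
  have h3 := le_of_mul_le_mul_left h2 (by positivity)
  refine (measure_mono hsub).trans ?_
  rw [← ENNReal.ofReal_toReal (measure_ne_top μ _)]
  exact ENNReal.ofReal_le_ofReal h3

lemma IsBigOP.withHighProb {Z : ℕ → Ω → ℝ} {r s : ℕ → ℝ} (hZ : IsBigOP μ Z r)
    (hs : ∀ᶠ n in atTop, 0 ≤ s n) (h : Tendsto (fun n => s n * r n) atTop (𝓝 0)) {c : ℝ}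
    (hc : 0 < c) : WithHighProb μ fun n => {ω | s n * |Z n ω| ≤ c} := by
  intro ε hε
  obtain ⟨M, hM, h1⟩ := hZ ε hε
  have h2 : Tendsto (fun n => M * (s n * r n)) atTop (𝓝 0) := by simpa using h.const_mul M
  filter_upwards [h1, hs, h2.eventually_le_const hc] with n h1 hs h2
  refine (measure_mono fun ω hω => ?_).trans h1
  simp only [Set.mem_compl_iff, Set.mem_ofPred_eq, not_le] at hω ⊢
  by_contra! hle
  have := mul_le_mul_of_nonneg_left hle hs
  linarith [mul_left_comm (s n) M (r n)]

end StochasticOrder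

/-! ### Second moments of weighted error sums and of local averages. -/

namespace SpilloverModel

variable {Ω : Type*} {𝒢 : MeasurableSpace Ω} [MeasurableSpace Ω] {d dx dz : ℕ}
  (M : SpilloverModel Ω d dx dz)
  {μ : Measure Ω}

/-- The outcome unobservable net of the control function. -/
def err (n : ℕ) (i : Fin n) (ω : Ω) : ℝ :=
  M.eps n (M.smp n i) ω - M.lam (M.U n (M.smp n i) ω) (M.V n (M.smp n i) ω)

lemma UV_mem (n : ℕ) (i : Fin (M.N n)) (ω : Ω) :
    (M.U n i ω, M.V n i ω) ∈ Set.Icc (0 : ℝ) 1 ×ˢ Set.Icc (0 : ℝ) 1 :=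
  ⟨Set.Ioo_subset_Icc_self (M.U_mem n i ω), Set.Ioo_subset_Icc_self (M.V_mem n i ω)⟩

variable {M}

lemma measurable_lam_UV (hlam : ContinuousOn (Function.uncurry M.lam)
    (Set.Icc (0 : ℝ) 1 ×ˢ Set.Icc (0 : ℝ) 1)) {n : ℕ} {i : Fin (M.N n)}
    (hU : Measurable[𝒢] (M.U n i)) (hV : Measurable[𝒢] (M.V n i)) :
    Measurable[𝒢] fun ω => M.lam (M.U n i ω) (M.V n i ω) :=
  hlam.measurable_comp (hU.prodMk hV) (M.UV_mem n i)

lemma exists_lam_bound (hlam : ContinuousOn (Function.uncurry M.lam)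
    (Set.Icc (0 : ℝ) 1 ×ˢ Set.Icc (0 : ℝ) 1)) : ∃ C : ℝ, 0 ≤ C ∧
    ∀ u ∈ Set.Icc (0 : ℝ) 1, ∀ v ∈ Set.Icc (0 : ℝ) 1, |M.lam u v| ≤ C := by
  obtain ⟨C, hC⟩ := (isCompact_Icc.prod isCompact_Icc).exists_bound_of_continuousOn hlam
  refine ⟨|C|, abs_nonneg _, fun u hu v hv => ?_⟩
  exact (hC (u, v) ⟨hu, hv⟩).trans (le_abs_self C)

/-- Conditionally on the treatment data, weighted sums of the errors have variance of the order of
the squared weights. -/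
theorem exists_integral_sq_sum_err_le [IsProbabilityMeasure μ] (hS : M.Standing μ)
    (hE : M.ErrorCondition μ) (hlam : ContinuousOn (Function.uncurry M.lam)
    (Set.Icc (0 : ℝ) 1 ×ˢ Set.Icc (0 : ℝ) 1)) :
    ∃ C : ℝ, 0 ≤ C ∧ ∀ (n : ℕ) (c : Fin n → Ω → ℝ) (b : ℝ),
      (∀ i, Measurable[M.sigmaF n] (c i)) → (∀ ω, ∑ i, c i ω ^ 2 ≤ b) →
      Integrable (fun ω => (∑ i, c i ω * M.err n i ω) ^ 2) μ ∧
        ∫ ω, (∑ i, c i ω * M.err n i ω) ^ 2 ∂μ ≤ C * b := by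
  obtain ⟨CL, hCL0, hCL⟩ := exists_lam_bound hlam
  obtain ⟨C4, hC4⟩ := hE.moment
  -- From (ε − λ)² ≤ 2ε² + 2λ² and 2ε² ≤ 1 + ε⁴: the conditional fourth moment bounds the
  -- conditional variance.
  refine ⟨1 + |C4| + 2 * CL ^ 2, by positivity, fun n c b hc hb => ?_⟩
  have hm := M.sigmaF_le n
  have hlm : ∀ i : Fin n, Measurable[M.sigmaF n]
      fun ω => M.lam (M.U n (M.smp n i) ω) (M.V n (M.smp n i) ω) := fun i =>
    measurable_lam_UV hlam (M.measurable_U_sigmaF n _) (M.measurable_V_sigmaF n _)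
  have hlC : ∀ (i : Fin n) ω, |M.lam (M.U n (M.smp n i) ω) (M.V n (M.smp n i) ω)| ≤ CL :=
    fun i ω => hCL _ (M.UV_mem n _ ω).1 _ (M.UV_mem n _ ω).2
  have heL2 : ∀ i : Fin n, MemLp (M.eps n (M.smp n i)) 2 μ := fun i =>
    (hE.memLp n _).mono_exponent (by norm_num)
  have herr : ∀ i : Fin n, MemLp (M.err n i) 2 μ := fun i =>
    (heL2 i).sub (MemLp.of_bound ((hlm i).mono hm le_rfl).aestronglyMeasurable CL
      (Eventually.of_forall fun ω => by simpa [Real.norm_eq_abs] using hlC i ω))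
  have hcs : ∀ i ω, c i ω ^ 2 ≤ b := fun i ω =>
    (Finset.single_le_sum (f := fun i => c i ω ^ 2) (fun _ _ => sq_nonneg _)
      (Finset.mem_univ i)).trans (hb ω)
  have hcc : ∀ i j ω, |c i ω * c j ω| ≤ b := fun i j ω => by
    rw [abs_le]
    constructor <;>
      nlinarith [hcs i ω, hcs j ω, sq_nonneg (c i ω + c j ω), sq_nonneg (c i ω - c j ω)]
  have hccm : ∀ i j, StronglyMeasurable[M.sigmaF n] fun ω => c i ω * c j ω := fun i j =>
    ((hc i).mul (hc j)).stronglyMeasurable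
  have hint : ∀ i j, Integrable (fun ω => c i ω * c j ω * (M.err n i ω * M.err n j ω)) μ :=
    fun i j => ((herr i).integrable_mul (herr j)).bdd_mul ((hccm i j).mono hm).aestronglyMeasurable
      (Eventually.of_forall fun ω => by simpa [Real.norm_eq_abs] using hcc i j ω)
  have hexp : ∀ ω, (∑ i, c i ω * M.err n i ω) ^ 2 =
      ∑ i, ∑ j, c i ω * c j ω * (M.err n i ω * M.err n j ω) := by
    intro ω
    rw [sq, Finset.sum_mul_sum]
    exact Finset.sum_congr rfl fun i _ => Finset.sum_congr rfl fun j _ => by ring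
  have hc2i : ∀ i, Integrable (fun ω => c i ω ^ 2) μ := fun i =>
    Integrable.of_bound (((hc i).pow_const 2).mono hm le_rfl).aestronglyMeasurable b
      (Eventually.of_forall fun ω => by
        simpa [Real.norm_eq_abs, abs_of_nonneg (sq_nonneg (c i ω))] using hcs i ω)
  -- Given F_N the errors are uncorrelated, and E[ε_i | F_N] = E[ε_i | U_i, V_i] = λ(U_i, V_i)
  -- identifies the centring. The weights are F_N-measurable and bounded, so the cross terms vanish.
  have hoff : ∀ i j, i ≠ j → ∫ ω, c i ω * c j ω * (M.err n i ω * M.err n j ω) ∂μ = 0 :=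
    fun i j hij => (hE.condIndep n _ _ fun h => hij (M.smp_injective n h)).integral_mul_centered_eq_zero
      hm (heL2 i) (heL2 j) (M.measurable_eps n _) (M.measurable_eps n _)
      (hlm i).stronglyMeasurable (hlm j).stronglyMeasurable (hlC i) (hlC j)
      ((hE.condMean n _).trans (hS.control n i)) (hccm i j) (hcc i j)
  have h4 : ∀ i : Fin n, Integrable (fun ω => M.eps n (M.smp n i) ω ^ 4) μ := fun i => by
    have := (hE.memLp n (M.smp n i)).integrable_norm_pow (by norm_num)
    simpa only [ENNReal.toReal_ofNat, Real.norm_eq_abs, Nat.cast_ofNat,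
      Even.pow_abs (show Even 4 by decide)] using this
  have hc4 : ∀ i : Fin n, Integrable (fun ω => c i ω ^ 2 * M.eps n (M.smp n i) ω ^ 4) μ :=
    fun i => (h4 i).bdd_mul (((hc i).pow_const 2).mono hm le_rfl).aestronglyMeasurable
      (Eventually.of_forall fun ω => by
        simpa [Real.norm_eq_abs, abs_of_nonneg (sq_nonneg (c i ω))] using hcs i ω)
  have hdiag : ∀ i, ∫ ω, c i ω * c i ω * (M.err n i ω * M.err n i ω) ∂μ ≤
      (1 + |C4| + 2 * CL ^ 2) * ∫ ω, c i ω ^ 2 ∂μ := by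
    intro i
    have hp : ∫ ω, c i ω ^ 2 * M.eps n (M.smp n i) ω ^ 4 ∂μ ≤ |C4| * ∫ ω, c i ω ^ 2 ∂μ := by
      rw [integral_mul_eq_integral_mul_condExp hm ((hc i).pow_const 2).stronglyMeasurable (h4 i)
        (hc4 i) (EventuallyEq.refl _ _), ← integral_const_mul]
      refine integral_mono_ae ?_ ((hc2i i).const_mul _) ?_
      · exact integrable_condExp.bdd_mul (((hc i).pow_const 2).mono hm le_rfl).aestronglyMeasurable
          (Eventually.of_forall fun ω => by
            simpa [Real.norm_eq_abs, abs_of_nonneg (sq_nonneg (c i ω))] using hcs i ω)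
      · filter_upwards [hC4 n (M.smp n i)] with ω hω
        rw [mul_comm]
        exact mul_le_mul_of_nonneg_right (hω.trans (le_abs_self _)) (sq_nonneg _)
    calc _ ≤ ∫ ω, ((1 + 2 * CL ^ 2) * c i ω ^ 2 + c i ω ^ 2 * M.eps n (M.smp n i) ω ^ 4) ∂μ := by
          refine integral_mono (hint i i) (((hc2i i).const_mul _).add (hc4 i)) fun ω => ?_
          have hl2 := sq_le_sq' (abs_le.1 (hlC i ω)).1 (abs_le.1 (hlC i ω)).2
          have he : M.err n i ω * M.err n i ω ≤
              (1 + 2 * CL ^ 2) + M.eps n (M.smp n i) ω ^ 4 := by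
            rw [err]
            nlinarith [sq_nonneg (M.eps n (M.smp n i) ω +
              M.lam (M.U n (M.smp n i) ω) (M.V n (M.smp n i) ω)),
              sq_nonneg (M.eps n (M.smp n i) ω ^ 2 - 1)]
          have := mul_le_mul_of_nonneg_left he (sq_nonneg (c i ω))
          simp only
          nlinarith
      _ = (1 + 2 * CL ^ 2) * ∫ ω, c i ω ^ 2 ∂μ +
          ∫ ω, c i ω ^ 2 * M.eps n (M.smp n i) ω ^ 4 ∂μ := by
          rw [integral_add ((hc2i i).const_mul _) (hc4 i), integral_const_mul]
      _ ≤ _ := by linarith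
  simp_rw [hexp]
  refine ⟨integrable_finsetSum _ fun i _ => integrable_finsetSum _ fun j _ => hint i j, ?_⟩
  rw [integral_finsetSum _ fun i _ => integrable_finsetSum _ fun j _ => hint i j]
  calc _ = ∑ i, ∫ ω, c i ω * c i ω * (M.err n i ω * M.err n i ω) ∂μ := by
        refine Finset.sum_congr rfl fun i _ => ?_
        rw [integral_finsetSum _ fun j _ => hint i j]
        exact Finset.sum_eq_single i (fun j _ hj => hoff i j hj.symm) (by simp)
    _ ≤ ∑ i, (1 + |C4| + 2 * CL ^ 2) * ∫ ω, c i ω ^ 2 ∂μ := Finset.sum_le_sum fun i _ => hdiag i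
    _ = (1 + |C4| + 2 * CL ^ 2) * ∫ ω, ∑ i, c i ω ^ 2 ∂μ := by
        rw [← Finset.mul_sum, integral_finsetSum _ fun i _ => hc2i i]
    _ ≤ _ := by
        refine mul_le_mul_of_nonneg_left ?_ (by positivity)
        calc _ ≤ ∫ _, b ∂μ := integral_mono (integrable_finsetSum _ fun i _ => hc2i i)
              (integrable_const b) hb
          _ = b := by simp

end SpilloverModel

/-- Averages of bounded local functions of the field concentrate around their means. -/
theorem SpilloverModel.exists_integral_sq_mean_le {Ω : Type*} [MeasurableSpace Ω] {d dx dz : ℕ}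
    {M : SpilloverModel Ω d dx dz} {μ : Measure Ω} [IsProbabilityMeasure μ] {Δ : ℕ}
    (hD : M.SpatialDomain Δ) (hW : M.WeakDependence μ Δ) :
    ∃ C : ℝ, 0 ≤ C ∧ ∀ (n : ℕ) (f : Fin n → Ω → ℝ) (b : ℝ),
      (∀ i, Measurable[M.sigmaNbhd n (M.smp n i)] (f i)) →
      (∀ i, ∀ᵐ ω ∂μ, |f i ω| ≤ b) →
      Integrable (fun ω => ((n : ℝ)⁻¹ * ∑ i, f i ω - (n : ℝ)⁻¹ * ∑ i, ∫ ω', f i ω' ∂μ) ^ 2) μ ∧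
      ∫ ω, ((n : ℝ)⁻¹ * ∑ i, f i ω - (n : ℝ)⁻¹ * ∑ i, ∫ ω', f i ω' ∂μ) ^ 2 ∂μ ≤
        C * b ^ 2 / n := by
  obtain ⟨C, hC0, hC⟩ := exists_integral_sq_sum_le hD hW
  refine ⟨C, hC0, fun n f b hf hb => ?_⟩
  have h := hC n f b (fun i => (hf i).stronglyMeasurable) hb
  have hL : MemLp (fun ω => ∑ i, (f i ω - ∫ ω', f i ω' ∂μ)) 2 μ :=
    memLp_finsetSum _ fun i _ => (MemLp.of_bound
      ((hf i).mono (M.sigmaNbhd_le n _) le_rfl).aestronglyMeasurable b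
      (by simpa [Real.norm_eq_abs] using hb i)).sub (memLp_const _)
  have e : ∀ ω, ((n : ℝ)⁻¹ * ∑ i, f i ω - (n : ℝ)⁻¹ * ∑ i, ∫ ω', f i ω' ∂μ) ^ 2 =
      ((n : ℝ)⁻¹) ^ 2 * (∑ i, (f i ω - ∫ ω', f i ω' ∂μ)) ^ 2 := by
    intro ω
    rw [Finset.sum_sub_distrib]; ring
  simp_rw [e]
  refine ⟨hL.integrable_sq.const_mul _, ?_⟩
  rw [integral_const_mul]
  refine (mul_le_mul_of_nonneg_left h (by positivity)).trans (le_of_eq ?_)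
  rcases eq_or_ne (n : ℝ) 0 with h0 | h0
  · simp [h0]
  · field_simp

lemma Comparable.exists_le_mul {a b : ℕ → ℝ} (h : Comparable a b) (hb : ∀ n, 0 < b n) :
    ∃ C : ℝ, 0 < C ∧ ∀ᶠ n in atTop, a n ≤ C * b n := by
  obtain ⟨c₁, c₂, h1, h2⟩ := h
  refine ⟨max c₂ 1, by positivity, ?_⟩
  filter_upwards [h2] with n hn
  refine ((div_le_iff₀ (hb n)).1 hn.2).trans ?_
  exact mul_le_mul_of_nonneg_right (le_max_left _ _) (hb n).le

/-! ### Size and measurability of the series regressors. -/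

namespace SeriesBasis

variable {Ω : Type*} [MeasurableSpace Ω] {d dx dz : ℕ} {B : SeriesBasis}
  {M : SpilloverModel Ω d dx dz} {μ : Measure Ω}

lemma one_le_KTS (n : ℕ) : 1 ≤ B.KTS n := by
  have h1 : (1 : ℝ) ≤ B.KT n := by exact_mod_cast B.KT_pos n
  have h2 : (1 : ℝ) ≤ B.KS n := by exact_mod_cast B.KS_pos n
  exact one_le_mul_of_one_le_of_one_le h1 h2

lemma one_le_KUV (n : ℕ) : 1 ≤ B.KUV n := by
  have h1 : (1 : ℝ) ≤ B.KU n := by exact_mod_cast B.KU_pos n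
  have h2 : (1 : ℝ) ≤ B.KV n := by exact_mod_cast B.KV_pos n
  exact one_le_mul_of_one_le_of_one_le h1 h2

lemma card_IdxTS (n : ℕ) : (Fintype.card (B.IdxTS n) : ℝ) = B.KTS n := by
  simp [IdxTS, KTS]

lemma card_IdxUV (n : ℕ) : (Fintype.card (B.IdxUV n) : ℝ) = B.KUV n := by
  simp [IdxUV, KUV]

lemma card_IdxB (n : ℕ) : (Fintype.card (B.IdxB dx n) : ℝ) = dx * B.KTS n := by
  simp [IdxB, KTS]

lemma card_IdxG (n : ℕ) : (Fintype.card (B.IdxG n) : ℝ) = B.KTS n * B.KUV n := by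
  simp [IdxG, KTS, KUV]

lemma card_Idx_le (n : ℕ) : (Fintype.card (B.Idx dx n) : ℝ) ≤ (dx + 1) * (B.KTS n * B.KUV n) := by
  rw [Fintype.card_sum, Nat.cast_add, card_IdxB, card_IdxG]
  have h1 := one_le_KTS (B := B) n
  have h2 := one_le_KUV (B := B) n
  have h3 : B.KTS n ≤ B.KTS n * B.KUV n := le_mul_of_one_le_right (by linarith) h2
  have h4 : (dx : ℝ) * B.KTS n ≤ dx * (B.KTS n * B.KUV n) :=
    mul_le_mul_of_nonneg_left h3 (by positivity)
  linarith

lemma Bounded.exists_PTS_bound {TT SS : Set ℝ} (h : B.Bounded TT SS) :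
    ∃ C : ℝ, 0 ≤ C ∧ ∀ n, ∀ t ∈ TT, ∀ s ∈ SS, ∀ k, |B.PTS n t s k| ≤ C := by
  obtain ⟨C₁, h1⟩ := h.bT
  obtain ⟨C₂, h2⟩ := h.bS
  refine ⟨|C₁| * |C₂|, by positivity, fun n t ht s hs k => ?_⟩
  rw [PTS, abs_mul]
  exact mul_le_mul ((h1 n _ t ht).trans (le_abs_self _)) ((h2 n _ s hs).trans (le_abs_self _))
    (abs_nonneg _) (abs_nonneg _)

lemma Bounded.exists_PUV_bound {TT SS : Set ℝ} (h : B.Bounded TT SS) :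
    ∃ C : ℝ, 0 ≤ C ∧ (∀ n, ∀ u ∈ Set.Icc (0 : ℝ) 1, ∀ k, |B.pU n k u| ≤ C) ∧
      (∀ n, ∀ u ∈ Set.Icc (0 : ℝ) 1, ∀ k, |B.pV n k u| ≤ C) ∧
      ∀ n, ∀ u ∈ Set.Icc (0 : ℝ) 1, ∀ v ∈ Set.Icc (0 : ℝ) 1, ∀ k, |B.PUV n u v k| ≤ C ^ 2 := by
  obtain ⟨C₁, h1⟩ := h.bU
  obtain ⟨C₂, h2⟩ := h.bV
  have h1' : ∀ n, ∀ u ∈ Set.Icc (0 : ℝ) 1, ∀ k, |B.pU n k u| ≤ |C₁| + |C₂| := fun n u hu k =>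
    (h1 n k u hu).trans (by linarith [le_abs_self C₁, abs_nonneg C₂])
  have h2' : ∀ n, ∀ u ∈ Set.Icc (0 : ℝ) 1, ∀ k, |B.pV n k u| ≤ |C₁| + |C₂| := fun n u hu k =>
    (h2 n k u hu).trans (by linarith [le_abs_self C₂, abs_nonneg C₁])
  refine ⟨|C₁| + |C₂|, by positivity, h1', h2', fun n u hu v hv k => ?_⟩
  rw [PUV, abs_mul, sq]
  exact mul_le_mul (h1' n u hu _) (h2' n v hv _) (abs_nonneg _) (by positivity)

section Measurability

variable {ζU ζV : ℕ → ℝ}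

lemma Smooth.measurable_PUV {α : Type*} {_ : MeasurableSpace α} (h : B.Smooth ζU ζV) {n : ℕ}
    {u v : α → ℝ} (hu : Measurable u) (hv : Measurable v) (hu' : ∀ ω, u ω ∈ Set.Icc (0 : ℝ) 1)
    (hv' : ∀ ω, v ω ∈ Set.Icc (0 : ℝ) 1) (k : B.IdxUV n) :
    Measurable fun ω => B.PUV n (u ω) (v ω) k :=
  ((h.diffU n k.1).continuousOn.measurable_comp hu hu').mul
    ((h.diffV n k.2).continuousOn.measurable_comp hv hv')

lemma measurable_PTS {α : Type*} {_ : MeasurableSpace α} {n : ℕ} {t s : α → ℝ}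
    (ht : Measurable t) (hs : Measurable s) (k : B.IdxTS n) : Measurable fun ω => B.PTS n (t ω) (s ω) k :=
  ((B.measurable_pT n k.1).comp ht).mul ((B.measurable_pS n k.2).comp hs)

lemma Smooth.measurable_PUV_sigmaNbhd (h : B.Smooth ζU ζV) (n : ℕ) (i : Fin (M.N n))
    (k : B.IdxUV n) : Measurable[M.sigmaNbhd n i] fun ω => B.PUV n (M.U n i ω) (M.V n i ω) k :=
  h.measurable_PUV (M.measurable_U_sigmaNbhd (M.self_mem_nbhd n i)) (M.measurable_V_sigmaNbhd n i)
    (fun ω => (M.UV_mem n i ω).1) (fun ω => (M.UV_mem n i ω).2) k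

lemma measurable_coord {α : Type*} {_ : MeasurableSpace α} {f : α → EuclideanSpace ℝ (Fin dx)}
    (hf : Measurable f) (l : Fin dx) : Measurable fun ω => f ω l :=
  (EuclideanSpace.proj (𝕜 := ℝ) l).continuous.measurable.comp hf

/-- The infeasible row of an agent depends only on the field over its closed reference group, since
the centring is a constant. This locality is what makes the mixing bound applicable to the
infeasible Gram matrix. -/
lemma Smooth.measurable_Pi (h : B.Smooth ζU ζV) (n : ℕ) (i : Fin n) (k : B.Idx dx n) :
    Measurable[M.sigmaNbhd n (M.smp n i)] fun ω => B.Pi M μ n ω i k := by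
  have hP : ∀ k : B.IdxTS n, Measurable[M.sigmaNbhd n (M.smp n i)] fun ω =>
      B.PTS n (M.T n (M.smp n i) ω) (M.S n (M.smp n i) ω) k := fun k =>
    measurable_PTS (M.measurable_T_sigmaNbhd (M.self_mem_nbhd n _)) (M.measurable_S_sigmaNbhd n _) k
  rcases k with k | k
  · exact (measurable_coord (M.measurable_X_sigmaNbhd (M.self_mem_nbhd n _)) k.1).mul (hP k.2)
  · exact (hP k.1).mul ((h.measurable_PUV_sigmaNbhd n _ k.2).sub measurable_const)

/-- The estimated controls and the empirical centring may involve every agent, so locality is lost.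
Measurability with respect to F_N is what conditioning on the treatment data needs. -/
lemma Smooth.measurable_PiHat (h : B.Smooth ζU ζV) (H : ControlEstimator M) (n : ℕ) (i : Fin n)
    (k : B.Idx dx n) : Measurable[M.sigmaF n] fun ω => B.PiHat H n ω i k := by
  have hP : ∀ k : B.IdxTS n, Measurable[M.sigmaF n] fun ω =>
      B.PTS n (M.T n (M.smp n i) ω) (M.S n (M.smp n i) ω) k := fun k =>
    measurable_PTS (M.measurable_T_sigmaF n _) (M.measurable_S_sigmaF n _) k
  have hQ : ∀ (j : Fin (M.N n)) (k : B.IdxUV n), Measurable[M.sigmaF n] fun ω =>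
      B.PUV n (H.Uhat n j ω) (H.Vhat n j ω) k := fun j k =>
    h.measurable_PUV (H.measurable_Uhat n j) (H.measurable_Vhat n j) (H.Uhat_mem n j)
      (H.Vhat_mem n j) k
  rcases k with k | k
  · exact (measurable_coord (M.measurable_X_sigmaF n _) k.1).mul (hP k.2)
  · exact (hP k.1).mul ((hQ _ k.2).sub
      ((Finset.measurable_sum _ fun j _ => hQ (M.smp n j) k.2).const_mul _))

end Measurability

lemma abs_meanPUV_le [IsProbabilityMeasure μ] {C : ℝ} (hC : ∀ n, ∀ u ∈ Set.Icc (0 : ℝ) 1,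
    ∀ v ∈ Set.Icc (0 : ℝ) 1, ∀ k, |B.PUV n u v k| ≤ C) (n : ℕ) (k : B.IdxUV n) :
    |B.meanPUV M μ n k| ≤ |C| := by
  have h1 : ∀ i : Fin n,
      |∫ ω, B.PUV n (M.U n (M.smp n i) ω) (M.V n (M.smp n i) ω) k ∂μ| ≤ |C| := by
    intro i
    have := norm_integral_le_of_norm_le_const (μ := μ) (C := |C|)
      (f := fun ω => B.PUV n (M.U n (M.smp n i) ω) (M.V n (M.smp n i) ω) k)
      (Eventually.of_forall fun ω => by
        rw [Real.norm_eq_abs]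
        exact (hC n _ (M.UV_mem n _ ω).1 _ (M.UV_mem n _ ω).2 k).trans (le_abs_self _))
    simpa using this
  rw [meanPUV, abs_mul, abs_of_nonneg (by positivity : (0 : ℝ) ≤ (n : ℝ)⁻¹)]
  calc _ ≤ (n : ℝ)⁻¹ * ∑ _i : Fin n, |C| := by
        gcongr
        exact (Finset.abs_sum_le_sum_abs _ _).trans (Finset.sum_le_sum fun i _ => h1 i)
    _ = (n : ℝ)⁻¹ * n * |C| := by simp [mul_assoc]
    _ ≤ 1 * |C| := mul_le_mul_of_nonneg_right inv_mul_le_one (abs_nonneg _)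
    _ = |C| := one_mul _

/-- The range conditions on the sample and the bound on the covariates. -/
def SampleRange (M : SpilloverModel Ω d dx dz) (CX : ℝ) (n : ℕ) (ω : Ω) : Prop :=
  ∀ i : Fin n, M.T n (M.smp n i) ω ∈ M.suppT ∧ M.S n (M.smp n i) ω ∈ M.suppS ∧
    ‖M.X n (M.smp n i) ω‖ ≤ CX

lemma exists_ae_sampleRange {Δ : ℕ} (hS : M.Standing μ) (hW : M.WeakDependence μ Δ) :
    ∃ CX : ℝ, 0 ≤ CX ∧ ∀ n, ∀ᵐ ω ∂μ, SampleRange M CX n ω := by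
  obtain ⟨CX, hCX⟩ := hW.X_bounded
  refine ⟨|CX|, abs_nonneg _, fun n => ae_all_iff.2 fun i => ?_⟩
  filter_upwards [hS.T_mem n (M.smp n i), hS.S_mem n i, hCX n (M.smp n i)] with ω h1 h2 h3
  exact ⟨h1, h2, h3.trans (le_abs_self _)⟩

lemma exists_Pi_bound [IsProbabilityMeasure μ] {Δ : ℕ} (hS : M.Standing μ)
    (hW : M.WeakDependence μ Δ) (hB : B.Bounded M.suppT M.suppS) :
    ∃ C : ℝ, 0 ≤ C ∧ ∀ n (i : Fin n) k, ∀ᵐ ω ∂μ, |B.Pi M μ n ω i k| ≤ C := by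
  obtain ⟨CX, hCX0, hCX⟩ := exists_ae_sampleRange hS hW
  obtain ⟨CP, hCP0, hCP⟩ := hB.exists_PTS_bound
  obtain ⟨CU, hCU0, -, -, hCU⟩ := hB.exists_PUV_bound
  refine ⟨CX * CP + CP * (2 * CU ^ 2), by positivity, fun n i k => ?_⟩
  filter_upwards [hCX n] with ω hω
  obtain ⟨hT, hSS, hX⟩ := hω i
  have h1 : ∀ k, |B.PTS n (M.T n (M.smp n i) ω) (M.S n (M.smp n i) ω) k| ≤ CP :=
    hCP n _ hT _ hSS
  rcases k with k | k
  · have h2 : |M.X n (M.smp n i) ω k.1| ≤ CX := (PiLp.norm_apply_le _ k.1).trans hX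
    have h3 : |B.Pi M μ n ω i (Sum.inl k)| ≤ CX * CP := by
      simp only [Pi, Matrix.of_apply, Sum.elim_inl, abs_mul]
      exact mul_le_mul h2 (h1 _) (abs_nonneg _) hCX0
    have : 0 ≤ CP * (2 * CU ^ 2) := by positivity
    linarith
  · have h2 : |B.PUVbar M μ n (M.U n (M.smp n i) ω) (M.V n (M.smp n i) ω) k.2| ≤ 2 * CU ^ 2 := by
      rw [PUVbar]
      have h4 := hCU n _ (M.UV_mem n (M.smp n i) ω).1 _ (M.UV_mem n (M.smp n i) ω).2 k.2
      have h5 := abs_meanPUV_le (M := M) (μ := μ) hCU n k.2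
      rw [abs_of_nonneg (by positivity : 0 ≤ CU ^ 2)] at h5
      exact (abs_sub _ _).trans (by linarith)
    have h3 : |B.Pi M μ n ω i (Sum.inr k)| ≤ CP * (2 * CU ^ 2) := by
      simp only [Pi, Matrix.of_apply, Sum.elim_inr, abs_mul]
      exact mul_le_mul (h1 _) h2 (abs_nonneg _) hCP0
    have : 0 ≤ CX * CP := by positivity
    linarith

lemma Growth.exists_bounds {κ ζU ζV : ℕ → ℝ} {ν : ℝ} (h : B.Growth κ ζU ζV ν) :
    ∃ C : ℝ, 0 < C ∧ ∀ᶠ n in atTop, B.KTS n ≤ C * κ n ∧ B.KUV n ≤ C * κ n ∧ 1 ≤ C * κ n := by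
  obtain ⟨C₁, hC₁, h1⟩ := h.compTS.exists_le_mul h.κ_pos
  obtain ⟨C₂, hC₂, h2⟩ := h.compUV.exists_le_mul h.κ_pos
  refine ⟨C₁ + C₂, by positivity, ?_⟩
  filter_upwards [h1, h2] with n h1 h2
  have h3 := mul_pos hC₁ (h.κ_pos n)
  have h4 := mul_pos hC₂ (h.κ_pos n)
  have h5 := one_le_KTS (B := B) n
  rw [add_mul]
  exact ⟨by linarith, by linarith, by linarith⟩

lemma Growth.tendsto_sq_div_sqrt {κ ζU ζV : ℕ → ℝ} {ν : ℝ} (h : B.Growth κ ζU ζV ν) :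
    Tendsto (fun n : ℕ => κ n ^ 2 / √(n : ℝ)) atTop (𝓝 0) := by
  have h1 := (Real.continuous_sqrt.tendsto 0).comp h.lim₁
  rw [Real.sqrt_zero] at h1
  refine h1.congr fun n => ?_
  simp only [Function.comp_apply]
  rw [Real.sqrt_div (by positivity), show κ n ^ 4 = (κ n ^ 2) ^ 2 by ring,
    Real.sqrt_sq (by positivity)]

/-- Basis dimensions are at least one, so κ is eventually bounded away from zero and κ is at most a
constant times κ². -/
lemma Growth.tendsto_div_sqrt {κ ζU ζV : ℕ → ℝ} {ν : ℝ} (h : B.Growth κ ζU ζV ν) :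
    Tendsto (fun n : ℕ => κ n / √(n : ℝ)) atTop (𝓝 0) := by
  obtain ⟨C, hC, h1⟩ := h.exists_bounds
  have h2 := h.tendsto_sq_div_sqrt.const_mul C
  rw [mul_zero] at h2
  refine tendsto_of_tendsto_of_tendsto_of_le_of_le' tendsto_const_nhds h2 ?_ ?_
  · exact Eventually.of_forall fun n => div_nonneg (h.κ_pos n).le (Real.sqrt_nonneg _)
  · filter_upwards [h1] with n hn
    rw [← mul_div_assoc]
    refine div_le_div_of_nonneg_right ?_ (Real.sqrt_nonneg _)
    nlinarith [h.κ_pos n, hn.2.2]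

/-! ### Concentration of the empirical basis means and of the infeasible Gram matrix. -/

/-- Squared norm of the error in the empirical mean of `P_UV(U_i, V_i)`. -/
def meanErr (B : SeriesBasis) (M : SpilloverModel Ω d dx dz) (μ : Measure Ω) (n : ℕ) (ω : Ω) : ℝ :=
  ∑ k, ((n : ℝ)⁻¹ * ∑ i : Fin n, B.PUV n (M.U n (M.smp n i) ω) (M.V n (M.smp n i) ω) k -
    B.meanPUV M μ n k) ^ 2

lemma meanErr_nonneg (n : ℕ) (ω : Ω) : 0 ≤ B.meanErr M μ n ω :=
  Finset.sum_nonneg fun _ _ => sq_nonneg _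

/-- There are O(κ) coordinates, each an average of bounded local variables with variance O(1/n). -/
theorem isBigOP_sqrt_meanErr [IsProbabilityMeasure μ] {Δ : ℕ} {κ ζU ζV : ℕ → ℝ} {ν : ℝ}
    (hD : M.SpatialDomain Δ) (hW : M.WeakDependence μ Δ) (hB : B.Bounded M.suppT M.suppS)
    (hSm : B.Smooth ζU ζV) (hG : B.Growth κ ζU ζV ν) :
    IsBigOP μ (fun n ω => √(B.meanErr M μ n ω)) (fun n => √(κ n / n)) := by
  obtain ⟨C, hC0, hC⟩ := SpilloverModel.exists_integral_sq_mean_le hD hW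
  obtain ⟨CU, hCU0, -, -, hCU⟩ := hB.exists_PUV_bound
  obtain ⟨Cκ, hCκ0, hCκ⟩ := hG.exists_bounds
  have key := fun n k => hC n (fun i ω => B.PUV n (M.U n (M.smp n i) ω) (M.V n (M.smp n i) ω) k)
    (CU ^ 2) (fun i => hSm.measurable_PUV_sigmaNbhd n _ k)
    (fun i => Eventually.of_forall fun ω => hCU n _ (M.UV_mem n _ ω).1 _ (M.UV_mem n _ ω).2 k)
  have hsq : ∀ n ω, √(B.meanErr M μ n ω) ^ 2 = B.meanErr M μ n ω := fun n ω =>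
    Real.sq_sqrt (meanErr_nonneg n ω)
  refine IsBigOP.of_integral_sq_le (C := C * (CU ^ 2) ^ 2 * Cκ) (fun n => ?_) ?_ ?_
  · simp_rw [hsq]
    exact integrable_finsetSum _ fun k _ => (key n k).1
  · filter_upwards [eventually_gt_atTop 0] with n hn
    have : (0 : ℝ) < n := by exact_mod_cast hn
    exact Real.sqrt_pos.2 (div_pos (hG.κ_pos n) this)
  · filter_upwards [hCκ] with n hn
    simp_rw [hsq]
    rw [Real.sq_sqrt (div_nonneg (hG.κ_pos n).le (by positivity))]
    simp_rw [meanErr, meanPUV]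
    rw [integral_finsetSum _ fun k _ => (key n k).1]
    calc _ ≤ ∑ _k : B.IdxUV n, C * (CU ^ 2) ^ 2 / n := Finset.sum_le_sum fun k _ => (key n k).2
      _ = C * (CU ^ 2) ^ 2 * B.KUV n / n := by
          rw [Finset.sum_const, Finset.card_univ, nsmul_eq_mul, card_IdxUV]; ring
      _ ≤ C * (CU ^ 2) ^ 2 * (Cκ * κ n) / n := by
          gcongr
          exact hn.2.1
      _ = _ := by ring

/-- Squared Frobenius distance of the infeasible Gram matrix from its mean. -/
def gramErr (B : SeriesBasis) (M : SpilloverModel Ω d dx dz) (μ : Measure Ω) (n : ℕ) (ω : Ω) : ℝ :=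
  ∑ k, ∑ l, (((n : ℝ)⁻¹ • ((B.Pi M μ n ω).transpose * B.Pi M μ n ω)) k l - B.gram M μ n k l) ^ 2

lemma gramErr_nonneg (n : ℕ) (ω : Ω) : 0 ≤ B.gramErr M μ n ω :=
  Finset.sum_nonneg fun _ _ => Finset.sum_nonneg fun _ _ => sq_nonneg _

/-- The dimension is O(κ²), so there are O(κ⁴) entries, each an average of bounded local products
with variance O(1/n). Hence the requirement κ⁴/n → 0. -/
theorem isBigOP_sqrt_gramErr [IsProbabilityMeasure μ] {Δ : ℕ} {κ ζU ζV : ℕ → ℝ} {ν : ℝ}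
    (hS : M.Standing μ) (hD : M.SpatialDomain Δ) (hW : M.WeakDependence μ Δ)
    (hB : B.Bounded M.suppT M.suppS) (hSm : B.Smooth ζU ζV) (hG : B.Growth κ ζU ζV ν) :
    IsBigOP μ (fun n ω => √(B.gramErr M μ n ω)) (fun n => κ n ^ 2 / √(n : ℝ)) := by
  obtain ⟨C, hC0, hC⟩ := SpilloverModel.exists_integral_sq_mean_le hD hW
  obtain ⟨CP, hCP0, hCP⟩ := exists_Pi_bound hS hW hB
  obtain ⟨Cκ, hCκ0, hCκ⟩ := hG.exists_bounds
  have hmeas : ∀ n (i : Fin n) k l, Measurable[M.sigmaNbhd n (M.smp n i)] fun ω =>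
      B.Pi M μ n ω i k * B.Pi M μ n ω i l := fun n i k l =>
    (hSm.measurable_Pi n i k).mul (hSm.measurable_Pi n i l)
  have hbd : ∀ n (i : Fin n) k l, ∀ᵐ ω ∂μ, |B.Pi M μ n ω i k * B.Pi M μ n ω i l| ≤ CP ^ 2 := by
    intro n i k l
    filter_upwards [hCP n i k, hCP n i l] with ω h1 h2
    rw [abs_mul, sq]
    exact mul_le_mul h1 h2 (abs_nonneg _) hCP0
  have key := fun n k l => hC n (fun i ω => B.Pi M μ n ω i k * B.Pi M μ n ω i l)
    (CP ^ 2) (fun i => hmeas n i k l) (fun i => hbd n i k l)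
  have hint : ∀ n (i : Fin n) k l, Integrable (fun ω => B.Pi M μ n ω i k * B.Pi M μ n ω i l) μ :=
    fun n i k l => Integrable.of_bound
      ((hmeas n i k l).mono (M.sigmaNbhd_le n _) le_rfl).aestronglyMeasurable (CP ^ 2)
      (by simpa only [Real.norm_eq_abs] using hbd n i k l)
  have hgram : ∀ n k l, B.gram M μ n k l =
      (n : ℝ)⁻¹ * ∑ i : Fin n, ∫ ω, B.Pi M μ n ω i k * B.Pi M μ n ω i l ∂μ := by
    intro n k l
    simp only [gram, Matrix.of_apply, Matrix.mul_apply, Matrix.transpose_apply, div_eq_inv_mul]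
    rw [integral_const_mul, integral_finsetSum _ fun i _ => hint n i k l]
  have hent : ∀ (n : ℕ) ω k l, ((n : ℝ)⁻¹ • ((B.Pi M μ n ω).transpose * B.Pi M μ n ω)) k l =
      (n : ℝ)⁻¹ * ∑ i : Fin n, B.Pi M μ n ω i k * B.Pi M μ n ω i l := by
    intro n ω k l
    simp only [Matrix.smul_apply, Matrix.mul_apply, Matrix.transpose_apply, smul_eq_mul]
  have hsq : ∀ n ω, √(B.gramErr M μ n ω) ^ 2 = B.gramErr M μ n ω := fun n ω =>
    Real.sq_sqrt (gramErr_nonneg n ω)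
  have hgi : ∀ (n : ℕ) ω, B.gramErr M μ n ω = ∑ k, ∑ l,
      ((n : ℝ)⁻¹ * ∑ i : Fin n, B.Pi M μ n ω i k * B.Pi M μ n ω i l -
      (n : ℝ)⁻¹ * ∑ i : Fin n, ∫ ω, B.Pi M μ n ω i k * B.Pi M μ n ω i l ∂μ) ^ 2 := by
    intro n ω
    refine Finset.sum_congr rfl fun k _ => Finset.sum_congr rfl fun l _ => ?_
    rw [hent, hgram]
  refine IsBigOP.of_integral_sq_le (C := (dx + 1) ^ 2 * Cκ ^ 4 * (C * (CP ^ 2) ^ 2))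
    (fun n => ?_) ?_ ?_
  · simp_rw [hsq, hgi]
    exact integrable_finsetSum _ fun k _ => integrable_finsetSum _ fun l _ => (key n k l).1
  · filter_upwards [eventually_gt_atTop 0] with n hn
    have : (0 : ℝ) < n := by exact_mod_cast hn
    exact div_pos (pow_pos (hG.κ_pos n) 2) (Real.sqrt_pos.2 this)
  · filter_upwards [hCκ] with n hn
    simp_rw [hsq, hgi]
    rw [integral_finsetSum _ fun k _ => integrable_finsetSum _ fun l _ => (key n k l).1]
    have hcard : (Fintype.card (B.Idx dx n) : ℝ) ≤ (dx + 1) * (Cκ * κ n * (Cκ * κ n)) := by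
      refine (card_Idx_le n).trans (mul_le_mul_of_nonneg_left ?_ (by positivity))
      exact mul_le_mul hn.1 hn.2.1 (zero_le_one.trans (one_le_KUV n)) (by linarith [hn.2.2])
    calc _ ≤ ∑ _k : B.Idx dx n, ∑ _l : B.Idx dx n, C * (CP ^ 2) ^ 2 / n := by
          refine Finset.sum_le_sum fun k _ => ?_
          rw [integral_finsetSum _ fun l _ => (key n k l).1]
          exact Finset.sum_le_sum fun l _ => (key n k l).2
      _ = (Fintype.card (B.Idx dx n) : ℝ) ^ 2 * (C * (CP ^ 2) ^ 2 / n) := by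
          rw [Finset.sum_const, Finset.sum_const, Finset.card_univ, nsmul_eq_mul, nsmul_eq_mul]
          ring
      _ ≤ ((dx + 1) * (Cκ * κ n * (Cκ * κ n))) ^ 2 * (C * (CP ^ 2) ^ 2 / n) := by gcongr
      _ = _ := by
          rw [div_pow, Real.sq_sqrt (by positivity)]; ring

end SeriesBasis

/-! ### Effect of estimated controls on the regressor rows, and the Gram lower bound. -/

/-- A family of differentiable functions whose derivative vector has Euclidean norm at most `ζ` is
`ζ`-Lipschitz in Euclidean norm. -/
lemma sum_sq_sub_le_of_derivWithin {K : Type*} [Fintype K] {p : K → ℝ → ℝ} {ζ : ℝ}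
    (hd : ∀ j, DifferentiableOn ℝ (p j) (Set.Icc 0 1))
    (hζ : ∀ u ∈ Set.Icc (0 : ℝ) 1, √(∑ j, derivWithin (p j) (Set.Icc 0 1) u ^ 2) ≤ ζ)
    {u v : ℝ} (hu : u ∈ Set.Icc (0 : ℝ) 1) (hv : v ∈ Set.Icc (0 : ℝ) 1) :
    ∑ j, (p j u - p j v) ^ 2 ≤ ζ ^ 2 * (u - v) ^ 2 := by
  -- Test the increment vector against itself: x ↦ Σ w_j p_j(x) has derivative at most ‖w‖ζ and
  -- increment ‖w‖², so the scalar mean value inequality gives ‖w‖ ≤ ζ|u − v|.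
  set w : K → ℝ := fun j => p j u - p j v
  set m := √(∑ j, w j ^ 2) with hm
  have hm2 : m ^ 2 = ∑ j, w j ^ 2 := Real.sq_sqrt (Finset.sum_nonneg fun _ _ => sq_nonneg _)
  have hm0 : 0 ≤ m := Real.sqrt_nonneg _
  have hbound : ∀ x ∈ Set.Icc (0 : ℝ) 1,
      ‖∑ j, w j * derivWithin (p j) (Set.Icc 0 1) x‖ ≤ m * ζ := by
    intro x hx
    rw [Real.norm_eq_abs]
    refine (Real.abs_le_sqrt (Finset.sum_mul_sq_le_sq_mul_sq _ _ _)).trans ?_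
    rw [Real.sqrt_mul (Finset.sum_nonneg fun _ _ => sq_nonneg _)]
    exact mul_le_mul_of_nonneg_left (hζ x hx) hm0
  have hmv := (convex_Icc (0 : ℝ) 1).norm_image_sub_le_of_norm_hasDerivWithin_le
    (f := fun x => ∑ j, w j * p j x) (C := m * ζ)
    (fun x hx => HasDerivWithinAt.fun_sum fun j _ =>
      ((hd j x hx).hasDerivWithinAt).const_mul (w j)) hbound hv hu
  have h1 : ∑ j, w j * p j u - ∑ j, w j * p j v = m ^ 2 := by
    rw [hm2, ← Finset.sum_sub_distrib]
    exact Finset.sum_congr rfl fun j _ => by simp only [w]; ring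
  simp only [h1, Real.norm_eq_abs] at hmv
  have h2 : m ^ 2 ≤ m * ζ * |u - v| := (le_abs_self _).trans hmv
  rw [← hm2, ← sq_abs (u - v), ← mul_pow]
  rcases hm0.eq_or_lt with h0 | h0
  · rw [← h0, zero_pow two_ne_zero]; positivity
  · refine pow_le_pow_left₀ hm0 ?_ 2
    refine le_of_mul_le_mul_left ?_ h0
    calc m * m = m ^ 2 := (sq m).symm
      _ ≤ _ := h2
      _ = _ := by ring

namespace SeriesBasis

variable {Ω : Type*} [MeasurableSpace Ω] {d dx dz : ℕ} {B : SeriesBasis}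
  {M : SpilloverModel Ω d dx dz} {μ : Measure Ω}

/-- Change one tensor factor at a time: the increment of P_U costs ζ_U while P_V has norm at most
C√K_V, and symmetrically. This is the origin of ζ_†. -/
lemma Smooth.sum_sq_PUV_sub_le {ζU ζV : ℕ → ℝ} (h : B.Smooth ζU ζV) {C : ℝ} {n : ℕ}
    (hU : ∀ u ∈ Set.Icc (0 : ℝ) 1, ∀ k, |B.pU n k u| ≤ C)
    (hV : ∀ v ∈ Set.Icc (0 : ℝ) 1, ∀ k, |B.pV n k v| ≤ C)
    {u u' v v' : ℝ} (hu : u ∈ Set.Icc (0 : ℝ) 1) (hu' : u' ∈ Set.Icc (0 : ℝ) 1)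
    (hv : v ∈ Set.Icc (0 : ℝ) 1) (hv' : v' ∈ Set.Icc (0 : ℝ) 1) :
    ∑ k, (B.PUV n u v k - B.PUV n u' v' k) ^ 2 ≤
      2 * C ^ 2 * (B.zetaDagger ζU ζV n * (|u - u'| + |v - v'|)) ^ 2 := by
  have h1 := sum_sq_sub_le_of_derivWithin (h.diffU n) (h.boundU n) hu hu'
  have h2 := sum_sq_sub_le_of_derivWithin (h.diffV n) (h.boundV n) hv hv'
  have hζU : 0 ≤ ζU n := (Real.sqrt_nonneg _).trans (h.boundU n u hu)
  have hζV : 0 ≤ ζV n := (Real.sqrt_nonneg _).trans (h.boundV n u hu)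
  have h3 : ∑ b, B.pV n b v ^ 2 ≤ B.KV n * C ^ 2 := by
    calc _ ≤ ∑ _b : Fin (B.KV n), C ^ 2 := Finset.sum_le_sum fun b _ =>
          sq_le_sq' (abs_le.1 (hV v hv b)).1 (abs_le.1 (hV v hv b)).2
      _ = _ := by simp
  have h4 : ∑ a, B.pU n a u' ^ 2 ≤ B.KU n * C ^ 2 := by
    calc _ ≤ ∑ _a : Fin (B.KU n), C ^ 2 := Finset.sum_le_sum fun a _ =>
          sq_le_sq' (abs_le.1 (hU u' hu' a)).1 (abs_le.1 (hU u' hu' a)).2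
      _ = _ := by simp
  calc ∑ k, (B.PUV n u v k - B.PUV n u' v' k) ^ 2
      ≤ ∑ k : B.IdxUV n, (2 * ((B.pU n k.1 u - B.pU n k.1 u') ^ 2 * B.pV n k.2 v ^ 2) +
          2 * (B.pU n k.1 u' ^ 2 * (B.pV n k.2 v - B.pV n k.2 v') ^ 2)) := by
        refine Finset.sum_le_sum fun k _ => ?_
        simp only [PUV]
        nlinarith [sq_nonneg ((B.pU n k.1 u - B.pU n k.1 u') * B.pV n k.2 v -
          B.pU n k.1 u' * (B.pV n k.2 v - B.pV n k.2 v'))]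
    _ = 2 * ((∑ a, (B.pU n a u - B.pU n a u') ^ 2) * ∑ b, B.pV n b v ^ 2) +
        2 * ((∑ a, B.pU n a u' ^ 2) * ∑ b, (B.pV n b v - B.pV n b v') ^ 2) := by
        rw [Finset.sum_add_distrib, ← Finset.mul_sum, ← Finset.mul_sum, Finset.sum_mul_sum,
          Finset.sum_mul_sum, Fintype.sum_prod_type, Fintype.sum_prod_type]
    _ ≤ 2 * ((ζU n ^ 2 * (u - u') ^ 2) * (B.KV n * C ^ 2)) +
        2 * ((B.KU n * C ^ 2) * (ζV n ^ 2 * (v - v') ^ 2)) := by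
        gcongr
    _ = 2 * C ^ 2 * ((ζU n * √(B.KV n) * |u - u'|) ^ 2 + (ζV n * √(B.KU n) * |v - v'|) ^ 2) := by
        simp only [mul_pow, sq_abs, Real.sq_sqrt (Nat.cast_nonneg (B.KV n) : (0 : ℝ) ≤ _),
          Real.sq_sqrt (Nat.cast_nonneg (B.KU n) : (0 : ℝ) ≤ _)]
        ring
    _ ≤ _ := by
        refine mul_le_mul_of_nonneg_left ?_ (by positivity)
        have ha : 0 ≤ ζU n * √(B.KV n) := by positivity
        have hb : 0 ≤ ζV n * √(B.KU n) := by positivity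
        have hx := abs_nonneg (u - u')
        have hy := abs_nonneg (v - v')
        rw [zetaDagger]
        set a := ζU n * √(B.KV n)
        set b := ζV n * √(B.KU n)
        have e : (a + b) * (|u - u'| + |v - v'|) =
          a * |u - u'| + b * |v - v'| + (a * |v - v'| + b * |u - u'|) := by ring
        rw [e]
        have p1 := mul_nonneg ha hx
        have p2 := mul_nonneg hb hy
        have p3 := mul_nonneg ha hy
        have p4 := mul_nonneg hb hx
        nlinarith [mul_nonneg p1 p2, mul_nonneg (add_nonneg p1 p2) (add_nonneg p3 p4)]

/-- The uniform estimation error of the control variables. -/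
def ctrlErr (H : ControlEstimator M) (n : ℕ) (ω : Ω) : ℝ :=
  (⨆ i, |H.Uhat n i ω - M.U n i ω|) + ⨆ i, |H.Vhat n i ω - M.V n i ω|

lemma abs_sub_add_le_ctrlErr (H : ControlEstimator M) (n : ℕ) (i : Fin (M.N n)) (ω : Ω) :
    |H.Uhat n i ω - M.U n i ω| + |H.Vhat n i ω - M.V n i ω| ≤ ctrlErr H n ω :=
  add_le_add (le_ciSup (f := fun i => |H.Uhat n i ω - M.U n i ω|) (Set.finite_range _).bddAbove i)
    (le_ciSup (f := fun i => |H.Vhat n i ω - M.V n i ω|) (Set.finite_range _).bddAbove i)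

lemma ctrlErr_nonneg (H : ControlEstimator M) (n : ℕ) (ω : Ω) : 0 ≤ ctrlErr H n ω :=
  add_nonneg (Real.iSup_nonneg fun _ => abs_nonneg _) (Real.iSup_nonneg fun _ => abs_nonneg _)

lemma isBigOP_ctrlErr {H : ControlEstimator M} {ν : ℝ} (h : H.Rate μ ν) :
    IsBigOP μ (ctrlErr H) fun n => (n : ℝ) ^ (-ν) :=
  h.rateU.add h.rateV

/-- The rows of the feasible and infeasible regressor matrices are close. -/
lemma sum_sq_PiHat_sub_Pi_le {ζU ζV : ℕ → ℝ} (h : B.Smooth ζU ζV) (H : ControlEstimator M)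
    {CP CU CX : ℝ} {n : ℕ} (hn : 0 < n)
    (hCP : ∀ t ∈ M.suppT, ∀ s ∈ M.suppS, ∀ k, |B.PTS n t s k| ≤ CP)
    (hU : ∀ u ∈ Set.Icc (0 : ℝ) 1, ∀ k, |B.pU n k u| ≤ CU)
    (hV : ∀ v ∈ Set.Icc (0 : ℝ) 1, ∀ k, |B.pV n k v| ≤ CU) {ω : Ω} (hω : SampleRange M CX n ω)
    (i : Fin n) :
    ∑ k, (B.PiHat H n ω i k - B.Pi M μ n ω i k) ^ 2 ≤
      B.KTS n * CP ^ 2 * (3 * (4 * CU ^ 2 * (B.zetaDagger ζU ζV n * ctrlErr H n ω) ^ 2 +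
        B.meanErr M μ n ω)) := by
  set A : Fin n → B.IdxUV n → ℝ := fun j k =>
    B.PUV n (H.Uhat n (M.smp n j) ω) (H.Vhat n (M.smp n j) ω) k -
      B.PUV n (M.U n (M.smp n j) ω) (M.V n (M.smp n j) ω) k
  set E : B.IdxUV n → ℝ := fun k =>
    (n : ℝ)⁻¹ * ∑ i : Fin n, B.PUV n (M.U n (M.smp n i) ω) (M.V n (M.smp n i) ω) k -
    B.meanPUV M μ n k
  set L := 2 * CU ^ 2 * (B.zetaDagger ζU ζV n * ctrlErr H n ω) ^ 2 with hL
  have hn' : (n : ℝ) ≠ 0 := by exact_mod_cast hn.ne'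
  have hA : ∀ j, ∑ k, A j k ^ 2 ≤ L := by
    intro j
    refine (h.sum_sq_PUV_sub_le hU hV (H.Uhat_mem n _ ω) (M.UV_mem n _ ω).1 (H.Vhat_mem n _ ω)
      (M.UV_mem n _ ω).2).trans ?_
    refine mul_le_mul_of_nonneg_left ?_ (by positivity)
    rw [mul_pow, mul_pow]
    refine mul_le_mul_of_nonneg_left ?_ (by positivity)
    exact pow_le_pow_left₀ (by positivity) (abs_sub_add_le_ctrlErr H n _ ω) 2
  have hAm : ∑ k, ((n : ℝ)⁻¹ * ∑ j, A j k) ^ 2 ≤ L := by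
    calc _ ≤ ∑ k, (n : ℝ)⁻¹ * ∑ j, A j k ^ 2 := by
          refine Finset.sum_le_sum fun k _ => ?_
          have := sq_sum_le_card_mul_sum_sq (s := Finset.univ) (f := fun j => A j k)
          rw [Finset.card_univ, Fintype.card_fin] at this
          calc ((n : ℝ)⁻¹ * ∑ j, A j k) ^ 2 = ((n : ℝ)⁻¹) ^ 2 * (∑ j, A j k) ^ 2 := by ring
            _ ≤ ((n : ℝ)⁻¹) ^ 2 * (n * ∑ j, A j k ^ 2) := by gcongr
            _ = _ := by field_simp
      _ = (n : ℝ)⁻¹ * ∑ j, ∑ k, A j k ^ 2 := by rw [← Finset.mul_sum, Finset.sum_comm]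
      _ ≤ (n : ℝ)⁻¹ * ∑ _j : Fin n, L := by
          gcongr with j
          exact hA j
      _ = L := by simp [hn']
  -- Three sources of error: the agent's own control estimates, their average effect on the
  -- empirical centring, and the sampling error of the centring at the true controls. By Jensen the
  -- second is bounded like the first.
  have hdiff : ∀ k, B.PUVhat H n ω (H.Uhat n (M.smp n i) ω) (H.Vhat n (M.smp n i) ω) k -
      B.PUVbar M μ n (M.U n (M.smp n i) ω) (M.V n (M.smp n i) ω) k =
      A i k - (n : ℝ)⁻¹ * ∑ j, A j k - E k := by
    intro k
    simp only [PUVhat, PUVbar, A, E, Finset.sum_sub_distrib]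
    ring
  have hsum : ∑ k, (B.PUVhat H n ω (H.Uhat n (M.smp n i) ω) (H.Vhat n (M.smp n i) ω) k -
      B.PUVbar M μ n (M.U n (M.smp n i) ω) (M.V n (M.smp n i) ω) k) ^ 2 ≤
      3 * (2 * L + B.meanErr M μ n ω) := by
    simp_rw [hdiff]
    calc _ ≤ ∑ k, (3 * A i k ^ 2 + 3 * ((n : ℝ)⁻¹ * ∑ j, A j k) ^ 2 + 3 * E k ^ 2) := by
          refine Finset.sum_le_sum fun k _ => ?_
          set x := A i k
          set y := (n : ℝ)⁻¹ * ∑ j, A j k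
          nlinarith [sq_nonneg (x + y), sq_nonneg (x + E k), sq_nonneg (y - E k)]
      _ = 3 * ∑ k, A i k ^ 2 + 3 * ∑ k, ((n : ℝ)⁻¹ * ∑ j, A j k) ^ 2 + 3 * B.meanErr M μ n ω := by
          rw [Finset.sum_add_distrib, Finset.sum_add_distrib, ← Finset.mul_sum, ← Finset.mul_sum,
            ← Finset.mul_sum]
          rfl
      _ ≤ _ := by linarith [hA i]
  have hTS : ∑ k, B.PTS n (M.T n (M.smp n i) ω) (M.S n (M.smp n i) ω) k ^ 2 ≤
      B.KTS n * CP ^ 2 := by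
    calc _ ≤ ∑ _k : B.IdxTS n, CP ^ 2 := Finset.sum_le_sum fun k _ =>
          sq_le_sq' (abs_le.1 (hCP _ (hω i).1 _ (hω i).2.1 k)).1
            (abs_le.1 (hCP _ (hω i).1 _ (hω i).2.1 k)).2
      _ = _ := by rw [Finset.sum_const, Finset.card_univ, nsmul_eq_mul, card_IdxTS]
  rw [Fintype.sum_sum_type]
  have hinl : ∑ k : B.IdxB dx n, (B.PiHat H n ω i (Sum.inl k) -
      B.Pi M μ n ω i (Sum.inl k)) ^ 2 = 0 :=
    Finset.sum_eq_zero fun k _ => by simp [PiHat, Pi]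
  have hinr : ∑ k : B.IdxG n, (B.PiHat H n ω i (Sum.inr k) - B.Pi M μ n ω i (Sum.inr k)) ^ 2 =
      (∑ k, B.PTS n (M.T n (M.smp n i) ω) (M.S n (M.smp n i) ω) k ^ 2) *
      ∑ k, (B.PUVhat H n ω (H.Uhat n (M.smp n i) ω) (H.Vhat n (M.smp n i) ω) k -
      B.PUVbar M μ n (M.U n (M.smp n i) ω) (M.V n (M.smp n i) ω) k) ^ 2 := by
    rw [Finset.sum_mul_sum, Fintype.sum_prod_type]
    refine Finset.sum_congr rfl fun a _ => Finset.sum_congr rfl fun b _ => ?_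
    simp only [PiHat, Pi, Matrix.of_apply, Sum.elim_inr]
    ring
  rw [hinl, hinr, zero_add]
  have hL' : 2 * L = 4 * CU ^ 2 * (B.zetaDagger ζU ζV n * ctrlErr H n ω) ^ 2 := by rw [hL]; ring
  rw [← hL']
  exact mul_le_mul hTS hsum (Finset.sum_nonneg fun _ _ => sq_nonneg _)
    ((Finset.sum_nonneg fun _ _ => sq_nonneg _).trans hTS)

lemma gram_isHermitian (n : ℕ) : (B.gram M μ n).IsHermitian := by
  ext k l
  simp only [Matrix.conjTranspose_apply, star_trivial, gram, Matrix.of_apply, Matrix.mul_apply,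
    Matrix.transpose_apply]
  simp_rw [mul_comm]

/-- The event on which the feasible Gram matrix is bounded below. -/
def GramBelow (B : SeriesBasis) (H : ControlEstimator M) (c : ℝ) (n : ℕ) : Set Ω :=
  {ω | ∀ v, n * c * (v ⬝ᵥ v) ≤ ((B.PiHat H n ω).mulVec v) ⬝ᵥ ((B.PiHat H n ω).mulVec v)}

/-- The population eigenvalue bound c₁ survives two perturbations: the Frobenius error of the
infeasible Gram matrix leaves c₁/2, and the row errors of the feasible one leave a quarter of that.
-/
theorem exists_withHighProb_gramBelow [IsProbabilityMeasure μ] {Δ : ℕ} {κ ζU ζV : ℕ → ℝ} {ν : ℝ}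
    {H : ControlEstimator M} (hS : M.Standing μ) (hD : M.SpatialDomain Δ)
    (hW : M.WeakDependence μ Δ) (hB : B.Bounded M.suppT M.suppS) (hSm : B.Smooth ζU ζV)
    (hE : B.EigenCondition M μ) (hR : H.Rate μ ν) (hG : B.Growth κ ζU ζV ν) :
    ∃ c : ℝ, 0 < c ∧ WithHighProb μ (B.GramBelow H c) := by
  obtain ⟨c₁, c₂, hc₁, hev⟩ := hE
  obtain ⟨CX, hCX0, hCX⟩ := exists_ae_sampleRange hS hW
  obtain ⟨CP, hCP0, hCP⟩ := hB.exists_PTS_bound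
  obtain ⟨CU, hCU0, hU, hV, -⟩ := hB.exists_PUV_bound
  obtain ⟨Cκ, hCκ0, hCκ⟩ := hG.exists_bounds
  -- `K` gathers the constants of the row perturbation, plus 1 so that it is positive, and η² =
  -- c₁/(8K) makes this perturbation at most c₁/8. Rows are perturbed by P_TS ⊗ (·), whose squared
  -- norm carries a factor of order κ; hence the weights √κ in `w2` and `w3`.
  set K : ℝ := Cκ * CP ^ 2 * 3 * (4 * CU ^ 2 + 1) + 1 with hK
  have hK0 : 0 < K := by positivity
  set η : ℝ := √(c₁ / 2 / 4 / K) with hη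
  have hη0 : 0 < η := by positivity
  have hη2 : η ^ 2 = c₁ / 2 / 4 / K := Real.sq_sqrt (by positivity)
  have w1 := (isBigOP_sqrt_gramErr hS hD hW hB hSm hG).withHighProb (s := fun _ => 1)
    (c := c₁ / 2) (Eventually.of_forall fun _ => zero_le_one)
    (by simpa using hG.tendsto_sq_div_sqrt) (by positivity)
  have w2 := (isBigOP_ctrlErr hR).withHighProb (s := fun n => B.zetaDagger ζU ζV n * √(κ n))
    (c := η) (Eventually.of_forall fun n => by
      have h1 : 0 ≤ ζU n := (Real.sqrt_nonneg _).trans (hSm.boundU n 0 (by simp))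
      have h2 : 0 ≤ ζV n := (Real.sqrt_nonneg _).trans (hSm.boundV n 0 (by simp))
      rw [zetaDagger]; positivity) hG.lim₂ hη0
  have w3 := (isBigOP_sqrt_meanErr hD hW hB hSm hG).withHighProb (s := fun n => √(κ n))
    (c := η) (Eventually.of_forall fun _ => Real.sqrt_nonneg _)
    (hG.tendsto_div_sqrt.congr fun n => by
      rw [Real.sqrt_div (hG.κ_pos n).le, ← mul_div_assoc, Real.mul_self_sqrt (hG.κ_pos n).le]) hη0
  refine ⟨c₁ / 2 / 4, by positivity,
    (((w1.inter w2).inter w3).inter (WithHighProb.of_ae hCX)).mono ?_⟩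
  filter_upwards [hev, hCκ, eventually_gt_atTop 0] with n hev hn hn0
  rintro ω ⟨⟨⟨h1, h2⟩, h3⟩, h4⟩
  simp only [Set.mem_ofPred_eq, one_mul] at h1 h2 h3 h4
  have hn' : (0 : ℝ) < n := by exact_mod_cast hn0
  have hgram : ∀ v, c₁ * (v ⬝ᵥ v) ≤ v ⬝ᵥ (B.gram M μ n).mulVec v :=
    (gram_isHermitian n).mul_dotProduct_le_of_le_spectrum fun ρ hρ => (hev ρ hρ).1.le
  have hfrob : B.gramErr M μ n ω ≤ (c₁ / 2) ^ 2 := by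
    rw [abs_of_nonneg (Real.sqrt_nonneg _)] at h1
    rw [← Real.sq_sqrt (gramErr_nonneg (B := B) (M := M) (μ := μ) n ω)]
    exact pow_le_pow_left₀ (Real.sqrt_nonneg _) h1 2
  have hP : ∀ v, (Fintype.card (Fin n) : ℝ) * (c₁ / 2) * (v ⬝ᵥ v) ≤
      ((B.Pi M μ n ω).mulVec v) ⬝ᵥ ((B.Pi M μ n ω).mulVec v) := by
    intro v
    have := Matrix.quadratic_lower_bound_of_frobenius_close hc₁.le hgram hfrob v
    rw [Matrix.smul_mulVec, dotProduct_smul, smul_eq_mul, ← Matrix.mulVec_mulVec,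
      Matrix.dotProduct_mulVec v, Matrix.vecMul_transpose, ← div_eq_inv_mul,
      le_div_iff₀ hn'] at this
    rw [Fintype.card_fin]
    linarith
  have hrows : ∀ i, ∑ k, (B.PiHat H n ω i k - B.Pi M μ n ω i k) ^ 2 ≤ c₁ / 2 / 4 := by
    intro i
    refine (sum_sq_PiHat_sub_Pi_le hSm H hn0 (hCP n) (hU n) (hV n) h4 i).trans ?_
    rw [abs_of_nonneg (ctrlErr_nonneg H n ω)] at h2
    rw [abs_of_nonneg (Real.sqrt_nonneg _)] at h3
    have hκ0 := (hG.κ_pos n).le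
    have h5 : κ n * (B.zetaDagger ζU ζV n * ctrlErr H n ω) ^ 2 ≤ η ^ 2 := by
      have hz : 0 ≤ B.zetaDagger ζU ζV n * √(κ n) * ctrlErr H n ω := by
        have h1 : 0 ≤ ζU n := (Real.sqrt_nonneg _).trans (hSm.boundU n 0 (by simp))
        have h2 : 0 ≤ ζV n := (Real.sqrt_nonneg _).trans (hSm.boundV n 0 (by simp))
        have h3 := ctrlErr_nonneg H n ω
        rw [zetaDagger]; positivity
      have := pow_le_pow_left₀ hz h2 2
      rw [mul_right_comm, mul_pow, Real.sq_sqrt hκ0] at this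
      linarith
    have h6 : κ n * B.meanErr M μ n ω ≤ η ^ 2 := by
      have := pow_le_pow_left₀ (by positivity) h3 2
      rwa [mul_pow, Real.sq_sqrt hκ0, Real.sq_sqrt (meanErr_nonneg n ω)] at this
    have h7 := meanErr_nonneg (B := B) (M := M) (μ := μ) n ω
    calc _ ≤ Cκ * κ n * CP ^ 2 * (3 * (4 * CU ^ 2 * (B.zetaDagger ζU ζV n * ctrlErr H n ω) ^ 2 +
          B.meanErr M μ n ω)) := by gcongr; exact hn.1
      _ = Cκ * CP ^ 2 * 3 * (4 * CU ^ 2 * (κ n * (B.zetaDagger ζU ζV n * ctrlErr H n ω) ^ 2) +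
          κ n * B.meanErr M μ n ω) := by ring
      _ ≤ Cκ * CP ^ 2 * 3 * (4 * CU ^ 2 * η ^ 2 + η ^ 2) := by gcongr
      _ = (K - 1) * η ^ 2 := by rw [hK]; ring
      _ ≤ K * η ^ 2 := by nlinarith [sq_nonneg η]
      _ = _ := by rw [hη2]; field_simp
  intro v
  have := Matrix.gram_lower_bound_of_rows_close hP hrows v
  rwa [Fintype.card_fin] at this

end SeriesBasis

/-! ### Regularity and sample mean of the control function. -/

namespace SpilloverModel

variable {Ω : Type*} [MeasurableSpace Ω] {d dx dz : ℕ} {M : SpilloverModel Ω d dx dz}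
  {μ : Measure Ω}

lemma exists_lam_lipschitz (h : ContDiffOn ℝ 1 (Function.uncurry M.lam)
    (Set.Icc (0 : ℝ) 1 ×ˢ Set.Icc (0 : ℝ) 1)) : ∃ L : ℝ, 0 ≤ L ∧
    ∀ u ∈ Set.Icc (0 : ℝ) 1, ∀ v ∈ Set.Icc (0 : ℝ) 1, ∀ u' ∈ Set.Icc (0 : ℝ) 1,
    ∀ v' ∈ Set.Icc (0 : ℝ) 1, |M.lam u v - M.lam u' v'| ≤ L * (|u - u'| + |v - v'|) := by
  obtain ⟨K, hK⟩ := h.exists_lipschitzOnWith one_ne_zero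
    ((convex_Icc 0 1).prod (convex_Icc 0 1)) (isCompact_Icc.prod isCompact_Icc)
  refine ⟨K, K.2, fun u hu v hv u' hu' v' hv' => ?_⟩
  have := hK.dist_le_mul (u, v) ⟨hu, hv⟩ (u', v') ⟨hu', hv'⟩
  simp only [Real.dist_eq, Function.uncurry_apply_pair, Prod.dist_eq] at this
  refine this.trans (mul_le_mul_of_nonneg_left (max_le ?_ ?_) K.2)
  · linarith [abs_nonneg (v - v')]
  · linarith [abs_nonneg (u - u')]

/-- The sample mean of the control function. -/
def lamMean (M : SpilloverModel Ω d dx dz) (n : ℕ) (ω : Ω) : ℝ :=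
  (n : ℝ)⁻¹ * ∑ i : Fin n, M.lam (M.U n (M.smp n i) ω) (M.V n (M.smp n i) ω)

lemma Standing.integral_lam_eq_zero [IsProbabilityMeasure μ] (hS : M.Standing μ) (n : ℕ)
    (i : Fin n) : ∫ ω, M.lam (M.U n (M.smp n i) ω) (M.V n (M.smp n i) ω) ∂μ = 0 := by
  rw [← integral_congr_ae (hS.control n i), integral_condExp, hS.centered n i]
  exact ((M.measurable_U n _).prodMk
    ((M.measurable_V_sigmaF n _).mono (M.sigmaF_le n) le_rfl)).comap_le

/-- λ(U_i, V_i) has mean E[ε_i] = 0 and is a bounded local function, so the average is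
O_P(n^(-1/2)); ν ≤ 1/2 allows the weaker rate. -/
theorem isBigOP_lamMean [IsProbabilityMeasure μ] {Δ : ℕ} (hS : M.Standing μ)
    (hD : M.SpatialDomain Δ) (hW : M.WeakDependence μ Δ)
    (hlam : ContinuousOn (Function.uncurry M.lam) (Set.Icc (0 : ℝ) 1 ×ˢ Set.Icc (0 : ℝ) 1))
    {ν : ℝ} (hν : ν ≤ 1 / 2) : IsBigOP μ M.lamMean fun n => (n : ℝ) ^ (-ν) := by
  obtain ⟨C, hC0, hC⟩ := exists_integral_sq_mean_le hD hW
  obtain ⟨CL, hCL0, hCL⟩ := exists_lam_bound hlam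
  have key := fun n => hC n (fun i ω => M.lam (M.U n (M.smp n i) ω) (M.V n (M.smp n i) ω)) CL
    (fun i => measurable_lam_UV hlam (M.measurable_U_sigmaNbhd (M.self_mem_nbhd n _))
      (M.measurable_V_sigmaNbhd n _))
    (fun i => Eventually.of_forall fun ω => hCL _ (M.UV_mem n _ ω).1 _ (M.UV_mem n _ ω).2)
  simp only [hS.integral_lam_eq_zero, Finset.sum_const_zero, mul_zero, sub_zero] at key
  refine IsBigOP.of_integral_sq_le (C := C * CL ^ 2) (fun n => (key n).1) ?_ ?_
  · filter_upwards [eventually_gt_atTop 0] with n hn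
    exact Real.rpow_pos_of_pos (by exact_mod_cast hn) _
  · filter_upwards [eventually_gt_atTop 0] with n hn
    have hn1 : (1 : ℝ) ≤ n := by exact_mod_cast hn
    refine (key n).2.trans ?_
    rw [div_eq_mul_inv]
    refine mul_le_mul_of_nonneg_left ?_ (by positivity)
    rw [← Real.rpow_natCast, ← Real.rpow_mul (by positivity), ← Real.rpow_neg_one]
    exact Real.rpow_le_rpow_of_exponent_le hn1 (by push_cast; linarith)

end SpilloverModel

/-! ### Approximation error of the outcome equation. -/

namespace SeriesBasis

variable {Ω : Type*} [MeasurableSpace Ω] {d dx dz : ℕ} {B : SeriesBasis}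
  {M : SpilloverModel Ω d dx dz} {μ : Measure Ω}

lemma KTS_rpow_neg_nonneg (n : ℕ) (m : ℝ) : 0 ≤ B.KTS n ^ (-m) :=
  Real.rpow_nonneg (zero_le_one.trans (one_le_KTS n)) _

lemma KUV_rpow_neg_nonneg (n : ℕ) (m : ℝ) : 0 ≤ B.KUV n ^ (-m) :=
  Real.rpow_nonneg (zero_le_one.trans (one_le_KUV n)) _

lemma bias_nonneg (μβ μg μlam : ℝ) (n : ℕ) : 0 ≤ B.bias μβ μg μlam n :=
  add_nonneg (add_nonneg (KTS_rpow_neg_nonneg n _) (KTS_rpow_neg_nonneg n _))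
    (KUV_rpow_neg_nonneg n _)

/-- A function that is approximated by bounded series is bounded. -/
lemma Bounded.exists_bound_of_approx (hB : B.Bounded M.suppT M.suppS) {f : ℝ → ℝ → ℝ}
    {θ : ∀ n, B.IdxTS n → ℝ} {m : ℝ} (h : ∃ C : ℝ, ∀ᶠ n in atTop, ∀ x ∈ M.suppTS,
    |f x.1 x.2 - ∑ k, B.PTS n x.1 x.2 k * θ n k| ≤ C * B.KTS n ^ (-m)) :
    ∃ C : ℝ, 0 ≤ C ∧ ∀ x ∈ M.suppTS, |f x.1 x.2| ≤ C := by
  obtain ⟨CP, hCP0, hCP⟩ := hB.exists_PTS_bound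
  obtain ⟨C, hC⟩ := h
  -- A single n suffices: one fixed finite series is bounded. This matters because the range of (T,
  -- S) need not be compact.
  obtain ⟨n, hn⟩ := hC.exists
  refine ⟨|C * B.KTS n ^ (-m)| + ∑ k, CP * |θ n k|, by positivity, fun x hx => ?_⟩
  have h1 := (hn x hx).trans (le_abs_self _)
  have h2 : |∑ k, B.PTS n x.1 x.2 k * θ n k| ≤ ∑ k, CP * |θ n k| := by
    refine (Finset.abs_sum_le_sum_abs _ _).trans (Finset.sum_le_sum fun k _ => ?_)
    rw [abs_mul]
    exact mul_le_mul_of_nonneg_right (hCP n _ hx.1 _ hx.2 k) (abs_nonneg _)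
  have h3 := abs_sub_abs_le_abs_sub (f x.1 x.2) (∑ k, B.PTS n x.1 x.2 k * θ n k)
  linarith

section Remainder

variable {θβ : ∀ n, B.IdxB dx n → ℝ} {θg : ∀ n, B.IdxTS n → ℝ} {θlam : ∀ n, B.IdxUV n → ℝ}
  {μβ μg μlam : ℝ}

lemma PiHat_mulVec (H : ControlEstimator M) (n : ℕ) (ω : Ω) (i : Fin n) :
    (B.PiHat H n ω).mulVec (Sum.elim (θβ n) (B.kron θg θlam n)) i =
      ∑ l, M.X n (M.smp n i) ω l *
        ∑ k, B.PTS n (M.T n (M.smp n i) ω) (M.S n (M.smp n i) ω) k * θβ n (l, k) +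
      (∑ k, B.PTS n (M.T n (M.smp n i) ω) (M.S n (M.smp n i) ω) k * θg n k) *
        ∑ k, B.PUVhat H n ω (H.Uhat n (M.smp n i) ω) (H.Vhat n (M.smp n i) ω) k * θlam n k := by
  rw [Matrix.mulVec, dotProduct, Fintype.sum_sum_type]
  congr 1
  · rw [Fintype.sum_prod_type]
    refine Finset.sum_congr rfl fun l _ => ?_
    rw [Finset.mul_sum]
    refine Finset.sum_congr rfl fun k _ => ?_
    simp only [PiHat, Matrix.of_apply, Sum.elim_inl]
    ring
  · rw [Finset.sum_mul_sum, Fintype.sum_prod_type]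
    refine Finset.sum_congr rfl fun a _ => Finset.sum_congr rfl fun b _ => ?_
    simp only [PiHat, Matrix.of_apply, Sum.elim_inr, kron]
    ring

/-- The population centring cancels, so the empirically centred basis is also the recentring of
P̄_UV, the basis for which the approximation hypothesis is stated. -/
lemma sum_PUVhat_mul (H : ControlEstimator M) {n : ℕ} (hn : 0 < n) (ω : Ω) (u v : ℝ)
    (θ : B.IdxUV n → ℝ) :
    ∑ k, B.PUVhat H n ω u v k * θ k = ∑ k, B.PUVbar M μ n u v k * θ k -
      (n : ℝ)⁻¹ * ∑ j : Fin n, ∑ k, B.PUVbar M μ n (H.Uhat n (M.smp n j) ω)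
        (H.Vhat n (M.smp n j) ω) k * θ k := by
  have hn' : (n : ℝ) ≠ 0 := by exact_mod_cast hn.ne'
  have h : ∀ k, B.PUVhat H n ω u v k = B.PUVbar M μ n u v k - (n : ℝ)⁻¹ * ∑ j : Fin n,
      B.PUVbar M μ n (H.Uhat n (M.smp n j) ω) (H.Vhat n (M.smp n j) ω) k := by
    intro k
    simp only [PUVhat, PUVbar, Finset.sum_sub_distrib, Finset.sum_const, Finset.card_univ,
      Fintype.card_fin, nsmul_eq_mul, mul_sub, inv_mul_cancel_left₀ hn']
    ring
  simp_rw [h, sub_mul]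
  rw [Finset.sum_sub_distrib, Finset.sum_comm, Finset.mul_sum]
  simp_rw [mul_assoc, Finset.sum_mul]

/-- The feasible series in the control variables approximates the control function. -/
lemma abs_sum_PUVhat_sub_lam_le (H : ControlEstimator M) {L A : ℝ} {n : ℕ} (hn : 0 < n)
    {θ : B.IdxUV n → ℝ} (hL : ∀ u ∈ Set.Icc (0 : ℝ) 1, ∀ v ∈ Set.Icc (0 : ℝ) 1,
      ∀ u' ∈ Set.Icc (0 : ℝ) 1, ∀ v' ∈ Set.Icc (0 : ℝ) 1,
      |M.lam u v - M.lam u' v'| ≤ L * (|u - u'| + |v - v'|)) (hL0 : 0 ≤ L)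
    (hA : ∀ u ∈ Set.Icc (0 : ℝ) 1, ∀ v ∈ Set.Icc (0 : ℝ) 1,
      |M.lam u v - ∑ k, B.PUVbar M μ n u v k * θ k| ≤ A) (ω : Ω) (i : Fin n) :
    |∑ k, B.PUVhat H n ω (H.Uhat n (M.smp n i) ω) (H.Vhat n (M.smp n i) ω) k * θ k -
      M.lam (M.U n (M.smp n i) ω) (M.V n (M.smp n i) ω)| ≤
      2 * (A + L * ctrlErr H n ω) + |M.lamMean n ω| := by
  have hn' : (n : ℝ) ≠ 0 := by exact_mod_cast hn.ne'
  set s : Fin n → ℝ := fun j => ∑ k, B.PUVbar M μ n (H.Uhat n (M.smp n j) ω)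
        (H.Vhat n (M.smp n j) ω) k * θ k
  set l : Fin n → ℝ := fun j => M.lam (M.U n (M.smp n j) ω) (M.V n (M.smp n j) ω)
  -- Approximate at the estimated controls, where the sup bound holds, and only then move λ itself
  -- to the true controls. No derivative of the basis enters.
  have h1 : ∀ j, |s j - l j| ≤ A + L * ctrlErr H n ω := by
    intro j
    have e1 := hA _ (H.Uhat_mem n (M.smp n j) ω) _ (H.Vhat_mem n (M.smp n j) ω)
    have e2 := (hL _ (H.Uhat_mem n (M.smp n j) ω) _ (H.Vhat_mem n (M.smp n j) ω) _
      (M.UV_mem n (M.smp n j) ω).1 _ (M.UV_mem n (M.smp n j) ω).2).trans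
      (mul_le_mul_of_nonneg_left (abs_sub_add_le_ctrlErr H n (M.smp n j) ω) hL0)
    rw [abs_sub_comm] at e1
    exact (abs_sub_le _ _ _).trans (add_le_add e1 e2)
  have h2 : |(n : ℝ)⁻¹ * ∑ j, (s j - l j)| ≤ A + L * ctrlErr H n ω := by
    rw [abs_mul, abs_of_nonneg (by positivity : (0 : ℝ) ≤ (n : ℝ)⁻¹)]
    calc _ ≤ (n : ℝ)⁻¹ * ∑ _j : Fin n, (A + L * ctrlErr H n ω) := by
          refine mul_le_mul_of_nonneg_left ?_ (by positivity)
          exact (Finset.abs_sum_le_sum_abs _ _).trans (Finset.sum_le_sum fun j _ => h1 j)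
      _ = _ := by
          rw [Finset.sum_const, Finset.card_univ, Fintype.card_fin, nsmul_eq_mul,
            inv_mul_cancel_left₀ hn']
  rw [sum_PUVhat_mul (μ := μ) H hn]
  have e : s i - (n : ℝ)⁻¹ * ∑ j, s j - l i =
      (s i - l i) - (n : ℝ)⁻¹ * ∑ j, (s j - l j) - M.lamMean n ω := by
    simp only [SpilloverModel.lamMean, Finset.sum_sub_distrib, l]
    ring
  change |s i - (n : ℝ)⁻¹ * ∑ j, s j - l i| ≤ _
  rw [e]
  have e1 := abs_sub (s i - l i - (n : ℝ)⁻¹ * ∑ j, (s j - l j)) (M.lamMean n ω)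
  have e2 := abs_sub (s i - l i) ((n : ℝ)⁻¹ * ∑ j, (s j - l j))
  linarith [h1 i]

/-- The approximation error of the outcome equation, net of the conditionally centered errors. -/
theorem exists_remainder_bound (hB : B.Bounded M.suppT M.suppS) (H : ControlEstimator M)
    (hA : B.SeriesApproximation M μ θβ θg θlam μβ μg μlam) {CX : ℝ} (hCX : 0 ≤ CX) :
    ∃ C : ℝ, 0 < C ∧ ∀ᶠ n in atTop, ∀ ω, SampleRange M CX n ω → ∀ i : Fin n,
      |M.Y n (M.smp n i) ω - (B.PiHat H n ω).mulVec (Sum.elim (θβ n) (B.kron θg θlam n)) i -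
        M.g (M.T n (M.smp n i) ω) (M.S n (M.smp n i) ω) * M.err n i ω| ≤
      C * (B.bias μβ μg μlam n + ctrlErr H n ω + |M.lamMean n ω|) := by
  obtain ⟨Cg, hCg0, hCg⟩ := hB.exists_bound_of_approx hA.g_approx
  obtain ⟨CL, hCL0, hCL⟩ := SpilloverModel.exists_lam_bound hA.lam_smooth.continuousOn
  obtain ⟨L, hL0, hL⟩ := SpilloverModel.exists_lam_lipschitz hA.lam_smooth
  choose Cβ hCβ using hA.beta_approx
  obtain ⟨Cga, hCga⟩ := hA.g_approx
  obtain ⟨Cla, hCla⟩ := hA.lam_approx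
  set C₁ := ∑ l, CX * |Cβ l| with hC₁
  have hC₁0 : 0 ≤ C₁ := by positivity
  refine ⟨C₁ + |Cga| * CL + (Cg + |Cga|) * (2 * |Cla| + 2 * L + 1) + 1, by positivity, ?_⟩
  filter_upwards [eventually_all.2 hCβ, hCga, hCla, eventually_gt_atTop 0] with n hβ hg hl hn
  intro ω hω i
  obtain ⟨hT, hS, hX⟩ := hω i
  have hTS : (M.T n (M.smp n i) ω, M.S n (M.smp n i) ω) ∈ M.suppTS := ⟨hT, hS⟩
  rw [PiHat_mulVec, SpilloverModel.Y, SpilloverModel.err]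
  have hg1 := hg _ hTS
  have hg2 := hCg _ hTS
  have hβ1 := fun l => hβ l _ hTS
  simp only at hg1 hg2 hβ1
  have hq := abs_sum_PUVhat_sub_lam_le H hn (A := |Cla| * B.KUV n ^ (-μlam)) hL hL0
    (fun u hu v hv => (hl u hu v hv).trans
      (mul_le_mul_of_nonneg_right (le_abs_self _) (KUV_rpow_neg_nonneg n _))) ω i
  have hlam := hCL _ (M.UV_mem n (M.smp n i) ω).1 _ (M.UV_mem n (M.smp n i) ω).2
  simp only at hlam
  set t := M.T n (M.smp n i) ω
  set s := M.S n (M.smp n i) ω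
  set p := ∑ k, B.PTS n t s k * θg n k
  set q := ∑ k, B.PUVhat H n ω (H.Uhat n (M.smp n i) ω) (H.Vhat n (M.smp n i) ω) k * θlam n k
  set l₀ := M.lam (M.U n (M.smp n i) ω) (M.V n (M.smp n i) ω)
  set g₀ := M.g t s
  have hb1 := KTS_rpow_neg_nonneg (B := B) n μβ
  have hb2 := KTS_rpow_neg_nonneg (B := B) n μg
  have hb3 := KUV_rpow_neg_nonneg (B := B) n μlam
  have hδ := ctrlErr_nonneg H n ω
  have hm := abs_nonneg (M.lamMean n ω)
  have hlin : |∑ l, M.X n (M.smp n i) ω l * (M.beta l t s - ∑ k, B.PTS n t s k * θβ n (l, k))| ≤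
      C₁ * B.KTS n ^ (-μβ) := by
    rw [hC₁, Finset.sum_mul]
    refine (Finset.abs_sum_le_sum_abs _ _).trans (Finset.sum_le_sum fun l _ => ?_)
    rw [abs_mul, mul_assoc]
    refine mul_le_mul ((PiLp.norm_apply_le _ l).trans hX) ((hβ1 l).trans ?_) (abs_nonneg _) hCX
    exact mul_le_mul_of_nonneg_right (le_abs_self _) hb1
  have hg3 : |g₀ - p| ≤ |Cga| * B.KTS n ^ (-μg) :=
    hg1.trans (mul_le_mul_of_nonneg_right (le_abs_self _) hb2)
  -- The series for g is uniformly bounded because g is and the approximation error is at most a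
  -- constant, as K_TS ≥ 1.
  have hp : |p| ≤ Cg + |Cga| := by
    have h1 : B.KTS n ^ (-μg) ≤ 1 :=
      Real.rpow_le_one_of_one_le_of_nonpos (one_le_KTS n) (by linarith [hA.μg_pos])
    have h2 := mul_le_mul_of_nonneg_left h1 (abs_nonneg Cga)
    have h3 := abs_sub_abs_le_abs_sub p g₀
    rw [abs_sub_comm] at h3
    linarith
  have hprod : |g₀ * l₀ - p * q| ≤ |Cga| * B.KTS n ^ (-μg) * CL +
      (Cg + |Cga|) * (2 * (|Cla| * B.KUV n ^ (-μlam) + L * ctrlErr H n ω) + |M.lamMean n ω|) := by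
    rw [show g₀ * l₀ - p * q = (g₀ - p) * l₀ - p * (q - l₀) by ring]
    refine (abs_sub _ _).trans (add_le_add ?_ ?_)
    · rw [abs_mul]; exact mul_le_mul hg3 hlam (abs_nonneg _) (by positivity)
    · rw [abs_mul]; exact mul_le_mul hp hq (abs_nonneg _) (by positivity)
  have e : ∑ l, M.X n (M.smp n i) ω l * M.beta l t s + g₀ * M.eps n (M.smp n i) ω -
      (∑ l, M.X n (M.smp n i) ω l * ∑ k, B.PTS n t s k * θβ n (l, k) + p * q) -
      g₀ * (M.eps n (M.smp n i) ω - l₀) =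
      ∑ l, M.X n (M.smp n i) ω l * (M.beta l t s - ∑ k, B.PTS n t s k * θβ n (l, k)) +
        (g₀ * l₀ - p * q) := by
    simp only [mul_sub, Finset.sum_sub_distrib]
    ring
  rw [e]
  refine (abs_add_le _ _).trans ((add_le_add hlin hprod).trans ?_)
  rw [bias]
  set x := B.KTS n ^ (-μβ)
  set y := B.KTS n ^ (-μg)
  set z := B.KUV n ^ (-μlam)
  set δ := ctrlErr H n ω
  set m := |M.lamMean n ω|
  set G := Cg + |Cga|
  have hG : 0 ≤ G := by positivity
  have hw : x + y + z + δ + m = x + (y + (z + (δ + m))) := by ring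
  set w := x + y + z + δ + m with hwdef
  have b1 : C₁ * x ≤ C₁ * w := mul_le_mul_of_nonneg_left (by linarith) hC₁0
  have b2 : |Cga| * CL * y ≤ |Cga| * CL * w := mul_le_mul_of_nonneg_left (by linarith) (by positivity)
  have b3 : G * (2 * |Cla|) * z ≤ G * (2 * |Cla|) * w :=
    mul_le_mul_of_nonneg_left (by linarith) (by positivity)
  have b4 : G * (2 * L) * δ ≤ G * (2 * L) * w :=
    mul_le_mul_of_nonneg_left (by linarith) (by positivity)
  have b5 : G * m ≤ G * w := mul_le_mul_of_nonneg_left (by linarith) hG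
  have hw0 : 0 ≤ w := by positivity
  nlinarith

end Remainder

end SeriesBasis

/-- The inverse is the adjugate divided by the determinant, both polynomial in the entries; singular
matrices are covered by the convention 0⁻¹ = 0. -/
lemma Matrix.measurable_inv_apply {α ι : Type*} [Fintype ι] [DecidableEq ι] {_ : MeasurableSpace α}
    {A : α → Matrix ι ι ℝ} (hA : ∀ i j, Measurable fun ω => A ω i j) (i j : ι) :
    Measurable fun ω => (A ω)⁻¹ i j := by
  have hdet : ∀ {A : α → Matrix ι ι ℝ}, (∀ i j, Measurable fun ω => A ω i j) →
      Measurable fun ω => (A ω).det := by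
    intro A hA
    simp only [Matrix.det_apply]
    exact Finset.measurable_sum _ fun σ _ =>
      (Finset.measurable_prod _ fun i _ => hA _ _).const_smul _
  have hadj : Measurable fun ω => (A ω).adjugate i j := by
    simp only [Matrix.adjugate_apply]
    refine hdet fun k l => ?_
    simp only [Matrix.updateRow_apply]
    split_ifs
    · exact measurable_const
    · exact hA k l
  simp only [Matrix.inv_def, Matrix.smul_apply, smul_eq_mul, Ring.inverse_eq_inv']
  exact (hdet hA).inv.mul hadj

/-! ### Contribution of the errors to the coefficients. -/

namespace SeriesBasis

variable {Ω : Type*} [MeasurableSpace Ω] {d dx dz : ℕ} {B : SeriesBasis}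
  {M : SpilloverModel Ω d dx dz} {μ : Measure Ω}

/-- The matrix `[Π̂ᵀ Π̂ + τ_n D n]⁻¹ Π̂ᵀ` mapping outcomes to coefficients. -/
def ridgeMap (B : SeriesBasis) (H : ControlEstimator M) (τ : ℕ → ℝ)
    (D : ∀ n, Matrix (B.Idx dx n) (B.Idx dx n) ℝ) (n : ℕ) (ω : Ω) :
    Matrix (B.Idx dx n) (Fin n) ℝ :=
  ((B.PiHat H n ω).transpose * B.PiHat H n ω + (τ n * (n : ℝ)) • D n)⁻¹ *
    (B.PiHat H n ω).transpose

section

variable {τ ζU ζV : ℕ → ℝ} {D : ∀ n, Matrix (B.Idx dx n) (B.Idx dx n) ℝ}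

lemma Smooth.measurable_ridgeMap (h : B.Smooth ζU ζV) (H : ControlEstimator M) (n : ℕ)
    (k : B.Idx dx n) (i : Fin n) : Measurable[M.sigmaF n] fun ω => B.ridgeMap H τ D n ω k i := by
  simp only [ridgeMap, Matrix.mul_apply, Matrix.transpose_apply]
  refine Finset.measurable_sum _ fun l _ => Measurable.mul ?_ (h.measurable_PiHat H n i l)
  refine Matrix.measurable_inv_apply (fun k l => ?_) k l
  simp only [Matrix.add_apply, Matrix.mul_apply, Matrix.transpose_apply, Matrix.smul_apply]
  exact (Finset.measurable_sum _ fun i _ =>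
    (h.measurable_PiHat H n i k).mul (h.measurable_PiHat H n i l)).add measurable_const

open Classical in
/-- The function `g`, set to zero off the range of `(T_i, S_i)`. -/
def gExt (M : SpilloverModel Ω d dx dz) : ℝ × ℝ → ℝ :=
  M.suppTS.piecewise (Function.uncurry M.g) 0

/-- Nothing is assumed on g off the range of (T, S), which is reached with probability zero. The
extension by zero on the closed range is measurable everywhere. -/
lemma measurable_gExt (hg : ContinuousOn (Function.uncurry M.g) M.suppTS) :
    Measurable (gExt M) := by
  classical
  exact hg.measurable_piecewise continuousOn_const
    (M.suppT_closed.prod M.suppS_closed).measurableSet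

lemma gExt_of_mem {x : ℝ × ℝ} (hx : x ∈ M.suppTS) : gExt M x = M.g x.1 x.2 := by
  classical exact Set.piecewise_eq_of_mem _ _ _ hx

lemma abs_gExt_le {C : ℝ} (hC0 : 0 ≤ C) (hC : ∀ x ∈ M.suppTS, |M.g x.1 x.2| ≤ C) (x : ℝ × ℝ) :
    |gExt M x| ≤ C := by
  classical
  by_cases hx : x ∈ M.suppTS
  · rw [gExt_of_mem hx]; exact hC x hx
  · rw [gExt, Set.piecewise_eq_of_notMem _ _ _ hx]; simpa using hC0

open Classical in
/-- The contribution of the errors to a coefficient, truncated where the regressor matrix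
degenerates. -/
def truncNoise (B : SeriesBasis) (H : ControlEstimator M) (τ : ℕ → ℝ)
    (D : ∀ n, Matrix (B.Idx dx n) (B.Idx dx n) ℝ) (c : ℝ) (n : ℕ) (k : B.Idx dx n) (ω : Ω) : ℝ :=
  ∑ i : Fin n, (if ∑ j, B.ridgeMap H τ D n ω k j ^ 2 ≤ 1 / (n * c) then
    B.ridgeMap H τ D n ω k i * gExt M (M.T n (M.smp n i) ω, M.S n (M.smp n i) ω) else 0) *
    M.err n i ω

/-- The truncation event is F_N-measurable and forces the squared weights to sum to at most Cg²/(nc)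
everywhere, so the second-moment bound applies without conditioning on the good event. Summing
O(1/n) over the block and applying Chebyshev gives the rate. -/
theorem isBigOP_truncNoise [IsProbabilityMeasure μ] (hS : M.Standing μ) (hE : M.ErrorCondition μ)
    (hlam : ContinuousOn (Function.uncurry M.lam) (Set.Icc (0 : ℝ) 1 ×ˢ Set.Icc (0 : ℝ) 1))
    (hg : ContinuousOn (Function.uncurry M.g) M.suppTS) (hSm : B.Smooth ζU ζV)
    (H : ControlEstimator M) {Cg c : ℝ} (hCg0 : 0 ≤ Cg)
    (hCg : ∀ x ∈ M.suppTS, |M.g x.1 x.2| ≤ Cg) (hc : 0 < c) {J : ℕ → Type*}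
    [∀ n, Fintype (J n)] (σ : ∀ n, J n → B.Idx dx n) {q : ℕ → ℝ} {CJ : ℝ} (hq : ∀ n, 0 < q n)
    (hJ : ∀ᶠ n in atTop, (Fintype.card (J n) : ℝ) ≤ CJ * q n) :
    IsBigOP μ (fun n ω => √(∑ j, B.truncNoise H τ D c n (σ n j) ω ^ 2)) fun n => √(q n / n) := by
  classical
  obtain ⟨C, hC0, hC⟩ := SpilloverModel.exists_integral_sq_sum_err_le hS hE hlam
  have key := fun n (k : B.Idx dx n) => hC n (fun i ω =>
    if ∑ j, B.ridgeMap H τ D n ω k j ^ 2 ≤ 1 / (n * c) then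
    B.ridgeMap H τ D n ω k i * gExt M (M.T n (M.smp n i) ω, M.S n (M.smp n i) ω) else 0)
    (Cg ^ 2 * (1 / (n * c))) (fun i => by
      refine Measurable.ite ?_ ?_ measurable_const
      · exact measurableSet_le (Finset.measurable_sum _ fun j _ =>
          (hSm.measurable_ridgeMap H n k j).pow_const 2) measurable_const
      · exact (hSm.measurable_ridgeMap H n k i).mul ((measurable_gExt hg).comp
          ((M.measurable_T_sigmaF n _).prodMk (M.measurable_S_sigmaF n _)))) (fun ω => by
      split_ifs with h
      · calc _ ≤ ∑ i, Cg ^ 2 * B.ridgeMap H τ D n ω k i ^ 2 := by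
              refine Finset.sum_le_sum fun i _ => ?_
              rw [mul_pow, mul_comm]
              refine mul_le_mul_of_nonneg_right ?_ (sq_nonneg _)
              have := abs_gExt_le hCg0 hCg (M.T n (M.smp n i) ω, M.S n (M.smp n i) ω)
              exact sq_le_sq' (abs_le.1 this).1 (abs_le.1 this).2
          _ ≤ _ := by
              rw [← Finset.mul_sum]
              exact mul_le_mul_of_nonneg_left h (sq_nonneg _)
      · simp only [ne_eq, OfNat.ofNat_ne_zero, not_false_eq_true, zero_pow, Finset.sum_const_zero]
        positivity)
  have hsq : ∀ n ω, √(∑ j, B.truncNoise H τ D c n (σ n j) ω ^ 2) ^ 2 =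
      ∑ j, B.truncNoise H τ D c n (σ n j) ω ^ 2 := fun n ω =>
    Real.sq_sqrt (Finset.sum_nonneg fun _ _ => sq_nonneg _)
  have hi : ∀ n k, Integrable (fun ω => B.truncNoise H τ D c n k ω ^ 2) μ := fun n k => by
    convert (key n k).1 using 3
    exact Finset.sum_congr rfl fun i _ => by congr
  have hv : ∀ n k, ∫ ω, B.truncNoise H τ D c n k ω ^ 2 ∂μ ≤ C * (Cg ^ 2 * (1 / (n * c))) :=
    fun n k => by
    refine le_of_eq_of_le ?_ (key n k).2
    congr 1 with ω
  refine IsBigOP.of_integral_sq_le (C := CJ * (C * Cg ^ 2 / c)) (fun n => ?_) ?_ ?_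
  · simp_rw [hsq]
    exact integrable_finsetSum _ fun j _ => hi n _
  · filter_upwards [eventually_gt_atTop 0] with n hn
    have : (0 : ℝ) < n := by exact_mod_cast hn
    exact Real.sqrt_pos.2 (div_pos (hq n) this)
  · filter_upwards [hJ] with n hn
    simp_rw [hsq]
    rw [integral_finsetSum _ fun j _ => hi n _, Real.sq_sqrt (div_nonneg (hq n).le (by positivity))]
    calc _ ≤ ∑ _j : J n, C * (Cg ^ 2 * (1 / (n * c))) := Finset.sum_le_sum fun j _ => hv n _
      _ = Fintype.card (J n) * (C * (Cg ^ 2 * (1 / (n * c)))) := by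
          rw [Finset.sum_const, Finset.card_univ, nsmul_eq_mul]
      _ ≤ CJ * q n * (C * (Cg ^ 2 * (1 / (n * c)))) := by gcongr
      _ = _ := by
          rw [one_div, mul_inv]; ring

end

lemma norm_toLp_comp_le {ι κ : Type*} [Fintype ι] [Fintype κ] {σ : κ → ι}
    (hσ : Function.Injective σ) (w : ι → ℝ) :
    ‖WithLp.toLp 2 (fun k => w (σ k))‖ ≤ √(w ⬝ᵥ w) := by
  classical
  rw [EuclideanSpace.norm_eq]
  refine Real.sqrt_le_sqrt ?_
  simp only [Real.norm_eq_abs, sq_abs, dotProduct, ← sq]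
  rw [← Finset.sum_image (g := σ) (f := fun i => w i ^ 2) (s := Finset.univ) hσ.injOn]
  exact Finset.sum_le_sum_of_subset_of_nonneg (Finset.subset_univ _) fun _ _ _ => sq_nonneg _

/-! ### Error decomposition and block rates of the estimator. -/

section Estimator

variable {τ : ℕ → ℝ} {D : ∀ n, Matrix (B.Idx dx n) (B.Idx dx n) ℝ}

/-- The deterministic error bound on the event on which the Gram matrix is bounded below. -/
lemma norm_thetaHat_sub_le (hτ : ∀ n, 0 ≤ τ n) (hD : ∀ n, (D n).PosSemidef)
    (H : ControlEstimator M) {c CD CX R : ℝ} (hc : 0 < c) (hR0 : 0 ≤ R) {n : ℕ} (hn : 0 < n)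
    (hCD : ∀ v, v ⬝ᵥ (D n).mulVec v ≤ CD * (v ⬝ᵥ v)) {ω : Ω} (hω : ω ∈ B.GramBelow H c n)
    (hX : SampleRange M CX n ω) {θβ : ∀ n, B.IdxB dx n → ℝ} {θgl : ∀ n, B.IdxG n → ℝ}
    (hR : ∀ i : Fin n, |M.Y n (M.smp n i) ω -
      (B.PiHat H n ω).mulVec (Sum.elim (θβ n) (θgl n)) i -
        M.g (M.T n (M.smp n i) ω) (M.S n (M.smp n i) ω) * M.err n i ω| ≤ R)
    {J : Type*} [Fintype J] {σ : J → B.Idx dx n} (hσ : Function.Injective σ) :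
    ‖WithLp.toLp 2 (fun j => B.thetaHat H τ D n ω (σ j) - Sum.elim (θβ n) (θgl n) (σ j))‖ ≤
      R / √c + √CD / c * B.tauStar τ D θβ θgl n +
        √(∑ j, B.truncNoise H τ D c n (σ j) ω ^ 2) := by
  classical
  have hn' : (0 : ℝ) < n := by exact_mod_cast hn
  set θ := Sum.elim (θβ n) (θgl n) with hθ
  set P := B.PiHat H n ω with hP
  set t := τ n * (n : ℝ) with ht
  have ht0 : 0 ≤ t := mul_nonneg (hτ n) hn'.le
  have hcn : 0 < n * c := by positivity
  set u : Fin n → ℝ := fun i => M.g (M.T n (M.smp n i) ω) (M.S n (M.smp n i) ω) * M.err n i ω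
  set y : Fin n → ℝ := fun i => M.Y n (M.smp n i) ω
  set r : Fin n → ℝ := fun i => y i - P.mulVec θ i - u i
  have hy : y = P.mulVec θ + r + u := by
    ext i; simp only [Pi.add_apply, r]; ring
  have hsub := Matrix.ridge_sub_eq (hD n) ht0 hcn hω θ y r u hy
  set w₁ := (P.transpose * P + t • D n)⁻¹.mulVec (P.transpose.mulVec r) with hw₁
  set w₂ := (P.transpose * P + t • D n)⁻¹.mulVec (t • (D n).mulVec θ) with hw₂
  -- On the Gram event every row satisfies the truncation bound, and on the sample range g agrees
  -- with its extension, so the truncated noise is the actual one.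
  have hu : ((P.transpose * P + t • D n)⁻¹ * P.transpose).mulVec u =
      fun k => B.truncNoise H τ D c n k ω := by
    ext k
    have hle := Matrix.sum_sq_ridge_inv_mul_transpose_le (hD n) ht0 hcn hω k
    simp only [truncNoise, Matrix.mulVec, dotProduct]
    refine Finset.sum_congr rfl fun i _ => ?_
    rw [if_pos (by exact hle), gExt_of_mem ⟨(hX i).1, (hX i).2.1⟩]
    simp only [u, ridgeMap]
    ring
  rw [hu] at hsub
  have h1 : √(w₁ ⬝ᵥ w₁) ≤ R / √c := by
    have h2 := Matrix.ridge_inv_transpose_mulVec_le (hD n) ht0 hcn hω r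
    rw [← hw₁] at h2
    have h3 : r ⬝ᵥ r ≤ n * R ^ 2 := by
      calc r ⬝ᵥ r ≤ ∑ _i : Fin n, R ^ 2 := by
            refine Finset.sum_le_sum fun i _ => ?_
            rw [← sq]
            exact sq_le_sq' (abs_le.1 (hR i)).1 (abs_le.1 (hR i)).2
        _ = _ := by simp
    have h4 : c * (w₁ ⬝ᵥ w₁) ≤ R ^ 2 := by
      refine le_of_mul_le_mul_left ?_ hn'
      rw [← mul_assoc]; exact h2.trans h3
    rw [le_div_iff₀ (Real.sqrt_pos.2 hc), ← Real.sqrt_mul (Matrix.dotProduct_self_nonneg_real _)]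
    rw [← Real.sqrt_sq hR0]
    exact Real.sqrt_le_sqrt (by linarith)
  have h2 : √(w₂ ⬝ᵥ w₂) ≤ √CD / c * B.tauStar τ D θβ θgl n := by
    have h3 := Matrix.ridge_inv_penalty_le (hD n) ht0 hcn hω hCD θ
    rw [← hw₂] at h3
    have h4 := (hD n).dotProduct_mulVec_nonneg θ
    rw [star_trivial] at h4
    have h5 : c ^ 2 * (w₂ ⬝ᵥ w₂) ≤ CD * (τ n ^ 2 * (θ ⬝ᵥ (D n).mulVec θ)) := by
      refine le_of_mul_le_mul_left ?_ (pow_pos hn' 2)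
      calc _ = (n * c) ^ 2 * (w₂ ⬝ᵥ w₂) := by ring
        _ ≤ _ := h3
        _ = _ := by rw [ht]; ring
    rw [tauStar, div_mul_eq_mul_div, le_div_iff₀ hc, ← hθ]
    have h6 : √(w₂ ⬝ᵥ w₂) * c = √(c ^ 2 * (w₂ ⬝ᵥ w₂)) := by
      rw [Real.sqrt_mul (sq_nonneg c), Real.sqrt_sq hc.le, mul_comm]
    have h7 : √CD * (τ n * √(θ ⬝ᵥ (D n).mulVec θ)) =
        √(CD * (τ n ^ 2 * (θ ⬝ᵥ (D n).mulVec θ))) := by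
      rw [Real.sqrt_mul' _ (by positivity), Real.sqrt_mul (sq_nonneg _), Real.sqrt_sq (hτ n)]
    rw [h6, h7]
    exact Real.sqrt_le_sqrt h5
  have hvec : (WithLp.toLp 2 (fun j => B.thetaHat H τ D n ω (σ j) - θ (σ j)) : EuclideanSpace ℝ J) =
      WithLp.toLp 2 (fun j => w₁ (σ j)) + WithLp.toLp 2 (fun j => B.truncNoise H τ D c n (σ j) ω) -
        WithLp.toLp 2 (fun j => w₂ (σ j)) := by
    ext j
    exact congrFun hsub (σ j)
  have hnoise : ‖(WithLp.toLp 2 (fun j => B.truncNoise H τ D c n (σ j) ω) : EuclideanSpace ℝ J)‖ =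
      √(∑ j, B.truncNoise H τ D c n (σ j) ω ^ 2) := by
    rw [EuclideanSpace.norm_eq]
    simp only [Real.norm_eq_abs, sq_abs]
  rw [hvec]
  have e1 := norm_sub_le ((WithLp.toLp 2 (fun j => w₁ (σ j)) : EuclideanSpace ℝ J) +
    WithLp.toLp 2 (fun j => B.truncNoise H τ D c n (σ j) ω)) (WithLp.toLp 2 (fun j => w₂ (σ j)))
  have e2 := norm_add_le (WithLp.toLp 2 (fun j => w₁ (σ j)) : EuclideanSpace ℝ J)
    (WithLp.toLp 2 (fun j => B.truncNoise H τ D c n (σ j) ω))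
  have e3 := norm_toLp_comp_le hσ w₁
  have e4 := norm_toLp_comp_le hσ w₂
  linarith

variable {θβ : ∀ n, B.IdxB dx n → ℝ} {θg : ∀ n, B.IdxTS n → ℝ} {θlam : ∀ n, B.IdxUV n → ℝ}

lemma tauStar_nonneg (hτ : ∀ n, 0 ≤ τ n) (θβ : ∀ n, B.IdxB dx n → ℝ) (θgl : ∀ n, B.IdxG n → ℝ)
    (n : ℕ) : 0 ≤ B.tauStar τ D θβ θgl n := mul_nonneg (hτ n) (Real.sqrt_nonneg _)

/-- The rate of any block of the estimator, in terms of the order `q` of the size of the block. -/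
theorem isBigOP_thetaHat_block [IsProbabilityMeasure μ] {H : ControlEstimator M} {Δ : ℕ}
    {ν μβ μg μlam : ℝ} {κ ζU ζV : ℕ → ℝ}
    (hStanding : M.Standing μ) (hDomain : M.SpatialDomain Δ) (hMixing : M.WeakDependence μ Δ)
    (hError : M.ErrorCondition μ) (hBounded : B.Bounded M.suppT M.suppS)
    (hSmooth : B.Smooth ζU ζV) (hEigen : B.EigenCondition M μ)
    (hApprox : B.SeriesApproximation M μ θβ θg θlam μβ μg μlam) (hFirst : H.Rate μ ν)
    (hGrowth : B.Growth κ ζU ζV ν) (hPenalty : B.PenaltyCondition dx τ D)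
    {J : ℕ → Type*} [∀ n, Fintype (J n)] {σ : ∀ n, J n → B.Idx dx n}
    (hσ : ∀ n, Function.Injective (σ n)) {q : ℕ → ℝ} {CJ : ℝ} (hq : ∀ n, 0 < q n)
    (hJ : ∀ᶠ n in atTop, (Fintype.card (J n) : ℝ) ≤ CJ * q n) :
    IsBigOP μ
      (fun n ω => ‖WithLp.toLp 2 (fun j => B.thetaHat H τ D n ω (σ n j) -
        Sum.elim (θβ n) (B.kron θg θlam n) (σ n j))‖)
      (fun n => √(q n / n) + B.bias μβ μg μlam n +
        B.tauStar τ D θβ (B.kron θg θlam) n + (n : ℝ) ^ (-ν)) := by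
  obtain ⟨c, hc, hgood⟩ := exists_withHighProb_gramBelow hStanding hDomain hMixing hBounded
    hSmooth hEigen hFirst hGrowth
  obtain ⟨CX, hCX0, hCX⟩ := exists_ae_sampleRange hStanding hMixing
  obtain ⟨CR, hCR0, hCR⟩ := exists_remainder_bound hBounded H hApprox hCX0
  obtain ⟨Cg, hCg0, hCg⟩ := hBounded.exists_bound_of_approx hApprox.g_approx
  obtain ⟨CD, hCD⟩ := hPenalty.D_bounded
  have hnoise := isBigOP_truncNoise (τ := τ) (D := D) hStanding hError
    hApprox.lam_smooth.continuousOn hApprox.g_smooth.continuousOn hSmooth H hCg0 hCg hc σ hq hJ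
  have hlm := SpilloverModel.isBigOP_lamMean hStanding hDomain hMixing
    hApprox.lam_smooth.continuousOn hFirst.le_half
  have hctrl := isBigOP_ctrlErr hFirst
  set rate : ℕ → ℝ := fun n => √(q n / n) + B.bias μβ μg μlam n +
        B.tauStar τ D θβ (B.kron θg θlam) n + (n : ℝ) ^ (-ν) with hrate
  have r1 : ∀ n, 0 ≤ √(q n / n) := fun n => Real.sqrt_nonneg _
  have r2 := bias_nonneg (B := B) μβ μg μlam
  have r3 := tauStar_nonneg (D := D) hPenalty.τ_nonneg θβ (B.kron θg θlam)
  have r4 : ∀ n : ℕ, 0 ≤ (n : ℝ) ^ (-ν) := fun n => Real.rpow_nonneg (Nat.cast_nonneg n) _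
  have hdet : IsBigOP μ (fun n _ => B.bias μβ μg μlam n + B.tauStar τ D θβ (B.kron θg θlam) n)
      rate := by
    refine IsBigOP.of_deterministic (Eventually.of_forall fun n => ?_)
    rw [abs_of_nonneg (add_nonneg (r2 n) (r3 n)), hrate]
    linarith [r1 n, r4 n]
  have hA : ∀ᶠ n : ℕ in atTop, (n : ℝ) ^ (-ν) ≤ 1 * rate n := Eventually.of_forall fun n => by
    simp only [hrate]; linarith [r1 n, r2 n, r3 n]
  have hB : ∀ᶠ n : ℕ in atTop, √(q n / n) ≤ 1 * rate n := Eventually.of_forall fun n => by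
    simp only [hrate]; linarith [r4 n, r2 n, r3 n]
  have hlm' : IsBigOP μ (fun n ω => |M.lamMean n ω|) rate :=
    (hlm.mono_rate one_pos hA).of_le (WithHighProb.of_ae (p := fun _ _ => True)
      fun _ => Eventually.of_forall fun _ => trivial) one_pos
      (Eventually.of_forall fun n ω _ => by rw [abs_abs, one_mul])
  -- The constants in front of these terms are uniform in n, so it is enough to dominate the
  -- estimation error by a multiple of this sum on the good event.
  have htot := ((hdet.add (hctrl.mono_rate one_pos hA)).add hlm').add
    (hnoise.mono_rate one_pos hB)
  refine htot.of_le (C := CR / √c + √|CD| / c + 1) (hgood.inter (WithHighProb.of_ae hCX))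
    (by positivity) ?_
  filter_upwards [hCR, hCD, eventually_gt_atTop 0] with n hR hD hn
  rintro ω ⟨hω, hX⟩
  have hδ := ctrlErr_nonneg H n ω
  have hm := abs_nonneg (M.lamMean n ω)
  have hDq : ∀ v, v ⬝ᵥ (D n).mulVec v ≤ |CD| * (v ⬝ᵥ v) := fun v =>
    (hPenalty.D_psd n).1.dotProduct_le_of_spectrum_le
      (fun ρ hρ => (hD ρ hρ).trans (le_abs_self _)) v
  have hbound := norm_thetaHat_sub_le hPenalty.τ_nonneg hPenalty.D_psd H hc
    (by have := r2 n; positivity) hn hDq hω hX (hR ω hX) (hσ n)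
  rw [abs_of_nonneg (norm_nonneg _)]
  refine hbound.trans ?_
  set b := B.bias μβ μg μlam n
  set s := B.tauStar τ D θβ (B.kron θg θlam) n
  set δ := ctrlErr H n ω
  set m := |M.lamMean n ω|
  set N := √(∑ j, B.truncNoise H τ D c n (σ n j) ω ^ 2)
  have hb : 0 ≤ b := r2 n
  have hs : 0 ≤ s := r3 n
  have hN : 0 ≤ N := Real.sqrt_nonneg _
  have hsum : |b + s + δ + m + N| = b + s + δ + m + N := abs_of_nonneg (by linarith)
  rw [hsum]
  have k1 : 0 ≤ CR / √c := by positivity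
  have k2 : 0 ≤ √|CD| / c := by positivity
  rw [mul_div_right_comm]
  set k₁ := CR / √c
  set k₂ := √|CD| / c
  have p1 := mul_nonneg k1 hs
  have p2 := mul_nonneg k1 hN
  have p3 := mul_nonneg k2 hb
  have p4 := mul_nonneg k2 hδ
  have p5 := mul_nonneg k2 hm
  have p6 := mul_nonneg k2 hN
  linarith

end Estimator

end SeriesBasis

end

/-! ### The two rates. -/

theorem theorem2 {Ω : Type*} [MeasurableSpace Ω] (μ : Measure Ω) [IsProbabilityMeasure μ]
    {d dx dz : ℕ} (M : SpilloverModel Ω d dx dz) (H : ControlEstimator M) (B : SeriesBasis)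
    (Δ : ℕ) (ν μβ μg μlam : ℝ) (κ ζU ζV τ : ℕ → ℝ)
    (D : ∀ n, Matrix (B.Idx dx n) (B.Idx dx n) ℝ)
    (θβ : ∀ n, B.IdxB dx n → ℝ) (θg : ∀ n, B.IdxTS n → ℝ) (θlam : ∀ n, B.IdxUV n → ℝ)
    (hStanding : M.Standing μ)
    (hDomain : M.SpatialDomain Δ)
    (hMixing : M.WeakDependence μ Δ)
    (hError : M.ErrorCondition μ)
    (hBounded : B.Bounded M.suppT M.suppS)
    (hSmooth : B.Smooth ζU ζV)
    (hEigen : B.EigenCondition M μ)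
    (hApprox : B.SeriesApproximation M μ θβ θg θlam μβ μg μlam)
    (hFirst : H.Rate μ ν)
    (hGrowth : B.Growth κ ζU ζV ν)
    (hPenalty : B.PenaltyCondition dx τ D) :
    IsBigOP μ
      (fun n ω => ‖WithLp.toLp 2 (fun k : B.IdxB dx n =>
        B.thetaHat H τ D n ω (Sum.inl k) - θβ n k)‖)
      (fun n => √(κ n / n) + B.bias μβ μg μlam n +
        B.tauStar τ D θβ (B.kron θg θlam) n + (n : ℝ) ^ (-ν)) ∧
    IsBigOP μ
      (fun n ω => ‖WithLp.toLp 2 (fun k : B.IdxG n =>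
        B.thetaHat H τ D n ω (Sum.inr k) - B.kron θg θlam n k)‖)
      (fun n => κ n / √(n : ℝ) + B.bias μβ μg μlam n +
        B.tauStar τ D θβ (B.kron θg θlam) n + (n : ℝ) ^ (-ν)) := by
  obtain ⟨Cκ, hCκ0, hCκ⟩ := hGrowth.exists_bounds
  constructor
  · exact SeriesBasis.isBigOP_thetaHat_block hStanding hDomain hMixing hError hBounded hSmooth
      hEigen hApprox hFirst hGrowth hPenalty (σ := fun n => Sum.inl) (fun n => Sum.inl_injective)
      (q := κ) (CJ := dx * Cκ) hGrowth.κ_pos (by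
        filter_upwards [hCκ] with n hn
        rw [SeriesBasis.card_IdxB, mul_assoc]
        exact mul_le_mul_of_nonneg_left hn.1 (Nat.cast_nonneg _))
  -- This block has K_TS K_UV = O(κ²) coordinates instead of O(κ), so only the noise rate changes,
  -- to √(κ²/n) = κ/√n. The bias and penalty bounds are for the whole coefficient vector and are
  -- common to both blocks.
  · have h := SeriesBasis.isBigOP_thetaHat_block hStanding hDomain hMixing hError hBounded hSmooth
      hEigen hApprox hFirst hGrowth hPenalty (σ := fun n => Sum.inr) (fun n => Sum.inr_injective)
      (q := fun n => κ n ^ 2) (CJ := Cκ ^ 2) (fun n => pow_pos (hGrowth.κ_pos n) 2) (by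
        filter_upwards [hCκ] with n hn
        rw [SeriesBasis.card_IdxG]
        calc _ ≤ Cκ * κ n * (Cκ * κ n) := mul_le_mul hn.1 hn.2.1
              (zero_le_one.trans (SeriesBasis.one_le_KUV n)) (by linarith [hn.2.2])
          _ = _ := by ring)
    have hr : ∀ n : ℕ, √(κ n ^ 2 / n) = κ n / √(n : ℝ) := fun n => by
      rw [Real.sqrt_div (by positivity), Real.sqrt_sq (hGrowth.κ_pos n).le]
    simp only [hr] at h
    exact h
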